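/- \textbf{Setting.} A source talks to a destination with the help of one half-duplex relay. The source-relay, source-destination and relay-destination gains $h,g_1,g_2$ are independent, circularly-symmetric complex Gaussian with mean $0$ and variance $1$, and stay constant during one codeword of $M$ sub-blocks of $T$ symbols each ($T$ even). The noises at the destination and at the relay are independent white circularly-symmetric complex Gaussian with variances $\sigma_v^2>0$ and $\sigma_w^2>0$; put $c=\sigma_v^2/\sigma_w^2$. At signal-to-noise ratio $\rho$ and rate $R$ bits per channel use, the source uses a random codebook of $\lceil 2^{MTR}\rceil$ codewords $(x_k)_{k=1}^{MT}$ with i.i.d. circularly-symmetric complex Gaussian symbols of variance $E=\rho\sigma_v^2$, and sends one of the (equiprobable) messages. \textbf{Protocol (simplified dynamic decode-and-forward).} The relay, which receives $hx_k+w_k$, listens to the first $M'$ sub-blocks, where $$M'=\min\Big\{M,\max\Big\{\Big\lceil\frac M2\Big\rceil,\Big\lceil\frac{MR}{\log_2(1+|h|^2c\rho)}\Big\rceil\Big\}\Big\},$$ finds the maximum-likelihood estimate $\hat x$ of the codeword from them, and for $k>M'T$ sends the Alamouti-type signal built from the future symbols of the source: $\tilde x_k=\hat x_{k+1}^*$ for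 $k=M'T+1,M'T+3,\dots$ and $\tilde x_k=-\hat x_{k-1}^*$ for $k=M'T+2,M'T+4,\dots$. The destination receives $y_k=g_1x_k+v_k$ for $k\le M'T$ and $y_k=g_1x_k+g_2\tilde x_k+v_k$ for $k>M'T$; it knows $g_1,g_2,M'$ and decides for the message that minimizes the Euclidean distance between $y$ and the noiseless signal it would receive if source and relay both sent that message (maximum-likelihood decoding given that the relay has decoded correctly). Let $P_e(\rho,R,M,T)$ be the probability that it decides wrongly, averaged over messages, codebook, gains and noises. \textbf{Statement.} Let $0\le r\le 1$ and let $R(\rho)$ be rates with multiplexing gain $r$, that is $\lim_{\rho\to\infty}R(\rho)/\log_2\rho=r$, that are bounded below by a positive constant for all large $\rho$ (this is automatic if $r>0$). Then there are numbers $d_M(r)$, $M\ge1$, such that \begin{itemize} \item for every $M$ and all sufficiently large even sub-block lengths (i.e. there is a threshold $T_0(\rho)$, which may depend on all the data above, such that this holds for every choice of even $T(\rho)\ge T_0(\rho)$) the protocol has diversity gain $d_M(r)$: $$-\lim_{\rho\to\infty}\frac{\log P_e(\rho,R(\rho),M,T(\rho))}{\log\rho}=d_M(r);$$ \item $\displaystyle\lim_{M\to\infty}d_M(r)=d(r)$,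 where $$d(r)=\begin{cases}2(1-r),&0\le r\le\frac12,\\ (1-r)/r,&\frac12\le r\le1,\end{cases}$$ which is the diversity-multiplexing tradeoff of the original dynamic decode-and-forward protocol. \end{itemize} The same holds if only the Alamouti modification is made, i.e. with the original waiting rule $M'=\min\{M,\lceil MR/\log_2(1+|h|^2c\rho)\rceil\}$. -/

import Mathlib

open MeasureTheory ProbabilityTheory Filter Topology

noncomputable section

namespace DDF

/-- The circularly-symmetric complex Gaussian law with mean zero and variance `v`:
independent real and imaginary parts, each real Gaussian with variance `v / 2`. -/
def complexGaussian (v : ℝ) : Measure ℂ :=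
  ((gaussianReal 0 (v / 2).toNNReal).prod (gaussianReal 0 (v / 2).toNNReal)).map
    (fun p : ℝ × ℝ => (⟨p.1, p.2⟩ : ℂ))

/-- The law of `n` independent complex Gaussian variables with mean zero and variance `v`. -/
def complexGaussianVec (n : ℕ) (v : ℝ) : Measure (Fin n → ℂ) :=
  Measure.pi (fun _ => complexGaussian v)

/-- The two rules for the first sub-block in which the relay may transmit: after any sub-block,
or only once the codeword is halfway through. -/
inductive StartRule
  | anytime
  | secondHalf

/-- The least number of sub-blocks, out of `M`, during which the relay has to listen. -/
def StartRule.minWait : StartRule → ℕ → ℕ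
  | .anytime, _ => 0
  | .secondHalf, M => ⌈(M : ℝ) / 2⌉₊

/-- The number `M'` of sub-blocks that the relay listens to before it transmits,
`M' = min {M, max {minWait, ⌈M R / log₂ (1 + |h|² c ρ)⌉}}`.
For `h = 0` the quotient is read as infinite. -/
def listenBlocks (rule : StartRule) (M : ℕ) (R c ρ : ℝ) (h : ℂ) : ℕ :=
  open Classical in
  if h = 0 then M
  else min M (max (rule.minWait M) ⌈(M : ℝ) * R / Real.logb 2 (1 + ‖h‖ ^ 2 * c * ρ)⌉₊)

/-- The number of messages of a code of rate `R` bits per channel use and length `n`. -/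
def numMessages (R : ℝ) (n : ℕ) : ℕ := ⌈(2 : ℝ) ^ ((n : ℝ) * R)⌉₊

instance (R : ℝ) (n : ℕ) : NeZero (numMessages R n) :=
  ⟨(Nat.ceil_pos.mpr (Real.rpow_pos_of_pos two_pos _)).ne'⟩

/-- The (first) index at which a finite family of real numbers is minimal. -/
def argminIdx {N : ℕ} [NeZero N] (D : Fin N → ℝ) : Fin N :=
  (Finset.univ.filter (fun m => ∀ m', D m ≤ D m')).min' (by
    obtain ⟨m, -, hm⟩ := Finset.exists_min_image Finset.univ D
      ⟨⟨0, Nat.pos_of_ne_zero (NeZero.ne N)⟩, Finset.mem_univ _⟩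
    exact ⟨m, Finset.mem_filter.mpr ⟨Finset.mem_univ _, fun m' => hm m' (Finset.mem_univ _)⟩⟩)

/-- The `j`-th symbol of the word `x` (symbols are numbered from `0`). -/
def sym {n : ℕ} (x : Fin n → ℂ) (j : ℕ) : ℂ := if hj : j < n then x ⟨j, hj⟩ else 0

/-- The relay signal that is formed from the codeword `x` when the relay listens for the first
`s` symbol intervals: silence up to there, and from there on the Alamouti signal
`x*_{s+1}, -x*_s, x*_{s+3}, -x*_{s+2}, …`. -/
def relaySignal {n : ℕ} (s : ℕ) (x : Fin n → ℂ) (k : Fin n) : ℂ :=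
  if (k : ℕ) < s then 0
  else if Even ((k : ℕ) - s) then starRingEnd ℂ (sym x (k + 1))
  else -starRingEnd ℂ (sym x (k - 1))

/-- The decision of the relay: maximum-likelihood (minimum-distance) decoding of the signal
`h x_k + w_k` received in the first `s` symbol intervals, when message `m` is sent. -/
def relayDecision {N n : ℕ} [NeZero N] (s : ℕ) (C : Fin N → Fin n → ℂ) (h : ℂ)
    (w : Fin n → ℂ) (m : Fin N) : Fin N :=
  argminIdx (fun m' => ∑ k : Fin n,
    if (k : ℕ) < s then ‖(h * C m k + w k) - h * C m' k‖ ^ 2 else 0)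

/-- The signal received by the destination when the source sends message `m` and the relay sends
the signal for message `m₁`. -/
def received {N n : ℕ} (s : ℕ) (C : Fin N → Fin n → ℂ) (g₁ g₂ : ℂ) (v : Fin n → ℂ)
    (m m₁ : Fin N) (k : Fin n) : ℂ :=
  g₁ * C m k + g₂ * relaySignal s (C m₁) k + v k

/-- The decision of the destination on the received signal `y`: maximum-likelihood
(minimum-distance) decoding for the channel in which source and relay send the same message. -/
def destDecision {N n : ℕ} [NeZero N] (s : ℕ) (C : Fin N → Fin n → ℂ) (g₁ g₂ : ℂ)
    (y : Fin n → ℂ) : Fin N :=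
  argminIdx (fun m' => ∑ k : Fin n,
    ‖y k - (g₁ * C m' k + g₂ * relaySignal s (C m') k)‖ ^ 2)

/-- All the randomness of one use of the protocol: the codebook, the channel gains
`(h, g₁, g₂)` of the source-relay, source-destination and relay-destination links, the noise at
the relay and the noise at the destination. -/
abbrev Outcome (N n : ℕ) : Type :=
  (Fin N → Fin n → ℂ) × (ℂ × ℂ × ℂ) × (Fin n → ℂ) × (Fin n → ℂ)

/-- The joint law: everything is independent, code symbols have variance `E`, gains have
variance one, noises have variances `σw2` (relay) and `σv2` (destination). -/
def law (N n : ℕ) (E σv2 σw2 : ℝ) : Measure (Outcome N n) :=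
  (Measure.pi (fun _ => complexGaussianVec n E)).prod
    (((complexGaussian 1).prod ((complexGaussian 1).prod (complexGaussian 1))).prod
      ((complexGaussianVec n σw2).prod (complexGaussianVec n σv2)))

/-- The event that the destination decides for a wrong message when `m` is sent. The codeword
consists of `M` sub-blocks of `T` symbols. -/
def errorEvent (rule : StartRule) (M T : ℕ) (R c ρ : ℝ)
    (m : Fin (numMessages R (M * T))) : Set (Outcome (numMessages R (M * T)) (M * T)) :=
  {ω |
    let C := ω.1
    let h := ω.2.1.1
    let g₁ := ω.2.1.2.1
    let g₂ := ω.2.1.2.2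
    let w := ω.2.2.1
    let v := ω.2.2.2
    let s := listenBlocks rule M R c ρ h * T
    destDecision s C g₁ g₂ (received s C g₁ g₂ v m (relayDecision s C h w m)) ≠ m}

/-- The error probability of the protocol at signal-to-noise ratio `ρ = E / σv2` and rate `R`
(bits per channel use), for equiprobable messages and averaged over the channel gains, the noises
and the Gaussian codebook of the source. -/
def errorProb (rule : StartRule) (σv2 σw2 : ℝ) (M T : ℕ) (R ρ : ℝ) : ℝ :=
  (∑ m : Fin (numMessages R (M * T)),
    (law (numMessages R (M * T)) (M * T) (ρ * σv2) σv2 σw2).real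
      (errorEvent rule M T R (σv2 / σw2) ρ m)) / (numMessages R (M * T) : ℝ)

/-- `R`, in bits per channel use, has multiplexing gain `r`. -/
def HasMultiplexingGain (R : ℝ → ℝ) (r : ℝ) : Prop :=
  Tendsto (fun ρ => R ρ / Real.logb 2 ρ) atTop (𝓝 r)

/-- The error probability `Pe`, as a function of the signal-to-noise ratio, has diversity
gain `d`. -/
def HasDiversityGain (Pe : ℝ → ℝ) (d : ℝ) : Prop :=
  Tendsto (fun ρ => -(Real.log (Pe ρ) / Real.log ρ)) atTop (𝓝 d)

/-- The diversity-multiplexing tradeoff of dynamic decode-and-forward. -/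
def tradeoff (r : ℝ) : ℝ := if r ≤ 1 / 2 then 2 * (1 - r) else (1 - r) / r

end DDF

end

/-!
Fix the signal-to-noise ratio `ρ` and let the sub-blocks become long. Given the channel gains, both
the source-relay link while the relay listens and the link to the destination, once the relay sends
the signal for the correct message, are channels `signal a b c s`: a scalar channel followed by an
Alamouti channel. By orthogonality of the Alamouti scheme (`sum_norm_sq_signal`,
`sum_re_conj_mul_signal`) such a channel, used with Gaussian inputs, has the same information
density statistics as parallel scalar channels; in particular its outputs are independent. A
Chebyshev bound (`exists_measure_infoDensity_le`) concentrates the normalised information density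
at the mutual information, so that the random code is reliable below it
(`exists_tendsto_measure_argminIdx_ne`) and every decoder fails above it
(`exists_tendsto_sum_measure_decode`, a strong converse by change of measure). The waiting rule
makes the relay's channel support the rate strictly for almost every gain (`ae_relayReliable`),
and a relay that stays silent does no harm. Dominated convergence over the gains therefore puts the
error probability between the outage probabilities `destInfo < R log 2` and `destInfo ≤ R log 2`,
up to any prescribed error (`exists_subblock_threshold`). That error is taken to be half of the
outage probability, which does not affect exponents.

It remains to find the exponent of the outage probability in `ρ`. The probability that the relay
listens to more than `k` sub-blocks has exponent `listenExponent rule r M k`. If the relay listens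
to a fraction `l` of the codeword, outage of the destination has exponent `outageExponent r l`:
the upper bound on the probability is a Markov bound with negative moments of the gains
(`exponentGE_mutualInfo`), the lower bound restricts the gains to a box (`exponentLE_mutualInfo`).
Since the mutual information decreases in the listening time, a union bound over `k` and a single
best `k` give matching bounds, and the diversity gain is
`diversity rule r M = min_k (listenExponent rule r M k + outageExponent r ((k + 1) / M))`.
As `M → ∞` this minimum tends to the infimum over `l` of
`max (1 - r / l) 0 + outageExponent r l` for `l > 1 / 2` and of `2 * (1 - r)`, which is
`tradeoff r` (`diversity_le_tradeoff`, `tradeoff_sub_le_diversity`). Waiting for half of the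
codeword costs nothing, as `outageExponent r l = 2 * (1 - r)` for all `l ≤ 1 / 2`.
-/

noncomputable section

namespace DDF

open scoped ENNReal

/-! ### Complex Gaussian laws -/

lemma measurable_complexMk : Measurable (fun p : ℝ × ℝ => (⟨p.1, p.2⟩ : ℂ)) :=
  Complex.measurableEquivRealProd.symm.measurable

instance (v : ℝ) : IsProbabilityMeasure (complexGaussian v) :=
  Measure.isProbabilityMeasure_map measurable_complexMk.aemeasurable

instance (n : ℕ) (v : ℝ) : IsProbabilityMeasure (complexGaussianVec n v) := by
  unfold complexGaussianVec; infer_instance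

instance (n : ℕ) (v : ℝ) : SFinite (complexGaussianVec n v) := by
  have : IsFiniteMeasure (complexGaussianVec n v) := inferInstance
  infer_instance

instance (N n : ℕ) (E σv2 σw2 : ℝ) : IsProbabilityMeasure (law N n E σv2 σw2) := by
  unfold law; infer_instance

lemma norm_sq_eq_re_im (z : ℂ) : ‖z‖ ^ 2 = z.re ^ 2 + z.im ^ 2 := by
  rw [← Complex.normSq_eq_norm_sq, Complex.normSq_apply]; ring

lemma complexGaussian_eq_withDensity {v : ℝ} (hv : 0 < v) :
    complexGaussian v = (volume : Measure ℂ).withDensity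
      (fun z => ENNReal.ofReal ((Real.pi * v)⁻¹ * Real.exp (-(‖z‖ ^ 2 / v)))) := by
  have hv2 : (v / 2).toNNReal ≠ 0 := by
    simpa using hv
  have hprod : (gaussianReal 0 (v / 2).toNNReal).prod (gaussianReal 0 (v / 2).toNNReal) =
      (volume : Measure (ℝ × ℝ)).withDensity
        (fun p => ENNReal.ofReal ((Real.pi * v)⁻¹ * Real.exp (-((p.1 ^ 2 + p.2 ^ 2) / v)))) := by
    rw [gaussianReal_of_var_ne_zero _ hv2,
      prod_withDensity (measurable_gaussianPDF _ _) (measurable_gaussianPDF _ _)]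
    congr 1
    funext p
    rw [gaussianPDF_def, ← ENNReal.ofReal_mul (gaussianPDFReal_nonneg _ _ _)]
    congr 1
    have h1 : ((v / 2).toNNReal : ℝ) = v / 2 := Real.coe_toNNReal _ (by positivity)
    simp only [gaussianPDFReal_def, h1, sub_zero]
    have h2 : 2 * Real.pi * (v / 2) = Real.pi * v := by ring
    rw [h2, show -((p.1 ^ 2 + p.2 ^ 2) / v) = -p.1 ^ 2 / (2 * (v / 2)) + -p.2 ^ 2 / (2 * (v / 2)) by
      field_simp; ring, Real.exp_add]
    have h3 : (√(Real.pi * v))⁻¹ * (√(Real.pi * v))⁻¹ = (Real.pi * v)⁻¹ := by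
      rw [← mul_inv, Real.mul_self_sqrt (by positivity)]
    rw [← h3]; ring
  have hvol : Measure.map (fun p : ℝ × ℝ => (⟨p.1, p.2⟩ : ℂ)) volume = (volume : Measure ℂ) :=
    (Complex.volume_preserving_equiv_real_prod.symm).map_eq
  have hm : Measurable (fun z : ℂ =>
      ENNReal.ofReal ((Real.pi * v)⁻¹ * Real.exp (-(‖z‖ ^ 2 / v)))) := by fun_prop
  ext s hs
  rw [complexGaussian, hprod, Measure.map_apply measurable_complexMk hs,
    withDensity_apply _ (measurable_complexMk hs), withDensity_apply _ hs]
  conv_rhs => rw [← hvol]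
  rw [setLIntegral_map hs hm measurable_complexMk]
  refine lintegral_congr fun p => ?_
  rw [norm_sq_eq_re_im]

/-- Expectations under a complex Gaussian law as integrals against Lebesgue measure. -/
lemma lintegral_complexGaussian {v : ℝ} (hv : 0 < v) {f : ℂ → ℝ≥0∞} (hf : Measurable f) :
    ∫⁻ z, f z ∂complexGaussian v =
      ∫⁻ z, ENNReal.ofReal ((Real.pi * v)⁻¹ * Real.exp (-(‖z‖ ^ 2 / v))) * f z := by
  rw [complexGaussian_eq_withDensity hv, lintegral_withDensity_eq_lintegral_mul _ (by fun_prop) hf]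
  rfl

lemma complexGaussian_absolutelyContinuous {v : ℝ} (hv : 0 < v) :
    complexGaussian v ≪ (volume : Measure ℂ) := by
  rw [complexGaussian_eq_withDensity hv]; exact withDensity_absolutelyContinuous _ _

/-- A translate of a centred complex Gaussian law has a density with respect to any other centred
complex Gaussian law. -/
lemma complexGaussian_map_add {σ2 τ : ℝ} (hσ : 0 < σ2) (hτ : 0 < τ) (s : ℂ) :
    (complexGaussian σ2).map (fun z => s + z) = (complexGaussian τ).withDensity
      (fun y => ENNReal.ofReal (τ / σ2 * Real.exp (‖y‖ ^ 2 / τ - ‖y - s‖ ^ 2 / σ2))) := by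
  ext A hA
  rw [← lintegral_indicator_one hA, lintegral_map (by fun_prop) (by fun_prop),
    lintegral_complexGaussian hσ (by fun_prop), withDensity_apply _ hA, ← lintegral_indicator hA,
    lintegral_complexGaussian hτ (by fun_prop)]
  rw [← lintegral_sub_right_eq_self _ s]
  refine lintegral_congr fun y => ?_
  have : s + (y - s) = y := by ring
  rw [this]
  by_cases hy : y ∈ A
  · simp only [Set.indicator_of_mem hy, Pi.one_apply, mul_one]
    rw [← ENNReal.ofReal_mul (by positivity)]
    congr 1
    rw [sub_eq_add_neg (‖y‖ ^ 2 / τ), Real.exp_add, Real.exp_neg (‖y‖ ^ 2 / τ)]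
    have := (Real.exp_pos (‖y‖ ^ 2 / τ)).ne'
    field_simp
  · simp [Set.indicator_of_notMem hy]

/-- Gaussian integral obtained by completing the square. -/
lemma lintegral_exp_quadratic {E σ2 G : ℝ} (hE : 0 < E) (hσ : 0 < σ2) (hG : 0 ≤ G) (u : ℂ) :
    ∫⁻ x, ENNReal.ofReal (Real.exp ((2 * (starRingEnd ℂ u * x).re - G * ‖x‖ ^ 2) / σ2))
        ∂complexGaussian E =
      ENNReal.ofReal (σ2 / (σ2 + G * E) * Real.exp (‖u‖ ^ 2 * E / ((σ2 + G * E) * σ2))) := by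
  have hτ : 0 < σ2 + G * E := by positivity
  -- The integrand is, up to a constant, the density of a Gaussian law of variance `w` centred
  -- at `s`.
  set w : ℝ := E * σ2 / (σ2 + G * E) with hw
  have hw0 : 0 < w := by positivity
  set s : ℂ := u * ((E / (σ2 + G * E) : ℝ) : ℂ) with hs
  rw [lintegral_complexGaussian hE (by fun_prop)]
  have h1 : ∫⁻ z, ENNReal.ofReal ((Real.pi * w)⁻¹ * Real.exp (-(‖z - s‖ ^ 2 / w))) = 1 := by
    rw [lintegral_sub_right_eq_self (fun z : ℂ =>
      ENNReal.ofReal ((Real.pi * w)⁻¹ * Real.exp (-(‖z‖ ^ 2 / w)))) s]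
    have := lintegral_complexGaussian hw0 (f := fun _ => 1) measurable_const
    simpa using this.symm
  have h2 : ∀ z : ℂ, ENNReal.ofReal ((Real.pi * E)⁻¹ * Real.exp (-(‖z‖ ^ 2 / E))) *
      ENNReal.ofReal (Real.exp ((2 * (starRingEnd ℂ u * z).re - G * ‖z‖ ^ 2) / σ2)) =
      ENNReal.ofReal (σ2 / (σ2 + G * E) * Real.exp (‖u‖ ^ 2 * E / ((σ2 + G * E) * σ2))) *
      ENNReal.ofReal ((Real.pi * w)⁻¹ * Real.exp (-(‖z - s‖ ^ 2 / w))) := by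
    intro z
    rw [← ENNReal.ofReal_mul (by positivity), ← ENNReal.ofReal_mul (by positivity)]
    congr 1
    have e : -(‖z‖ ^ 2 / E) + (2 * (starRingEnd ℂ u * z).re - G * ‖z‖ ^ 2) / σ2 =
        ‖u‖ ^ 2 * E / ((σ2 + G * E) * σ2) + -(‖z - s‖ ^ 2 / w) := by
      simp only [norm_sq_eq_re_im,
        hs, hw, Complex.mul_re, Complex.mul_im, Complex.conj_re, Complex.conj_im,
        Complex.sub_re, Complex.sub_im, Complex.ofReal_re, Complex.ofReal_im]
      field_simp
      ring
    rw [mul_assoc, ← Real.exp_add, e, Real.exp_add, hw]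
    field_simp
  simp_rw [h2]
  rw [lintegral_const_mul _ (by fun_prop), h1, mul_one]

lemma map_re_complexGaussian (v : ℝ) :
    (complexGaussian v).map Complex.re = gaussianReal 0 (v / 2).toNNReal := by
  rw [complexGaussian, Measure.map_map Complex.measurable_re measurable_complexMk]
  exact (measurePreserving_fst (μ := gaussianReal 0 (v / 2).toNNReal)
    (ν := gaussianReal 0 (v / 2).toNNReal)).map_eq

lemma map_im_complexGaussian (v : ℝ) :
    (complexGaussian v).map Complex.im = gaussianReal 0 (v / 2).toNNReal := by
  rw [complexGaussian, Measure.map_map Complex.measurable_im measurable_complexMk]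
  exact (measurePreserving_snd (μ := gaussianReal 0 (v / 2).toNNReal)
    (ν := gaussianReal 0 (v / 2).toNNReal)).map_eq

lemma memLp_re_complexGaussian (v : ℝ) (p : ℝ≥0∞) (hp : p ≠ ∞) :
    MemLp Complex.re p (complexGaussian v) :=
  (memLp_map_measure_iff (g := id) (f := Complex.re) (by fun_prop) (by fun_prop)).1
    (by rw [map_re_complexGaussian]; exact memLp_id_gaussianReal' p hp)

lemma memLp_im_complexGaussian (v : ℝ) (p : ℝ≥0∞) (hp : p ≠ ∞) :
    MemLp Complex.im p (complexGaussian v) :=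
  (memLp_map_measure_iff (g := id) (f := Complex.im) (by fun_prop) (by fun_prop)).1
    (by rw [map_im_complexGaussian]; exact memLp_id_gaussianReal' p hp)

lemma integral_gaussianReal_sq {v : ℝ} (hv : 0 ≤ v) :
    ∫ x, x ^ 2 ∂gaussianReal 0 (v / 2).toNNReal = v / 2 := by
  have := variance_of_integral_eq_zero (X := id) (μ := gaussianReal 0 (v / 2).toNNReal)
    (by fun_prop) (by simp)
  rw [variance_id_gaussianReal] at this
  simpa [Real.coe_toNNReal _ (by positivity : 0 ≤ v / 2)] using this.symm

lemma memLp_norm_sq_complexGaussian (v : ℝ) :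
    MemLp (fun z : ℂ => ‖z‖ ^ 2) 2 (complexGaussian v) := by
  simp_rw [norm_sq_eq_re_im]
  have key : ∀ f : ℂ → ℝ, MemLp f 4 (complexGaussian v) →
      MemLp (fun z => f z ^ 2) 2 (complexGaussian v) := by
    intro f hf
    have : (4 : ℝ≥0∞) / 2 = 2 := by
      rw [ENNReal.div_eq_inv_mul, show (4 : ℝ≥0∞) = 2 * 2 by norm_num, ← mul_assoc,
        ENNReal.inv_mul_cancel (by norm_num) (by norm_num), one_mul]
    have h := hf.norm_rpow_div (2 : ℝ≥0∞)
    rw [this] at h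
    refine h.congr_norm ((hf.aestronglyMeasurable).pow 2) ?_
    filter_upwards with z
    simp
  exact (key _ (memLp_re_complexGaussian v 4 (by norm_num))).add
    (key _ (memLp_im_complexGaussian v 4 (by norm_num)))

lemma integrable_norm_sq_complexGaussian (v : ℝ) :
    Integrable (fun z : ℂ => ‖z‖ ^ 2) (complexGaussian v) :=
  (memLp_norm_sq_complexGaussian v).integrable (by norm_num)

lemma integral_norm_sq_complexGaussian {v : ℝ} (hv : 0 ≤ v) :
    ∫ z, ‖z‖ ^ 2 ∂complexGaussian v = v := by
  have h1 : ∫ z : ℂ, z.re ^ 2 ∂complexGaussian v = v / 2 := by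
    rw [← integral_gaussianReal_sq hv, ← map_re_complexGaussian,
      integral_map (by fun_prop) (by fun_prop)]
  have h2 : ∫ z : ℂ, z.im ^ 2 ∂complexGaussian v = v / 2 := by
    rw [← integral_gaussianReal_sq hv, ← map_im_complexGaussian,
      integral_map (by fun_prop) (by fun_prop)]
  simp_rw [norm_sq_eq_re_im]
  rw [integral_add (memLp_re_complexGaussian v 2 (by norm_num)).integrable_sq
    (memLp_im_complexGaussian v 2 (by norm_num)).integrable_sq, h1, h2]
  ring

lemma integral_re_complexGaussian (v : ℝ) : ∫ z : ℂ, z.re ∂complexGaussian v = 0 := by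
  have := integral_map (μ := complexGaussian v) (φ := Complex.re) (f := fun x : ℝ => x)
    (by fun_prop) (by fun_prop)
  rw [← this, map_re_complexGaussian]; simp

lemma integral_im_complexGaussian (v : ℝ) : ∫ z : ℂ, z.im ∂complexGaussian v = 0 := by
  have := integral_map (μ := complexGaussian v) (φ := Complex.im) (f := fun x : ℝ => x)
    (by fun_prop) (by fun_prop)
  rw [← this, map_im_complexGaussian]; simp

lemma memLp_re_mul_complexGaussian (v : ℝ) (c : ℂ) :
    MemLp (fun z : ℂ => (c * z).re) 2 (complexGaussian v) := by
  simp_rw [Complex.mul_re]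
  exact ((memLp_re_complexGaussian v 2 (by norm_num)).const_mul _).sub
    ((memLp_im_complexGaussian v 2 (by norm_num)).const_mul _)

lemma integral_re_mul_complexGaussian (v : ℝ) (c : ℂ) :
    ∫ z : ℂ, (c * z).re ∂complexGaussian v = 0 := by
  simp_rw [Complex.mul_re]
  rw [integral_sub
    (((memLp_re_complexGaussian v 2 (by norm_num)).const_mul _).integrable (by norm_num))
    (((memLp_im_complexGaussian v 2 (by norm_num)).const_mul _).integrable (by norm_num)),
    integral_const_mul, integral_const_mul, integral_re_complexGaussian,
    integral_im_complexGaussian]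
  simp

lemma variance_re_mul_complexGaussian_le {v : ℝ} (hv : 0 ≤ v) (c : ℂ) :
    Var[fun z : ℂ => (c * z).re; complexGaussian v] ≤ ‖c‖ ^ 2 * v := by
  refine (variance_le_expectation_sq (by fun_prop)).trans ?_
  calc ∫ z : ℂ, ((fun z : ℂ => (c * z).re) ^ 2) z ∂complexGaussian v
      ≤ ∫ z : ℂ, ‖c‖ ^ 2 * ‖z‖ ^ 2 ∂complexGaussian v := by
        refine integral_mono (memLp_re_mul_complexGaussian v c).integrable_sq
          ((integrable_norm_sq_complexGaussian v).const_mul _) fun z => ?_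
        simp only [Pi.pow_apply]
        rw [← mul_pow, ← norm_mul, norm_sq_eq_re_im]
        nlinarith [sq_nonneg (c * z).im]
    _ = ‖c‖ ^ 2 * v := by rw [integral_const_mul, integral_norm_sq_complexGaussian hv]

/-- With `le_complexGaussian_one_ball`: small gains of order `x` have probability of order `x`,
which is the source of all exponents. -/
lemma complexGaussian_one_ball_le {x : ℝ} (hx : 0 ≤ x) :
    complexGaussian 1 {z | ‖z‖ ^ 2 < x} ≤ ENNReal.ofReal x := by
  have hs : {z : ℂ | ‖z‖ ^ 2 < x} = Metric.ball 0 (√x) := by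
    ext z; simp [Real.lt_sqrt (norm_nonneg z)]
  rw [complexGaussian_eq_withDensity one_pos, hs, withDensity_apply _ measurableSet_ball]
  calc ∫⁻ z in Metric.ball (0 : ℂ) (√x),
        ENNReal.ofReal ((Real.pi * 1)⁻¹ * Real.exp (-(‖z‖ ^ 2 / 1)))
      ≤ ∫⁻ _ in Metric.ball (0 : ℂ) (√x), ENNReal.ofReal (Real.pi⁻¹) := by
        refine lintegral_mono fun z => ENNReal.ofReal_le_ofReal ?_
        have : Real.exp (-(‖z‖ ^ 2 / 1)) ≤ 1 := Real.exp_le_one_iff.2 (by simp)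
        have hpi := inv_pos.2 Real.pi_pos
        rw [mul_one]; nlinarith
    _ = ENNReal.ofReal x := by
        rw [setLIntegral_const, Complex.volume_ball, ← ENNReal.ofReal_pow (Real.sqrt_nonneg x),
          Real.sq_sqrt hx, show (NNReal.pi : ℝ≥0∞) = ENNReal.ofReal Real.pi by
            rw [← NNReal.coe_real_pi, ENNReal.ofReal_coe_nnreal],
          ← ENNReal.ofReal_mul hx, ← ENNReal.ofReal_mul (by positivity)]
        congr 1
        field_simp

lemma le_complexGaussian_one_ball {x : ℝ} (hx : 0 ≤ x) (hx1 : x ≤ 1) :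
    ENNReal.ofReal (Real.exp (-1) * x) ≤ complexGaussian 1 {z | ‖z‖ ^ 2 < x} := by
  have hs : {z : ℂ | ‖z‖ ^ 2 < x} = Metric.ball 0 (√x) := by
    ext z; simp [Real.lt_sqrt (norm_nonneg z)]
  have hms : MeasurableSet {z : ℂ | ‖z‖ ^ 2 < x} := by rw [hs]; exact measurableSet_ball
  rw [complexGaussian_eq_withDensity one_pos, withDensity_apply _ hms]
  calc ENNReal.ofReal (Real.exp (-1) * x)
      = ∫⁻ _ in {z : ℂ | ‖z‖ ^ 2 < x}, ENNReal.ofReal (Real.pi⁻¹ * Real.exp (-1)) := by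
        rw [setLIntegral_const, hs, Complex.volume_ball, ← ENNReal.ofReal_pow (Real.sqrt_nonneg x),
          Real.sq_sqrt hx, show (NNReal.pi : ℝ≥0∞) = ENNReal.ofReal Real.pi by
            rw [← NNReal.coe_real_pi, ENNReal.ofReal_coe_nnreal],
          ← ENNReal.ofReal_mul hx, ← ENNReal.ofReal_mul (by positivity)]
        congr 1
        field_simp
    _ ≤ ∫⁻ z in {z : ℂ | ‖z‖ ^ 2 < x},
        ENNReal.ofReal ((Real.pi * 1)⁻¹ * Real.exp (-(‖z‖ ^ 2 / 1))) := by
        refine setLIntegral_mono' hms fun z hz => ENNReal.ofReal_le_ofReal ?_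
        rw [mul_one, div_one]
        have : Real.exp (-1) ≤ Real.exp (-‖z‖ ^ 2) :=
          Real.exp_le_exp.2 (by have := hz.out; linarith)
        gcongr

/-- The negative moments of a link gain are finite below order one. -/
lemma lintegral_norm_rpow_complexGaussian_one_lt_top {b : ℝ} (hb : b < 1) :
    ∫⁻ z, ENNReal.ofReal (‖z‖ ^ (-2 * b)) ∂complexGaussian 1 < ∞ := by
  have hint : Integrable (fun z : ℂ => ‖z‖ ^ (-2 * b) * Real.exp (-‖z‖ ^ (2 : ℝ))) := by
    -- A non-integrable function would have integral `0` by convention, but the value is positive.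
    by_contra hcon
    have h := Complex.integral_rpow_mul_exp_neg_rpow (p := 2) (q := -2 * b) (by norm_num)
      (by linarith)
    rw [integral_undef hcon] at h
    have : 0 < (2 * Real.pi / 2) * Real.Gamma ((-2 * b + 2) / 2) :=
      mul_pos (by positivity) (Real.Gamma_pos_of_pos (by linarith))
    exact this.ne h
  rw [lintegral_complexGaussian one_pos (by fun_prop)]
  have h2 := (hint.const_mul Real.pi⁻¹).lintegral_lt_top
  refine lt_of_eq_of_lt (lintegral_congr fun z => ?_) h2
  rw [← ENNReal.ofReal_mul (by positivity)]
  congr 1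
  rw [mul_one, div_one, Real.rpow_two]
  ring

lemma lintegral_pi_prod {n : ℕ} {μ : Fin n → Measure ℂ} [∀ k, IsProbabilityMeasure (μ k)]
    {f : Fin n → ℂ → ℝ≥0∞} (hf : ∀ k, Measurable (f k)) :
    ∫⁻ x, ∏ k, f k (x k) ∂Measure.pi μ = ∏ k, ∫⁻ z, f k z ∂μ k := by
  have h := lintegral_prod_eq_prod_lintegral_of_indepFun Finset.univ
    (fun k (x : Fin n → ℂ) => f k (x k))
    (iIndepFun_pi (μ := μ) (X := f) fun k => (hf k).aemeasurable)
    (fun k => (hf k).comp (measurable_pi_apply k))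
  refine h.trans ?_
  refine Finset.prod_congr rfl fun k _ => ?_
  exact (measurePreserving_eval μ k).lintegral_comp (hf k)

lemma pi_eq_withDensity_prod {n : ℕ} {μ ν : Fin n → Measure ℂ} [∀ k, IsProbabilityMeasure (μ k)]
    [∀ k, IsProbabilityMeasure (ν k)] {f : Fin n → ℂ → ℝ≥0∞} (hf : ∀ k, Measurable (f k))
    (h : ∀ k, μ k = (ν k).withDensity (f k)) :
    Measure.pi μ = (Measure.pi ν).withDensity (fun x => ∏ k, f k (x k)) := by
  refine Measure.pi_eq fun s hs => ?_
  rw [withDensity_apply _ (MeasurableSet.univ_pi hs), ← lintegral_indicator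
    (MeasurableSet.univ_pi hs)]
  have : ∀ x : Fin n → ℂ, (Set.univ.pi s).indicator (fun x => ∏ k, f k (x k)) x =
      ∏ k, (s k).indicator (f k) (x k) := by
    intro x
    by_cases hx : x ∈ Set.univ.pi s
    · rw [Set.indicator_of_mem hx]
      exact Finset.prod_congr rfl fun k _ => (Set.indicator_of_mem (hx k trivial) _).symm
    · rw [Set.indicator_of_notMem hx]
      simp only [Set.mem_pi, Set.mem_univ, true_implies, not_forall] at hx
      obtain ⟨k, hk⟩ := hx
      exact (Finset.prod_eq_zero (Finset.mem_univ k) (Set.indicator_of_notMem hk _)).symm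
  simp_rw [this]
  rw [lintegral_pi_prod fun k => (hf k).indicator (hs k)]
  refine Finset.prod_congr rfl fun k _ => ?_
  rw [lintegral_indicator (hs k), h k, withDensity_apply _ (hs k)]

/-! ### Alamouti channels and their information density -/

/-- The noiseless output of a channel with gain `a` during the first `s` symbol intervals and
an Alamouti channel with gains `b` and `c` afterwards. With `a = b = g₁` and `c = g₂` this is the
destination's channel, with `b = c = 0` the channel from the source to the relay. -/
def signal {n : ℕ} (a b c : ℂ) (s : ℕ) (x : Fin n → ℂ) (k : Fin n) : ℂ :=
  if (k : ℕ) < s then a * x k else b * x k + c * relaySignal s x k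

/-- The power gain that the channel `signal a b c s` gives to the `k`-th symbol. -/
def gain (a b c : ℂ) (s k : ℕ) : ℝ := if k < s then ‖a‖ ^ 2 else ‖b‖ ^ 2 + ‖c‖ ^ 2

lemma gain_nonneg (a b c : ℂ) (s k : ℕ) : 0 ≤ gain a b c s k := by
  unfold gain; split_ifs <;> positivity

lemma gain_two_mul {s : ℕ} (hs : Even s) (a b c : ℂ) (j : ℕ) :
    gain a b c s (2 * j) = gain a b c s (2 * j + 1) := by
  obtain ⟨t, rfl⟩ := hs
  unfold gain
  by_cases h : 2 * j < t + t
  · rw [if_pos h, if_pos (by omega)]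
  · rw [if_neg h, if_neg (by omega)]

/-- Sums over an even number of symbols may be compared pair by pair. -/
lemma sum_fin_eq_of_pairs {n : ℕ} (hn : Even n) {f g : Fin n → ℝ}
    (h : ∀ (j : ℕ) (h0 : 2 * j < n) (h1 : 2 * j + 1 < n),
      f ⟨2 * j, h0⟩ + f ⟨2 * j + 1, h1⟩ = g ⟨2 * j, h0⟩ + g ⟨2 * j + 1, h1⟩) :
    ∑ k, f k = ∑ k, g k := by
  have key : ∀ (F G : ℕ → ℝ) (p : ℕ),
      (∀ j < p, F (2 * j) + F (2 * j + 1) = G (2 * j) + G (2 * j + 1)) →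
      ∑ i ∈ Finset.range (p + p), F i = ∑ i ∈ Finset.range (p + p), G i := by
    intro F G p
    induction p with
    | zero => simp
    | succ p ih =>
      intro hp
      have e : p + 1 + (p + 1) = p + p + 1 + 1 := by ring
      have := hp p (by omega)
      rw [e, Finset.sum_range_succ, Finset.sum_range_succ, Finset.sum_range_succ,
        Finset.sum_range_succ, ih fun j hj => hp j (by omega)]
      rw [two_mul] at this
      linarith
  obtain ⟨p, rfl⟩ := hn
  rw [Finset.sum_fin_eq_sum_range, Finset.sum_fin_eq_sum_range]
  refine key _ _ p fun j hj => ?_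
  rw [dif_pos (by omega), dif_pos (by omega), dif_pos (by omega), dif_pos (by omega)]
  exact h j (by omega) (by omega)

lemma signal_of_lt {n : ℕ} {a b c : ℂ} {s : ℕ} {x : Fin n → ℂ} {k : Fin n} (h : (k : ℕ) < s) :
    signal a b c s x k = a * x k := if_pos h

lemma signal_two_mul {n : ℕ} {a b c : ℂ} {s : ℕ} (hs : Even s) {x : Fin n → ℂ} {j : ℕ}
    (h0 : 2 * j < n) (h1 : 2 * j + 1 < n) (h : ¬ 2 * j < s) :
    signal a b c s x ⟨2 * j, h0⟩ =
      b * x ⟨2 * j, h0⟩ + c * starRingEnd ℂ (x ⟨2 * j + 1, h1⟩) := by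
  obtain ⟨t, rfl⟩ := hs
  have he : Even (2 * j - (t + t)) := ⟨j - t, by omega⟩
  simp only [signal, relaySignal, sym]
  rw [if_neg h, if_neg h, if_pos he, dif_pos h1]

lemma signal_two_mul_add_one {n : ℕ} {a b c : ℂ} {s : ℕ} (hs : Even s) {x : Fin n → ℂ} {j : ℕ}
    (h0 : 2 * j < n) (h1 : 2 * j + 1 < n) (h : ¬ 2 * j < s) :
    signal a b c s x ⟨2 * j + 1, h1⟩ =
      b * x ⟨2 * j + 1, h1⟩ - c * starRingEnd ℂ (x ⟨2 * j, h0⟩) := by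
  obtain ⟨t, rfl⟩ := hs
  have he : ¬ Even (2 * j + 1 - (t + t)) := by
    rintro ⟨r, hr⟩; omega
  simp only [signal, relaySignal, sym]
  rw [if_neg (by omega), if_neg (by omega), if_neg he, dif_pos (by omega)]
  simp only [Nat.add_sub_cancel, mul_neg]
  ring

/-- The Alamouti scheme is orthogonal: each symbol is received with the power gain of its block. -/
lemma sum_norm_sq_signal {n : ℕ} (hn : Even n) {s : ℕ} (hs : Even s) (a b c : ℂ)
    (x : Fin n → ℂ) {β : ℕ → ℝ} (hβ : ∀ j, β (2 * j) = β (2 * j + 1)) :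
    ∑ k : Fin n, β k * ‖signal a b c s x k‖ ^ 2 =
      ∑ k : Fin n, β k * gain a b c s k * ‖x k‖ ^ 2 := by
  refine sum_fin_eq_of_pairs hn fun j h0 h1 => ?_
  by_cases h : 2 * j < s
  · have h' : 2 * j + 1 < s := by obtain ⟨t, rfl⟩ := hs; omega
    rw [signal_of_lt (k := ⟨2 * j, h0⟩) h, signal_of_lt (k := ⟨2 * j + 1, h1⟩) h']
    simp only [gain, if_pos h, if_pos h', norm_mul, mul_pow]
    ring
  · have h' : ¬ 2 * j + 1 < s := by omega
    rw [signal_two_mul hs h0 h1 h, signal_two_mul_add_one hs h0 h1 h]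
    simp only [gain, if_neg h, if_neg h', ← hβ, norm_sq_eq_re_im, Complex.add_re, Complex.add_im,
      Complex.sub_re, Complex.sub_im, Complex.mul_re, Complex.mul_im, Complex.conj_re,
      Complex.conj_im]
    ring

/-- For the real inner product, the adjoint of an Alamouti channel is again of this form. -/
lemma sum_re_conj_mul_signal {n : ℕ} (hn : Even n) {s : ℕ} (hs : Even s) (a b c : ℂ)
    (x y : Fin n → ℂ) :
    ∑ k, (starRingEnd ℂ (y k) * signal a b c s x k).re =
      ∑ k, (starRingEnd ℂ (signal (starRingEnd ℂ a) (starRingEnd ℂ b) (-c) s y k) * x k).re := by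
  refine sum_fin_eq_of_pairs hn fun j h0 h1 => ?_
  by_cases h : 2 * j < s
  · have h' : 2 * j + 1 < s := by obtain ⟨t, rfl⟩ := hs; omega
    rw [signal_of_lt (k := ⟨2 * j, h0⟩) h, signal_of_lt (k := ⟨2 * j + 1, h1⟩) h',
      signal_of_lt (k := ⟨2 * j, h0⟩) h, signal_of_lt (k := ⟨2 * j + 1, h1⟩) h']
    simp only [map_mul, Complex.conj_conj]
    congr 2 <;> ring
  · rw [signal_two_mul hs h0 h1 h, signal_two_mul_add_one hs h0 h1 h,
      signal_two_mul hs h0 h1 h, signal_two_mul_add_one hs h0 h1 h]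
    simp only [Complex.add_re, Complex.add_im, map_add, map_sub, map_mul,
      Complex.sub_re, Complex.sub_im, Complex.mul_re, Complex.mul_im, Complex.conj_re,
      Complex.conj_im, Complex.neg_re, Complex.neg_im]
    ring

lemma gain_conj (a b c : ℂ) (s k : ℕ) :
    gain (starRingEnd ℂ a) (starRingEnd ℂ b) (-c) s k = gain a b c s k := by
  simp [gain]

lemma measurable_relaySignal {n : ℕ} (s : ℕ) (k : Fin n) :
    Measurable (fun x : Fin n → ℂ => relaySignal s x k) := by
  have hsym : ∀ j, Measurable (fun x : Fin n → ℂ => sym x j) := by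
    intro j; unfold sym; split_ifs <;> fun_prop
  unfold relaySignal
  split_ifs
  · fun_prop
  · exact Complex.continuous_conj.measurable.comp (hsym _)
  · exact (Complex.continuous_conj.measurable.comp (hsym _)).neg

lemma measurable_signal {n : ℕ} (a b c : ℂ) (s : ℕ) (k : Fin n) :
    Measurable (fun x : Fin n → ℂ => signal a b c s x k) := by
  have := measurable_relaySignal s k
  unfold signal
  split_ifs <;> fun_prop

/-- The information density (in nats) between the input `x` and the output `y` of the channel
`signal a b c s` with noise variance `σ2`, for Gaussian inputs of variance `E`: the logarithm of
the likelihood ratio of `y` given `x` and of `y` under the output law, in which the `y k` are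
independent with variances `σ2 + gain a b c s k * E`. -/
def infoDensity {n : ℕ} (σ2 E : ℝ) (a b c : ℂ) (s : ℕ) (x y : Fin n → ℂ) : ℝ :=
  ∑ k : Fin n, (Real.log ((σ2 + gain a b c s k * E) / σ2) + ‖y k‖ ^ 2 / (σ2 + gain a b c s k * E)
    - ‖y k - signal a b c s x k‖ ^ 2 / σ2)

lemma measurable_infoDensity {n : ℕ} (σ2 E : ℝ) (a b c : ℂ) (s : ℕ) :
    Measurable (fun p : (Fin n → ℂ) × (Fin n → ℂ) => infoDensity σ2 E a b c s p.1 p.2) := by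
  have := fun k => measurable_signal (n := n) a b c s k
  unfold infoDensity
  refine Finset.measurable_sum _ fun k _ => ?_
  have h : Measurable fun p : (Fin n → ℂ) × (Fin n → ℂ) => signal a b c s p.1 k :=
    (this k).comp measurable_fst
  fun_prop

lemma norm_sub_sq_complex (z w : ℂ) :
    ‖z - w‖ ^ 2 = ‖z‖ ^ 2 - 2 * (starRingEnd ℂ z * w).re + ‖w‖ ^ 2 := by
  simp only [norm_sq_eq_re_im, Complex.sub_re, Complex.sub_im, Complex.mul_re, Complex.conj_re,
    Complex.conj_im]
  ring

/-- The likelihood of an output, averaged over independent Gaussian inputs, is the density of the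
product output law. -/
lemma lintegral_exp_infoDensity {n : ℕ} (hn : Even n) {s : ℕ} (hs : Even s) {σ2 E : ℝ}
    (hσ : 0 < σ2) (hE : 0 < E) (a b c : ℂ) (y : Fin n → ℂ) :
    ∫⁻ x, ENNReal.ofReal (Real.exp (infoDensity σ2 E a b c s x y)) ∂complexGaussianVec n E = 1 := by
  set G : ℕ → ℝ := gain a b c s with hGdef
  have hG : ∀ k, 0 ≤ G k := gain_nonneg a b c s
  have hτ : ∀ k, 0 < σ2 + G k * E := fun k => by have := hG k; positivity
  set u : Fin n → ℂ := signal (starRingEnd ℂ a) (starRingEnd ℂ b) (-c) s y with hu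
  set A : ℝ := ∑ k : Fin n, (Real.log ((σ2 + G k * E) / σ2) + ‖y k‖ ^ 2 / (σ2 + G k * E)
    - ‖y k‖ ^ 2 / σ2) with hA
  -- By orthogonality and the adjoint `u` of the channel applied to `y`, the exponent splits into
  -- terms that depend on one symbol each.
  have hdec : ∀ x : Fin n → ℂ, infoDensity σ2 E a b c s x y =
      A + ∑ k : Fin n, (2 * (starRingEnd ℂ (u k) * x k).re - G k * ‖x k‖ ^ 2) / σ2 := by
    intro x
    have h1 := sum_re_conj_mul_signal hn hs a b c x y
    have h2 := sum_norm_sq_signal hn hs a b c x (β := fun _ => 1) (fun _ => rfl)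
    simp only [one_mul] at h2
    have h3 : ∑ k : Fin n, (2 * (starRingEnd ℂ (u k) * x k).re - G k * ‖x k‖ ^ 2) / σ2 =
        ∑ k : Fin n, (2 * (starRingEnd ℂ (y k) * signal a b c s x k).re -
          ‖signal a b c s x k‖ ^ 2) / σ2 := by
      rw [← Finset.sum_div, ← Finset.sum_div, Finset.sum_sub_distrib, Finset.sum_sub_distrib,
        ← Finset.mul_sum, ← Finset.mul_sum, h1, h2]
    rw [infoDensity, h3, hA, ← Finset.sum_add_distrib]
    refine Finset.sum_congr rfl fun k _ => ?_
    rw [norm_sub_sq_complex]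
    ring
  have hexp : ∀ x : Fin n → ℂ, ENNReal.ofReal (Real.exp (infoDensity σ2 E a b c s x y)) =
      ENNReal.ofReal (Real.exp A) * ∏ k : Fin n, ENNReal.ofReal
        (Real.exp ((2 * (starRingEnd ℂ (u k) * x k).re - G k * ‖x k‖ ^ 2) / σ2)) := by
    intro x
    rw [hdec, Real.exp_add, ENNReal.ofReal_mul (Real.exp_pos _).le,
      Real.exp_sum Finset.univ fun k : Fin n => (2 * (_ * x k).re - G k * ‖x k‖ ^ 2) / σ2,
      ENNReal.ofReal_prod_of_nonneg fun _ _ => (Real.exp_pos _).le]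
  simp_rw [hexp]
  rw [lintegral_const_mul _ (Finset.measurable_prod _ fun k _ => by fun_prop), complexGaussianVec,
    lintegral_pi_prod (f := fun k z => ENNReal.ofReal
      (Real.exp ((2 * (starRingEnd ℂ (u k) * z).re - G k * ‖z‖ ^ 2) / σ2)))
      (fun k => by fun_prop)]
  simp_rw [lintegral_exp_quadratic hE hσ (hG _)]
  rw [← ENNReal.ofReal_prod_of_nonneg
    (fun k _ => by have := hτ k; positivity), ← ENNReal.ofReal_mul (Real.exp_pos _).le]
  have hlog : ∀ k : Fin n, σ2 / (σ2 + G k * E) * Real.exp (‖u k‖ ^ 2 * E / ((σ2 + G k * E) * σ2)) =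
      Real.exp (Real.log (σ2 / (σ2 + G k * E)) + ‖u k‖ ^ 2 * E / ((σ2 + G k * E) * σ2)) := by
    intro k
    rw [Real.exp_add, Real.exp_log (by have := hτ k; positivity)]
  simp_rw [hlog]
  rw [← Real.exp_sum, ← Real.exp_add]
  -- The squares of `u` have the same gains, so that everything cancels.
  have hsum : A + ∑ k : Fin n, (Real.log (σ2 / (σ2 + G k * E)) +
      ‖u k‖ ^ 2 * E / ((σ2 + G k * E) * σ2)) = 0 := by
    have h2 := sum_norm_sq_signal hn hs (starRingEnd ℂ a) (starRingEnd ℂ b) (-c) y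
      (β := fun k => E / ((σ2 + G k * E) * σ2))
      (fun j => by simp only [hGdef]; rw [gain_two_mul hs])
    simp only [gain_conj] at h2
    have h3 : ∀ k : Fin n, ‖u k‖ ^ 2 * E / ((σ2 + G k * E) * σ2) =
        E / ((σ2 + G k * E) * σ2) * ‖u k‖ ^ 2 := fun k => by ring
    simp_rw [h3]
    rw [Finset.sum_add_distrib, h2, hA, ← Finset.sum_add_distrib, ← Finset.sum_add_distrib]
    refine Finset.sum_eq_zero fun k _ => ?_
    have := (hτ k).ne'
    rw [Real.log_div this hσ.ne', Real.log_div hσ.ne' this]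
    change _ + (_ + E / ((σ2 + G k * E) * σ2) * G k * ‖y k‖ ^ 2) = 0
    field_simp
    ring
  rw [hsum]
  simp

/-! ### Law of large numbers for the information density -/

/-- Chebyshev inequality for sums of independent centred variables. -/
lemma measure_pi_abs_sum_ge_le {n : ℕ} {μ : Fin n → Measure ℂ} [∀ k, IsProbabilityMeasure (μ k)]
    {X : Fin n → ℂ → ℝ} (hX : ∀ k, MemLp (X k) 2 (μ k)) (h0 : ∀ k, ∫ z, X k z ∂μ k = 0)
    {W : Fin n → ℝ} (hW : ∀ k, Var[X k; μ k] ≤ W k) {ε : ℝ} (hε : 0 < ε) :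
    Measure.pi μ {x | ε ≤ |∑ k, X k (x k)|} ≤ ENNReal.ofReal ((∑ k, W k) / ε ^ 2) := by
  have hmem : ∀ k, MemLp (fun x : Fin n → ℂ => X k (x k)) 2 (Measure.pi μ) := fun k =>
    (hX k).comp_measurePreserving (measurePreserving_eval μ k)
  have hsum : MemLp (∑ k, fun x : Fin n → ℂ => X k (x k)) 2 (Measure.pi μ) :=
    memLp_finsetSum' _ fun k _ => hmem k
  have hmean : ∫ x, (∑ k, fun x : Fin n → ℂ => X k (x k)) x ∂Measure.pi μ = 0 := by
    simp only [Finset.sum_apply]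
    rw [integral_finsetSum _ fun k _ => (hmem k).integrable (by norm_num)]
    refine Finset.sum_eq_zero fun k _ => ?_
    have h1 := integral_map (μ := Measure.pi μ) (φ := Function.eval k) (f := X k)
      (measurable_pi_apply k).aemeasurable
      (by rw [(measurePreserving_eval μ k).map_eq]; exact (hX k).aestronglyMeasurable)
    rw [(measurePreserving_eval μ k).map_eq, h0 k] at h1
    exact h1.symm
  have h := meas_ge_le_variance_div_sq hsum hε
  rw [hmean, variance_sum_pi hX] at h
  simp only [Finset.sum_apply, sub_zero] at h
  refine h.trans (ENNReal.ofReal_le_ofReal ?_)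
  gcongr with k
  exact hW k

lemma memLp_centered_norm_sq (v w q : ℝ) :
    MemLp (fun z : ℂ => q * (‖z‖ ^ 2 - w)) 2 (complexGaussian v) :=
  ((memLp_norm_sq_complexGaussian v).sub (memLp_const w)).const_mul q

lemma integral_centered_norm_sq {v : ℝ} (hv : 0 ≤ v) (q : ℝ) :
    ∫ z : ℂ, q * (‖z‖ ^ 2 - v) ∂complexGaussian v = 0 := by
  rw [integral_const_mul, integral_sub (integrable_norm_sq_complexGaussian v)
    (integrable_const _), integral_norm_sq_complexGaussian hv]
  simp

lemma variance_centered_norm_sq (v w q : ℝ) :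
    Var[fun z : ℂ => q * (‖z‖ ^ 2 - w); complexGaussian v] =
      q ^ 2 * Var[fun z : ℂ => ‖z‖ ^ 2; complexGaussian v] := by
  rw [variance_const_mul, variance_sub_const (by fun_prop)]

/-- Weak law of large numbers for the information density, with an explicit rate. -/
lemma exists_measure_infoDensity_le {σ2 E : ℝ} (hσ : 0 < σ2) (hE : 0 < E) :
    ∃ K : ℝ, 0 ≤ K ∧ ∀ (a b c : ℂ) (n s : ℕ), Even n → Even s → ∀ ε : ℝ, 0 < ε →
      ((complexGaussianVec n E).prod (complexGaussianVec n σ2))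
        {p | ε ≤ |infoDensity σ2 E a b c s p.1 (fun k => signal a b c s p.1 k + p.2 k) -
          ∑ k : Fin n, Real.log ((σ2 + gain a b c s k * E) / σ2)|} ≤
      ENNReal.ofReal (K * n / ε ^ 2) := by
  set κ₁ := Var[fun z : ℂ => ‖z‖ ^ 2; complexGaussian E] with hκ₁
  set κ₂ := Var[fun z : ℂ => ‖z‖ ^ 2; complexGaussian σ2] with hκ₂
  have hκ₁0 : 0 ≤ κ₁ := variance_nonneg _ _
  have hκ₂0 : 0 ≤ κ₂ := variance_nonneg _ _
  refine ⟨9 * (κ₁ / E ^ 2 + κ₂ / σ2 ^ 2 + 4), by positivity, ?_⟩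
  intro a b c n s hn hs ε hε
  set G : ℕ → ℝ := gain a b c s with hGdef
  have hG : ∀ k, 0 ≤ G k := gain_nonneg a b c s
  set τ : ℕ → ℝ := fun k => σ2 + G k * E with hτdef
  have hτ : ∀ k, 0 < τ k := fun k => by
    have := mul_nonneg (hG k) hE.le; simp only [hτdef]; linarith
  have hτσ : ∀ k, σ2 ≤ τ k := fun k => by
    have := mul_nonneg (hG k) hE.le; simp only [hτdef]; linarith
  have hτG : ∀ k, G k * E ≤ τ k := fun k => by simp only [hτdef]; linarith
  -- The deviation splits into the fluctuation `A` of the input power, the fluctuation `B` of the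
  -- noise power and the cross term `C`, which is centred given the input.
  set A : (Fin n → ℂ) → ℝ := fun x => ∑ k : Fin n, G k / τ k * (‖x k‖ ^ 2 - E) with hA
  set B : (Fin n → ℂ) → ℝ := fun v => ∑ k : Fin n, (1 / τ k - 1 / σ2) * (‖v k‖ ^ 2 - σ2) with hB
  set C : (Fin n → ℂ) → (Fin n → ℂ) → ℝ := fun x v =>
    ∑ k : Fin n, (((2 / τ k : ℝ) : ℂ) * starRingEnd ℂ (signal a b c s x k) * v k).re with hC
  have hdec : ∀ x v : Fin n → ℂ, infoDensity σ2 E a b c s x (fun k => signal a b c s x k + v k) -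
      ∑ k : Fin n, Real.log ((σ2 + G k * E) / σ2) = A x + B v + C x v := by
    intro x v
    have h2 := sum_norm_sq_signal hn hs a b c x (β := fun k => 1 / τ k)
      (fun j => by simp only [hτdef, hGdef]; rw [gain_two_mul hs])
    have hA' : A x = ∑ k : Fin n, (1 / τ k * ‖signal a b c s x k‖ ^ 2 - G k / τ k * E) := by
      rw [Finset.sum_sub_distrib, h2, ← Finset.sum_sub_distrib, hA]
      refine Finset.sum_congr rfl fun k _ => ?_
      simp only [hGdef]; ring
    rw [infoDensity, hA', hB, hC, ← Finset.sum_sub_distrib, ← Finset.sum_add_distrib,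
      ← Finset.sum_add_distrib]
    refine Finset.sum_congr rfl fun k _ => ?_
    have e1 : signal a b c s x k + v k - signal a b c s x k = v k := by ring
    have e2 : ‖signal a b c s x k + v k‖ ^ 2 = ‖signal a b c s x k‖ ^ 2 +
        2 * (starRingEnd ℂ (signal a b c s x k) * v k).re + ‖v k‖ ^ 2 := by
      have := norm_sub_sq_complex (signal a b c s x k) (-v k)
      simp only [sub_neg_eq_add, norm_neg, mul_neg, Complex.neg_re] at this
      linarith
    rw [e1, e2, mul_assoc, Complex.re_ofReal_mul]
    have h3 : 1 = G k * E / τ k + σ2 / τ k := by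
      rw [← add_div, eq_div_iff (hτ k).ne']; simp only [hτdef]; ring
    have h4 : σ2 + G k * E = τ k := rfl
    change Real.log ((σ2 + G k * E) / σ2) + _ / (σ2 + G k * E) - _ -
      Real.log ((σ2 + G k * E) / σ2) = _
    rw [h4]
    have h5 : G k / τ k * E = 1 - σ2 / τ k := by rw [h3]; ring
    rw [h5]
    have := (hτ k).ne'
    field_simp
    ring
  have hε3 : 0 < ε / 3 := by positivity
  have hPA : complexGaussianVec n E {x | ε / 3 ≤ |A x|} ≤
      ENNReal.ofReal (n * (κ₁ / E ^ 2) / (ε / 3) ^ 2) := by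
    have := measure_pi_abs_sum_ge_le (μ := fun _ : Fin n => complexGaussian E)
      (X := fun k z => G k / τ k * (‖z‖ ^ 2 - E)) (fun k => memLp_centered_norm_sq _ _ _)
      (fun k => integral_centered_norm_sq hE.le _) (W := fun _ => κ₁ / E ^ 2) (fun k => ?_) hε3
    · rw [Finset.sum_const, Finset.card_univ, Fintype.card_fin, nsmul_eq_mul] at this
      exact this
    · rw [variance_centered_norm_sq, ← hκ₁]
      have h1 : G k / τ k ≤ 1 / E := by
        rw [div_le_div_iff₀ (hτ k) hE, one_mul]; exact hτG k
      have h0 : 0 ≤ G k / τ k := div_nonneg (hG k) (hτ k).le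
      calc (G k / τ k) ^ 2 * κ₁ ≤ (1 / E) ^ 2 * κ₁ := by gcongr
        _ = κ₁ / E ^ 2 := by ring
  have hPB : complexGaussianVec n σ2 {v | ε / 3 ≤ |B v|} ≤
      ENNReal.ofReal (n * (κ₂ / σ2 ^ 2) / (ε / 3) ^ 2) := by
    have := measure_pi_abs_sum_ge_le (μ := fun _ : Fin n => complexGaussian σ2)
      (X := fun k z => (1 / τ k - 1 / σ2) * (‖z‖ ^ 2 - σ2))
      (fun k => memLp_centered_norm_sq _ _ _)
      (fun k => integral_centered_norm_sq hσ.le _) (W := fun _ => κ₂ / σ2 ^ 2) (fun k => ?_) hε3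
    · rw [Finset.sum_const, Finset.card_univ, Fintype.card_fin, nsmul_eq_mul] at this
      exact this
    · rw [variance_centered_norm_sq, ← hκ₂]
      have h1 : (1 / τ k - 1 / σ2) ^ 2 ≤ (1 / σ2) ^ 2 := by
        have h2 : 1 / τ k ≤ 1 / σ2 := one_div_le_one_div_of_le hσ (hτσ k)
        have h3 : 0 < 1 / τ k := one_div_pos.2 (hτ k)
        nlinarith
      calc (1 / τ k - 1 / σ2) ^ 2 * κ₂ ≤ (1 / σ2) ^ 2 * κ₂ := by gcongr
        _ = κ₂ / σ2 ^ 2 := by ring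
  have hPC1 : ∀ x, complexGaussianVec n σ2 {v | ε / 3 ≤ |C x v|} ≤
      ENNReal.ofReal (∑ k : Fin n, 4 / E / (ε / 3) ^ 2 * ‖x k‖ ^ 2) := by
    intro x
    have := measure_pi_abs_sum_ge_le (μ := fun _ : Fin n => complexGaussian σ2)
      (X := fun k z => (((2 / τ k : ℝ) : ℂ) * starRingEnd ℂ (signal a b c s x k) * z).re)
      (fun k => memLp_re_mul_complexGaussian _ _)
      (fun k => integral_re_mul_complexGaussian _ _) (fun k =>
        variance_re_mul_complexGaussian_le hσ.le _) hε3
    refine this.trans (ENNReal.ofReal_le_ofReal ?_)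
    rw [← Finset.mul_sum, div_mul_eq_mul_div]
    gcongr
    have h2 := sum_norm_sq_signal hn hs a b c x (β := fun k => (2 / τ k) ^ 2 * σ2)
      (fun j => by simp only [hτdef, hGdef]; rw [gain_two_mul hs])
    have h3 : ∀ k : Fin n, ‖((2 / τ k : ℝ) : ℂ) * starRingEnd ℂ (signal a b c s x k)‖ ^ 2 * σ2 =
        (2 / τ k) ^ 2 * σ2 * ‖signal a b c s x k‖ ^ 2 := by
      intro k
      rw [norm_mul, mul_pow, Complex.norm_real, Real.norm_eq_abs, sq_abs, RCLike.norm_conj]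
      ring
    simp_rw [h3]
    rw [h2, Finset.mul_sum]
    refine Finset.sum_le_sum fun k _ => ?_
    refine mul_le_mul_of_nonneg_right ?_ (by positivity)
    change (2 / τ k) ^ 2 * σ2 * G k ≤ 4 / E
    have := hτ k
    rw [div_pow, div_mul_eq_mul_div, div_mul_eq_mul_div, div_le_div_iff₀ (by positivity) hE]
    have := mul_le_mul (hτσ k) (hτG k) (mul_nonneg (hG k) hE.le) (hτ k).le
    nlinarith
  have hmS : ∀ k : Fin n, Measurable fun p : (Fin n → ℂ) × (Fin n → ℂ) =>
      signal a b c s p.1 k := fun k => (measurable_signal a b c s k).comp measurable_fst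
  have hmC : MeasurableSet {p : (Fin n → ℂ) × (Fin n → ℂ) | ε / 3 ≤ |C p.1 p.2|} := by
    refine measurableSet_le measurable_const ?_
    simp only [hC]
    refine Measurable.abs (Finset.measurable_sum _ fun k _ => ?_)
    refine Complex.measurable_re.comp ?_
    refine Measurable.mul (measurable_const.mul ?_) (by fun_prop)
    exact Complex.continuous_conj.measurable.comp (hmS k)
  have hPC : ((complexGaussianVec n E).prod (complexGaussianVec n σ2))
      {p | ε / 3 ≤ |C p.1 p.2|} ≤ ENNReal.ofReal (n * 4 / (ε / 3) ^ 2) := by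
    rw [Measure.prod_apply hmC]
    refine (lintegral_mono hPC1).trans ?_
    have hint : ∀ k : Fin n, Integrable (fun x : Fin n → ℂ => 4 / E / (ε / 3) ^ 2 * ‖x k‖ ^ 2)
        (complexGaussianVec n E) := fun k =>
      ((measurePreserving_eval (fun _ : Fin n => complexGaussian E) k).integrable_comp_of_integrable
        (integrable_norm_sq_complexGaussian E)).const_mul _
    rw [← ofReal_integral_eq_lintegral_ofReal (integrable_finsetSum _ fun k _ => hint k)
      (by filter_upwards with x; exact Finset.sum_nonneg fun k _ => by positivity)]
    refine ENNReal.ofReal_le_ofReal ?_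
    rw [integral_finsetSum _ fun k _ => hint k]
    have : ∀ k : Fin n, ∫ x : Fin n → ℂ, ‖x k‖ ^ 2 ∂complexGaussianVec n E = E := by
      intro k
      have h1 := integral_map (μ := complexGaussianVec n E) (φ := Function.eval k)
        (f := fun z : ℂ => ‖z‖ ^ 2) (measurable_pi_apply k).aemeasurable (by fun_prop)
      rw [complexGaussianVec, (measurePreserving_eval _ k).map_eq,
        integral_norm_sq_complexGaussian hE.le] at h1
      exact h1.symm
    simp_rw [integral_const_mul, this]
    rw [Finset.sum_const, Finset.card_univ, Fintype.card_fin, nsmul_eq_mul]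
    refine le_of_eq ?_
    field_simp
  have hsub : {p : (Fin n → ℂ) × (Fin n → ℂ) |
      ε ≤ |infoDensity σ2 E a b c s p.1 (fun k => signal a b c s p.1 k + p.2 k) -
          ∑ k : Fin n, Real.log ((σ2 + G k * E) / σ2)|} ⊆
      (Prod.fst ⁻¹' {x | ε / 3 ≤ |A x|} ∪ Prod.snd ⁻¹' {v | ε / 3 ≤ |B v|}) ∪
        {p | ε / 3 ≤ |C p.1 p.2|} := by
    intro p hp
    have hp : ε ≤ _ := hp
    rw [hdec] at hp
    by_contra hcon
    simp only [Set.mem_union, Set.mem_preimage, Set.mem_ofPred_eq, not_or, not_le] at hcon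
    have h1 := abs_add_le (A p.1 + B p.2) (C p.1 p.2)
    have h2 := abs_add_le (A p.1) (B p.2)
    linarith [hcon.1.1, hcon.1.2, hcon.2]
  refine (measure_mono hsub).trans ((measure_union_le _ _).trans ?_)
  refine (add_le_add (measure_union_le _ _) le_rfl).trans ?_
  have hfst := (measurePreserving_fst (μ := complexGaussianVec n E)
    (ν := complexGaussianVec n σ2)).measure_preimage (s := {x | ε / 3 ≤ |A x|})
    (measurableSet_le measurable_const (by simp only [hA]; fun_prop)).nullMeasurableSet
  have hsnd := (measurePreserving_snd (μ := complexGaussianVec n E)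
    (ν := complexGaussianVec n σ2)).measure_preimage (s := {v | ε / 3 ≤ |B v|})
    (measurableSet_le measurable_const (by simp only [hB]; fun_prop)).nullMeasurableSet
  rw [hfst, hsnd]
  refine (add_le_add (add_le_add hPA hPB) hPC).trans ?_
  rw [← ENNReal.ofReal_add (by positivity) (by positivity),
    ← ENNReal.ofReal_add (by positivity) (by positivity)]
  refine ENNReal.ofReal_le_ofReal (le_of_eq ?_)
  field_simp
  ring

/-! ### Random coding and the strong converse -/

lemma argminIdx_le {N : ℕ} [NeZero N] (D : Fin N → ℝ) (m : Fin N) : D (argminIdx D) ≤ D m := by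
  have h := Finset.min'_mem (Finset.univ.filter (fun m => ∀ m', D m ≤ D m')) (by
    obtain ⟨m, -, hm⟩ := Finset.exists_min_image Finset.univ D
      ⟨⟨0, Nat.pos_of_ne_zero (NeZero.ne N)⟩, Finset.mem_univ _⟩
    exact ⟨m, Finset.mem_filter.mpr ⟨Finset.mem_univ _, fun m' => hm m' (Finset.mem_univ _)⟩⟩)
  exact (Finset.mem_filter.1 h).2 m

lemma argminIdx_eq_iff {N : ℕ} [NeZero N] (D : Fin N → ℝ) (m : Fin N) :
    argminIdx D = m ↔ (∀ m', D m ≤ D m') ∧ ∀ j < m, ∃ m', D m' < D j := by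
  have hne : (Finset.univ.filter (fun m => ∀ m', D m ≤ D m')).Nonempty :=
    ⟨argminIdx D, Finset.mem_filter.2 ⟨Finset.mem_univ _, argminIdx_le D⟩⟩
  have hle : ∀ j, (∀ m', D j ≤ D m') → argminIdx D ≤ j := fun j hj =>
    Finset.min'_le _ _ (Finset.mem_filter.2 ⟨Finset.mem_univ _, hj⟩)
  constructor
  · rintro rfl
    refine ⟨argminIdx_le D, fun j hj => ?_⟩
    by_contra! hcon
    exact absurd (hle j hcon) (not_le.2 hj)
  · rintro ⟨h1, h2⟩
    refine le_antisymm (hle m h1) (not_lt.1 fun hlt => ?_)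
    obtain ⟨m', hm'⟩ := h2 _ hlt
    exact absurd (argminIdx_le D m') (not_le.2 hm')

lemma measurable_argminIdx {N : ℕ} [NeZero N] : Measurable (argminIdx : (Fin N → ℝ) → Fin N) := by
  refine measurable_to_countable' fun m => ?_
  have : argminIdx ⁻¹' {m} = (⋂ m', {D : Fin N → ℝ | D m ≤ D m'}) ∩
      ⋂ j, ⋂ _ : j < m, ⋃ m', {D : Fin N → ℝ | D m' < D j} := by
    ext D
    simp [argminIdx_eq_iff]
  rw [this]
  refine MeasurableSet.inter (MeasurableSet.iInter fun m' => measurableSet_le (by fun_prop)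
    (by fun_prop)) (MeasurableSet.iInter fun j => MeasurableSet.iInter fun _ =>
      MeasurableSet.iUnion fun m' => measurableSet_lt (by fun_prop) (by fun_prop))

lemma measurable_infoDensity_received {n : ℕ} (σ2 E : ℝ) (a b c : ℂ) (s : ℕ) {α : Type*}
    [MeasurableSpace α] {f g v : α → Fin n → ℂ} (hf : Measurable f) (hg : Measurable g)
    (hv : Measurable v) :
    Measurable fun p =>
      infoDensity σ2 E a b c s (f p) (fun k => signal a b c s (g p) k + v p k) := by
  have h1 : Measurable fun p => (fun k => signal a b c s (g p) k + v p k : Fin n → ℂ) :=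
    measurable_pi_lambda _ fun k =>
      ((measurable_signal a b c s k).comp hg).add ((measurable_pi_apply k).comp hv)
  have h2 := (measurable_infoDensity σ2 E a b c s).comp (hf.prodMk h1)
  exact h2

lemma measurePreserving_eval_pair {N : ℕ} {α : Type*} [MeasurableSpace α] (P : Measure α)
    [IsProbabilityMeasure P] {m m' : Fin N} (h : m ≠ m') :
    MeasurePreserving (fun C : Fin N → α => (C m, C m')) (Measure.pi fun _ => P) (P.prod P) := by
  refine ⟨by fun_prop, ?_⟩
  have hi := (iIndepFun_pi (μ := fun _ : Fin N => P) (X := fun _ x => x)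
    fun _ => aemeasurable_id).indepFun h
  have := (indepFun_iff_map_prod_eq_prod_map_map (measurable_pi_apply m).aemeasurable
    (measurable_pi_apply m').aemeasurable).1 hi
  refine this.trans ?_
  have h1 := (measurePreserving_eval (fun _ : Fin N => P) m).map_eq
  have h2 := (measurePreserving_eval (fun _ : Fin N => P) m').map_eq
  exact congrArg₂ Measure.prod h1 h2

lemma lintegral_prod_prod_eq_one {α β : Type*} [MeasurableSpace α] [MeasurableSpace β]
    {P : Measure α} {Q : Measure β} [IsProbabilityMeasure P] [IsProbabilityMeasure Q]
    {f : (α × α) × β → ℝ≥0∞} (hf : Measurable f) (h : ∀ v x, ∫⁻ x', f ((x, x'), v) ∂P = 1) :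
    ∫⁻ q, f q ∂((P.prod P).prod Q) = 1 := by
  rw [lintegral_prod_symm _ hf.aemeasurable]
  have : ∀ v, ∫⁻ x, f (x, v) ∂(P.prod P) = 1 := by
    intro v
    have hv : Measurable fun x => f (x, v) := hf.comp (measurable_id.prodMk measurable_const)
    rw [lintegral_prod _ hv.aemeasurable]
    simp [h]
  simp [this]

/-- An independent codeword reaches the information density `t` with probability at most
`exp (-t)`. -/
lemma measure_infoDensity_indep_le {n : ℕ} (hn : Even n) {s : ℕ} (hs : Even s) {σ2 E : ℝ}
    (hσ : 0 < σ2) (hE : 0 < E) (a b c : ℂ) (t : ℝ) :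
    (((complexGaussianVec n E).prod (complexGaussianVec n E)).prod (complexGaussianVec n σ2))
      {q | t ≤ infoDensity σ2 E a b c s q.1.2 (fun k => signal a b c s q.1.1 k + q.2 k)} ≤
    ENNReal.ofReal (Real.exp (-t)) := by
  set f : ((Fin n → ℂ) × (Fin n → ℂ)) × (Fin n → ℂ) → ℝ≥0∞ := fun q => ENNReal.ofReal
    (Real.exp (infoDensity σ2 E a b c s q.1.2 (fun k => signal a b c s q.1.1 k + q.2 k))) with hf
  have hfm : Measurable f := ENNReal.measurable_ofReal.comp (Real.measurable_exp.comp
    (measurable_infoDensity_received σ2 E a b c s (measurable_snd.comp measurable_fst)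
      (measurable_fst.comp measurable_fst) measurable_snd))
  have hint : ∫⁻ q, f q ∂(((complexGaussianVec n E).prod (complexGaussianVec n E)).prod
      (complexGaussianVec n σ2)) = 1 := by
    refine lintegral_prod_prod_eq_one hfm fun v x => ?_
    have h1 := lintegral_exp_infoDensity hn hs hσ hE a b c (fun k => signal a b c s x k + v k)
    simpa only [hf] using h1
  have hmk := mul_meas_ge_le_lintegral hfm (ENNReal.ofReal (Real.exp t))
    (μ := ((complexGaussianVec n E).prod (complexGaussianVec n E)).prod (complexGaussianVec n σ2))
  rw [hint] at hmk
  have hset : {q | ENNReal.ofReal (Real.exp t) ≤ f q} = {q | t ≤ infoDensity σ2 E a b c s q.1.2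
      (fun k => signal a b c s q.1.1 k + q.2 k)} := by
    ext q
    simp only [hf, Set.mem_ofPred_eq, ENNReal.ofReal_le_ofReal_iff (Real.exp_pos _).le,
      Real.exp_le_exp]
  rw [hset] at hmk
  rw [Real.exp_neg, ENNReal.ofReal_inv_of_pos (Real.exp_pos t)]
  rw [mul_comm] at hmk
  exact ENNReal.le_inv_iff_mul_le.2 hmk

/-- Achievability for a random codebook: whenever smaller metrics mean larger information
densities, minimum-metric decoding fails only if the information density of the sent word is at
most `t`, or that of one of the other words is at least `t`. -/
lemma measure_argminIdx_ne_le {N n : ℕ} [NeZero N] (hn : Even n) {s : ℕ} (hs : Even s) {σ2 E : ℝ}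
    (hσ : 0 < σ2) (hE : 0 < E) (a b c : ℂ) (m : Fin N) (t : ℝ)
    {D : (Fin n → ℂ) → (Fin n → ℂ) → ℝ}
    (hD : ∀ y x x', D y x' ≤ D y x →
      infoDensity σ2 E a b c s x y ≤ infoDensity σ2 E a b c s x' y) :
    ((Measure.pi fun _ : Fin N => complexGaussianVec n E).prod (complexGaussianVec n σ2))
      {p | argminIdx (fun m' => D (fun k => signal a b c s (p.1 m) k + p.2 k) (p.1 m')) ≠ m} ≤
    ((complexGaussianVec n E).prod (complexGaussianVec n σ2))
        {p | infoDensity σ2 E a b c s p.1 (fun k => signal a b c s p.1 k + p.2 k) ≤ t} +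
      N * ENNReal.ofReal (Real.exp (-t)) := by
  set P := complexGaussianVec n E
  set Q := complexGaussianVec n σ2
  set A : Set ((Fin n → ℂ) × (Fin n → ℂ)) :=
    {p | infoDensity σ2 E a b c s p.1 (fun k => signal a b c s p.1 k + p.2 k) ≤ t} with hA
  set B : Set (((Fin n → ℂ) × (Fin n → ℂ)) × (Fin n → ℂ)) :=
    {q | t ≤ infoDensity σ2 E a b c s q.1.2 (fun k => signal a b c s q.1.1 k + q.2 k)} with hB
  have hAm : MeasurableSet A := measurableSet_le (measurable_infoDensity_received σ2 E a b c s
    measurable_fst measurable_fst measurable_snd) measurable_const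
  have hBm : MeasurableSet B := measurableSet_le measurable_const
    (measurable_infoDensity_received σ2 E a b c s (measurable_snd.comp measurable_fst)
      (measurable_fst.comp measurable_fst) measurable_snd)
  have hsub : {p : (Fin N → Fin n → ℂ) × (Fin n → ℂ) |
      argminIdx (fun m' => D (fun k => signal a b c s (p.1 m) k + p.2 k) (p.1 m')) ≠ m} ⊆
      (Prod.map (Function.eval m) id ⁻¹' A) ∪
      ⋃ m' ∈ Finset.univ.erase m, Prod.map (fun C : Fin N → Fin n → ℂ => (C m, C m')) id ⁻¹' B := by
    intro p hp
    by_cases h : p ∈ Prod.map (Function.eval m) id ⁻¹' A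
    · exact Or.inl h
    right
    have h : t < infoDensity σ2 E a b c s (p.1 m) (fun k => signal a b c s (p.1 m) k + p.2 k) :=
      not_le.1 h
    refine Set.mem_iUnion₂.2 ⟨_, Finset.mem_erase.2 ⟨hp, Finset.mem_univ _⟩, ?_⟩
    exact h.le.trans (hD _ _ _ (argminIdx_le
      (fun m' => D (fun k => signal a b c s (p.1 m) k + p.2 k) (p.1 m')) m))
  refine (measure_mono hsub).trans ((measure_union_le _ _).trans (add_le_add ?_ ?_))
  · exact (((measurePreserving_eval (fun _ : Fin N => P) m).prod
      (MeasurePreserving.id Q)).measure_preimage hAm.nullMeasurableSet).le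
  · refine (measure_biUnion_finset_le _ _).trans ?_
    calc ∑ m' ∈ Finset.univ.erase m, ((Measure.pi fun _ : Fin N => P).prod Q)
          (Prod.map (fun C : Fin N → Fin n → ℂ => (C m, C m')) id ⁻¹' B)
        ≤ ∑ m' ∈ Finset.univ.erase m, ENNReal.ofReal (Real.exp (-t)) := by
          refine Finset.sum_le_sum fun m' hm' => ?_
          rw [((measurePreserving_eval_pair P (Finset.ne_of_mem_erase hm').symm).prod
            (MeasurePreserving.id Q)).measure_preimage hBm.nullMeasurableSet]
          exact measure_infoDensity_indep_le hn hs hσ hE a b c t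
      _ ≤ ∑ m' : Fin N, ENNReal.ofReal (Real.exp (-t)) :=
          Finset.sum_le_sum_of_subset (Finset.erase_subset _ _)
      _ = N * ENNReal.ofReal (Real.exp (-t)) := by simp

/-- The law of the output given the input `x`, relative to the product output law. -/
lemma map_signal_add {n : ℕ} {σ2 E : ℝ} (hσ : 0 < σ2) (hE : 0 < E) (a b c : ℂ) (s : ℕ)
    (x : Fin n → ℂ) :
    (complexGaussianVec n σ2).map (fun v k => signal a b c s x k + v k) =
      (Measure.pi fun k : Fin n => complexGaussian (σ2 + gain a b c s k * E)).withDensity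
        (fun y => ENNReal.ofReal (Real.exp (infoDensity σ2 E a b c s x y))) := by
  have hτ : ∀ k, 0 < σ2 + gain a b c s k * E := fun k => by
    have := mul_nonneg (gain_nonneg a b c s k) hE.le; linarith
  have hprob : ∀ k : Fin n, IsProbabilityMeasure
      ((complexGaussian σ2).map (fun z => signal a b c s x k + z)) := fun k =>
    Measure.isProbabilityMeasure_map (by fun_prop)
  rw [complexGaussianVec, Measure.pi_map_pi (f := fun k z => signal a b c s x k + z)
    (fun k => by fun_prop),
    pi_eq_withDensity_prod (ν := fun k : Fin n => complexGaussian (σ2 + gain a b c s k * E))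
    (f := fun k y => ENNReal.ofReal ((σ2 + gain a b c s k * E) / σ2 *
      Real.exp (‖y‖ ^ 2 / (σ2 + gain a b c s k * E) - ‖y - signal a b c s x k‖ ^ 2 / σ2)))
    (fun k => by fun_prop) (fun k => complexGaussian_map_add hσ (hτ k) _)]
  congr 1
  funext y
  rw [← ENNReal.ofReal_prod_of_nonneg fun k _ => by have := hτ k; positivity, infoDensity,
    Real.exp_sum]
  congr 1
  refine Finset.prod_congr rfl fun k _ => ?_
  rw [add_sub_assoc, Real.exp_add, Real.exp_log (by have := hτ k; positivity)]

/-- Strong converse for a fixed codebook: the probabilities of correct decisions at information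
density at most `t` add up to at most `exp t`. -/
lemma sum_measure_decode_le {N n : ℕ} {σ2 E : ℝ} (hσ : 0 < σ2) (hE : 0 < E) (a b c : ℂ) (s : ℕ)
    (C : Fin N → Fin n → ℂ) {dec : (Fin n → ℂ) → Fin N} (hdec : Measurable dec) (t : ℝ) :
    ∑ m, complexGaussianVec n σ2 {v | dec (fun k => signal a b c s (C m) k + v k) = m ∧
        infoDensity σ2 E a b c s (C m) (fun k => signal a b c s (C m) k + v k) ≤ t} ≤
      ENNReal.ofReal (Real.exp t) := by
  set ν := Measure.pi fun k : Fin n => complexGaussian (σ2 + gain a b c s k * E) with hν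
  have key : ∀ m, complexGaussianVec n σ2 {v | dec (fun k => signal a b c s (C m) k + v k) = m ∧
        infoDensity σ2 E a b c s (C m) (fun k => signal a b c s (C m) k + v k) ≤ t} ≤
      ENNReal.ofReal (Real.exp t) * ν (dec ⁻¹' {m}) := by
    intro m
    have hinfo : Measurable fun y => infoDensity σ2 E a b c s (C m) y := by
      have h := (measurable_infoDensity σ2 E a b c s).comp (measurable_prodMk_left (x := C m))
      exact h
    have hms : MeasurableSet (dec ⁻¹' {m} ∩ {y | infoDensity σ2 E a b c s (C m) y ≤ t}) :=
      (hdec (measurableSet_singleton m)).inter (measurableSet_le hinfo measurable_const)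
    have hadd : Measurable fun (v : Fin n → ℂ) k => signal a b c s (C m) k + v k :=
      measurable_pi_lambda _ fun k => (measurable_pi_apply k).const_add _
    have h1 := Measure.map_apply (μ := complexGaussianVec n σ2) hadd hms
    rw [map_signal_add hσ hE, withDensity_apply _ hms] at h1
    calc _ = _ := h1.symm
      _ ≤ ∫⁻ _ in dec ⁻¹' {m} ∩ {y | infoDensity σ2 E a b c s (C m) y ≤ t},
          ENNReal.ofReal (Real.exp t) ∂ν :=
          setLIntegral_mono' hms fun y hy => ENNReal.ofReal_le_ofReal (Real.exp_le_exp.2 hy.2)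
      _ = ENNReal.ofReal (Real.exp t) *
          ν (dec ⁻¹' {m} ∩ {y | infoDensity σ2 E a b c s (C m) y ≤ t}) := setLIntegral_const _ _
      _ ≤ _ := by gcongr; exact Set.inter_subset_left
  refine (Finset.sum_le_sum fun m _ => key m).trans ?_
  rw [← Finset.mul_sum]
  have hsum : ∑ m, ν (dec ⁻¹' {m}) = 1 := by
    rw [sum_measure_preimage_singleton Finset.univ
      fun m _ => hdec (measurableSet_singleton m)]
    simp
  rw [hsum, mul_one]

/-- Strong converse, averaged over the random codebook. -/
lemma sum_measure_prod_decode_le {N n : ℕ} {σ2 E : ℝ} (hσ : 0 < σ2) (hE : 0 < E) (a b c : ℂ)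
    (s : ℕ) {dec : (Fin N → Fin n → ℂ) → (Fin n → ℂ) → Fin N}
    (hdec : Measurable fun p : (Fin N → Fin n → ℂ) × (Fin n → ℂ) => dec p.1 p.2) (t : ℝ) :
    ∑ m, ((Measure.pi fun _ : Fin N => complexGaussianVec n E).prod (complexGaussianVec n σ2))
        {p | dec p.1 (fun k => signal a b c s (p.1 m) k + p.2 k) = m} ≤
      N * ((complexGaussianVec n E).prod (complexGaussianVec n σ2))
        {p | t < infoDensity σ2 E a b c s p.1 (fun k => signal a b c s p.1 k + p.2 k)} +
      ENNReal.ofReal (Real.exp t) := by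
  set P := complexGaussianVec n E
  set Q := complexGaussianVec n σ2
  set A : Set ((Fin n → ℂ) × (Fin n → ℂ)) :=
    {p | t < infoDensity σ2 E a b c s p.1 (fun k => signal a b c s p.1 k + p.2 k)} with hA
  have hAm : MeasurableSet A := measurableSet_lt measurable_const
    (measurable_infoDensity_received σ2 E a b c s measurable_fst measurable_fst measurable_snd)
  set B : Fin N → Set ((Fin N → Fin n → ℂ) × (Fin n → ℂ)) := fun m =>
    {p | dec p.1 (fun k => signal a b c s (p.1 m) k + p.2 k) = m ∧
      infoDensity σ2 E a b c s (p.1 m) (fun k => signal a b c s (p.1 m) k + p.2 k) ≤ t} with hB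
  have hBm : ∀ m, MeasurableSet (B m) := by
    intro m
    have h1 : Measurable fun p : (Fin N → Fin n → ℂ) × (Fin n → ℂ) => p.1 m :=
      (measurable_pi_apply m).comp measurable_fst
    refine MeasurableSet.inter (s₁ := {p | dec p.1 (fun k => signal a b c s (p.1 m) k + p.2 k) = m})
      ?_ (measurableSet_le (measurable_infoDensity_received σ2 E a b c s h1 h1 measurable_snd)
        measurable_const)
    have h2 : Measurable fun p : (Fin N → Fin n → ℂ) × (Fin n → ℂ) =>
        (fun k => signal a b c s (p.1 m) k + p.2 k : Fin n → ℂ) := measurable_pi_lambda _ fun k =>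
      ((measurable_signal a b c s k).comp h1).add ((measurable_pi_apply k).comp measurable_snd)
    have h3 := hdec.comp (measurable_fst.prodMk h2)
    exact h3 (measurableSet_singleton m)
  have hle : ∀ m, ((Measure.pi fun _ : Fin N => P).prod Q)
      {p | dec p.1 (fun k => signal a b c s (p.1 m) k + p.2 k) = m} ≤
      (P.prod Q) A + ((Measure.pi fun _ : Fin N => P).prod Q) (B m) := by
    intro m
    rw [← ((measurePreserving_eval (fun _ : Fin N => P) m).prod
      (MeasurePreserving.id Q)).measure_preimage hAm.nullMeasurableSet]
    refine (measure_mono ?_).trans (measure_union_le _ _)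
    intro p hp
    by_cases h : p ∈ Prod.map (Function.eval m) id ⁻¹' A
    · exact Or.inl h
    · exact Or.inr ⟨hp, not_lt.1 h⟩
  refine (Finset.sum_le_sum fun m _ => hle m).trans ?_
  rw [Finset.sum_add_distrib]
  refine add_le_add (by simp) ?_
  simp_rw [Measure.prod_apply (hBm _)]
  rw [← lintegral_finsetSum _ fun m _ => measurable_measure_prodMk_left (hBm m)]
  calc _ ≤ ∫⁻ _, ENNReal.ofReal (Real.exp t) ∂(Measure.pi fun _ : Fin N => P) := by
        refine lintegral_mono fun C => ?_
        exact sum_measure_decode_le hσ hE a b c s C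
          (dec := dec C) (hdec.comp measurable_prodMk_left) t
    _ = _ := by simp

/-! ### Reliability of long random codes -/

/-- The mutual information per symbol (in nats) of a channel that has gain `a` for a fraction `l`
of the time and is an Alamouti channel with gains `b` and `c` for the rest. -/
def mutualInfo (snr l : ℝ) (a b c : ℂ) : ℝ :=
  l * Real.log (1 + ‖a‖ ^ 2 * snr) + (1 - l) * Real.log (1 + (‖b‖ ^ 2 + ‖c‖ ^ 2) * snr)

/-- The mean of the information density. -/
lemma sum_log_gain {σ2 E : ℝ} (hσ : 0 < σ2) (a b c : ℂ) {M m : ℕ} (hM : 0 < M)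
    (hm : m ≤ M) (T : ℕ) :
    ∑ k : Fin (M * T), Real.log ((σ2 + gain a b c (m * T) k * E) / σ2) =
      ((M * T : ℕ) : ℝ) * mutualInfo (E / σ2) (m / M) a b c := by
  obtain ⟨r, rfl⟩ := Nat.exists_eq_add_of_le hm
  have h1 := Fin.sum_univ_eq_sum_range
    (fun k => Real.log ((σ2 + gain a b c (m * T) k * E) / σ2)) ((m + r) * T)
  have hval : ∀ x : ℝ, (σ2 + x * E) / σ2 = 1 + x * (E / σ2) := fun x => by field_simp
  rw [h1, add_mul, Finset.sum_range_add]
  have h2 : ∀ k ∈ Finset.range (m * T), Real.log ((σ2 + gain a b c (m * T) k * E) / σ2) =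
      Real.log (1 + ‖a‖ ^ 2 * (E / σ2)) := fun k hk => by
    rw [gain, if_pos (Finset.mem_range.1 hk), hval]
  have h3 : ∀ k ∈ Finset.range (r * T),
      Real.log ((σ2 + gain a b c (m * T) (m * T + k) * E) / σ2) =
      Real.log (1 + (‖b‖ ^ 2 + ‖c‖ ^ 2) * (E / σ2)) := fun k _ => by
    rw [gain, if_neg (by omega), hval]
  rw [Finset.sum_congr rfl h2, Finset.sum_congr rfl h3]
  simp only [Finset.sum_const, Finset.card_range, nsmul_eq_mul, mutualInfo]
  have : ((m : ℝ) + r) ≠ 0 := by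
    have : (0 : ℝ) < ((m + r : ℕ) : ℝ) := by exact_mod_cast hM
    push_cast at this; exact this.ne'
  push_cast
  field_simp
  ring

lemma exp_le_numMessages (R : ℝ) (n : ℕ) :
    Real.exp (n * (R * Real.log 2)) ≤ numMessages R n := by
  have : Real.exp (n * (R * Real.log 2)) = (2 : ℝ) ^ ((n : ℝ) * R) := by
    rw [Real.rpow_def_of_pos two_pos]; congr 1; ring
  rw [this]; exact Nat.le_ceil _

lemma numMessages_le {R : ℝ} (hR : 0 ≤ R) (n : ℕ) :
    (numMessages R n : ℝ) ≤ 2 * Real.exp (n * (R * Real.log 2)) := by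
  have h : Real.exp (n * (R * Real.log 2)) = (2 : ℝ) ^ ((n : ℝ) * R) := by
    rw [Real.rpow_def_of_pos two_pos]; congr 1; ring
  have h1 : 1 ≤ Real.exp (n * (R * Real.log 2)) :=
    Real.one_le_exp (mul_nonneg n.cast_nonneg (mul_nonneg hR (Real.log_nonneg one_le_two)))
  have := (Nat.ceil_lt_add_one (a := (2 : ℝ) ^ ((n : ℝ) * R)) (by positivity)).le
  rw [← h] at this
  unfold numMessages
  rw [← h]
  linarith

/-- The bounds used below vanish for long sub-blocks: one from the law of large numbers and one
from the margin `δ` between rate and mutual information. Sub-block lengths are even, `2 * j`. -/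
lemma tendsto_rate_bound {M : ℕ} (hM : 0 < M) (K C : ℝ) {δ : ℝ} (hδ : 0 < δ) :
    Tendsto (fun j : ℕ => ENNReal.ofReal
        (K * ((M * (2 * j) : ℕ) : ℝ) / (((M * (2 * j) : ℕ) : ℝ) * δ) ^ 2) +
      ENNReal.ofReal (C * Real.exp (-(((M * (2 * j) : ℕ) : ℝ) * δ)))) atTop (𝓝 0) := by
  have hn : Tendsto (fun j : ℕ => ((M * (2 * j) : ℕ) : ℝ)) atTop atTop := by
    refine tendsto_natCast_atTop_atTop.comp ?_
    refine tendsto_atTop_mono (fun j => ?_) tendsto_id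
    change j ≤ M * (2 * j)
    nlinarith
  have h1 : Tendsto (fun x : ℝ => K * x / (x * δ) ^ 2) atTop (𝓝 0) := by
    have : Tendsto (fun x : ℝ => K / δ ^ 2 * x⁻¹) atTop (𝓝 (K / δ ^ 2 * 0)) :=
      tendsto_inv_atTop_zero.const_mul _
    rw [mul_zero] at this
    refine this.congr' ?_
    filter_upwards [eventually_gt_atTop 0] with x hx
    field_simp
  have h2 : Tendsto (fun x : ℝ => C * Real.exp (-(x * δ))) atTop (𝓝 0) := by
    have := (Real.tendsto_exp_neg_atTop_nhds_zero.comp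
      (tendsto_id.atTop_mul_const hδ)).const_mul C
    rw [mul_zero] at this
    exact this
  have e1 := ENNReal.tendsto_ofReal (h1.comp hn)
  have e2 := ENNReal.tendsto_ofReal (h2.comp hn)
  have := e1.add e2
  simpa using this

/-- Below capacity, minimum-distance decoding of the random code succeeds as the sub-block length
grows, uniformly over messages. -/
lemma exists_tendsto_measure_argminIdx_ne {σ2 E R : ℝ} (hσ : 0 < σ2) (hE : 0 < E) (hR : 0 ≤ R)
    (a b c : ℂ) {M m₀ : ℕ} (hM : 0 < M) (hm₀ : m₀ ≤ M)
    (hI : R * Real.log 2 < mutualInfo (E / σ2) (m₀ / M) a b c) :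
    ∃ ε : ℕ → ℝ≥0∞, Tendsto ε atTop (𝓝 0) ∧ ∀ j : ℕ, 0 < j →
      ∀ D : (Fin (M * (2 * j)) → ℂ) → (Fin (M * (2 * j)) → ℂ) → ℝ,
      (∀ y x x', D y x' ≤ D y x → infoDensity σ2 E a b c (m₀ * (2 * j)) x y ≤
        infoDensity σ2 E a b c (m₀ * (2 * j)) x' y) →
      ∀ m : Fin (numMessages R (M * (2 * j))),
      ((Measure.pi fun _ : Fin (numMessages R (M * (2 * j))) =>
        complexGaussianVec (M * (2 * j)) E).prod (complexGaussianVec (M * (2 * j)) σ2))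
      {p | argminIdx (fun m' => D (fun k => signal a b c (m₀ * (2 * j)) (p.1 m) k + p.2 k)
        (p.1 m')) ≠ m} ≤ ε j := by
  obtain ⟨K, -, hK⟩ := exists_measure_infoDensity_le hσ hE
  set I := mutualInfo (E / σ2) (m₀ / M) a b c with hIdef
  -- The threshold for the information density is halfway between rate and mutual information.
  set δ : ℝ := (I - R * Real.log 2) / 2 with hδ
  have hδ0 : 0 < δ := by rw [hδ]; linarith
  refine ⟨_, tendsto_rate_bound hM K 2 hδ0, fun j hj => ?_⟩
  have hsum := sum_log_gain (E := E) hσ a b c hM hm₀ (2 * j)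
  have hse : Even (m₀ * (2 * j)) := ⟨m₀ * j, by ring⟩
  have hne : Even (M * (2 * j)) := ⟨M * j, by ring⟩
  have hn0 : (0 : ℝ) < (M * (2 * j) : ℕ) := by exact_mod_cast (by positivity : 0 < M * (2 * j))
  rw [← hIdef] at hsum
  generalize M * (2 * j) = n at *
  intro D hD m
  refine (measure_argminIdx_ne_le hne hse hσ hE a b c m (n * (I - δ)) hD).trans (add_le_add ?_ ?_)
  · refine (measure_mono ?_).trans (hK a b c n _ hne hse (n * δ) (by positivity))
    intro p hp
    have hp : infoDensity σ2 E a b c (m₀ * (2 * j)) p.1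
      (fun k => signal a b c (m₀ * (2 * j)) p.1 k + p.2 k) ≤ n * (I - δ) := hp
    rw [Set.mem_ofPred_eq, hsum, abs_sub_comm]
    refine le_trans ?_ (le_abs_self _)
    linarith
  · rw [← ENNReal.ofReal_natCast, ← ENNReal.ofReal_mul (Nat.cast_nonneg _)]
    refine ENNReal.ofReal_le_ofReal ?_
    calc _ ≤ 2 * Real.exp (n * (R * Real.log 2)) * Real.exp (-(n * (I - δ))) := by
          gcongr; exact numMessages_le hR n
      _ = 2 * Real.exp (-(n * δ)) := by
          rw [mul_assoc, ← Real.exp_add]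
          congr 2
          rw [hδ]; ring

/-- Above capacity, every decoder of the random code fails as the sub-block length grows. -/
lemma exists_tendsto_sum_measure_decode {σ2 E R : ℝ} (hσ : 0 < σ2) (hE : 0 < E)
    (a b c : ℂ) {M m₀ : ℕ} (hM : 0 < M) (hm₀ : m₀ ≤ M)
    (hI : mutualInfo (E / σ2) (m₀ / M) a b c < R * Real.log 2) :
    ∃ ε : ℕ → ℝ≥0∞, Tendsto ε atTop (𝓝 0) ∧ ∀ j : ℕ, 0 < j →
      ∀ dec : (Fin (numMessages R (M * (2 * j))) → Fin (M * (2 * j)) → ℂ) →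
        (Fin (M * (2 * j)) → ℂ) → Fin (numMessages R (M * (2 * j))),
      Measurable (fun p : (Fin (numMessages R (M * (2 * j))) → Fin (M * (2 * j)) → ℂ) ×
        (Fin (M * (2 * j)) → ℂ) => dec p.1 p.2) →
      ∑ m, ((Measure.pi fun _ : Fin (numMessages R (M * (2 * j))) =>
        complexGaussianVec (M * (2 * j)) E).prod (complexGaussianVec (M * (2 * j)) σ2))
        {p | dec p.1 (fun k => signal a b c (m₀ * (2 * j)) (p.1 m) k + p.2 k) = m} ≤
      numMessages R (M * (2 * j)) * ε j := by
  obtain ⟨K, -, hK⟩ := exists_measure_infoDensity_le hσ hE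
  set I := mutualInfo (E / σ2) (m₀ / M) a b c with hIdef
  -- The threshold for the information density is halfway between mutual information and rate.
  set δ : ℝ := (R * Real.log 2 - I) / 2 with hδ
  have hδ0 : 0 < δ := by rw [hδ]; linarith
  refine ⟨_, tendsto_rate_bound hM K 1 hδ0, fun j hj => ?_⟩
  have hsum := sum_log_gain (E := E) hσ a b c hM hm₀ (2 * j)
  have hse : Even (m₀ * (2 * j)) := ⟨m₀ * j, by ring⟩
  have hne : Even (M * (2 * j)) := ⟨M * j, by ring⟩
  have hn0 : (0 : ℝ) < (M * (2 * j) : ℕ) := by exact_mod_cast (by positivity : 0 < M * (2 * j))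
  rw [← hIdef] at hsum
  generalize M * (2 * j) = n at *
  intro dec hdec
  refine (sum_measure_prod_decode_le hσ hE a b c (m₀ * (2 * j)) hdec (n * (I + δ))).trans ?_
  refine le_trans (add_le_add ?_ ?_) (mul_add _ _ _).symm.le
  · gcongr
    refine (measure_mono ?_).trans (hK a b c n _ hne hse (n * δ) (by positivity))
    intro p hp
    have hp : n * (I + δ) < infoDensity σ2 E a b c (m₀ * (2 * j)) p.1
      (fun k => signal a b c (m₀ * (2 * j)) p.1 k + p.2 k) := hp
    rw [Set.mem_ofPred_eq, hsum]
    refine le_trans ?_ (le_abs_self _)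
    linarith
  · rw [← ENNReal.ofReal_natCast, ← ENNReal.ofReal_mul (Nat.cast_nonneg _)]
    refine ENNReal.ofReal_le_ofReal ?_
    calc Real.exp (n * (I + δ)) = Real.exp (n * (R * Real.log 2)) * (1 * Real.exp (-(n * δ))) := by
          rw [one_mul, ← Real.exp_add]
          congr 1
          rw [hδ]; ring
      _ ≤ _ := by gcongr; exact exp_le_numMessages R n

/-! ### The error probability given the channel gains -/

lemma measurable_listenBlocks (rule : StartRule) (M : ℕ) (R c ρ : ℝ) :
    Measurable (listenBlocks rule M R c ρ) := by
  unfold listenBlocks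
  refine Measurable.ite (measurableSet_singleton 0) measurable_const ?_
  refine measurable_const.min (measurable_const.max (Nat.measurable_ceil.comp ?_))
  unfold Real.logb
  fun_prop

lemma listenBlocks_le (rule : StartRule) (M : ℕ) (R c ρ : ℝ) (h : ℂ) :
    listenBlocks rule M R c ρ h ≤ M := by
  unfold listenBlocks
  split_ifs
  · exact le_rfl
  · exact min_le_left _ _

lemma measurable_relayDecision {N n : ℕ} [NeZero N] (s : ℕ) (m : Fin N) {α : Type*}
    [MeasurableSpace α] {C : α → Fin N → Fin n → ℂ} {h : α → ℂ} {w : α → Fin n → ℂ}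
    (hC : Measurable C) (hh : Measurable h) (hw : Measurable w) :
    Measurable fun p => relayDecision s (C p) (h p) (w p) m := by
  have hCm : ∀ m k, Measurable fun p => C p m k := fun m k => by fun_prop
  have hwk : ∀ k, Measurable fun p => w p k := fun k => by fun_prop
  refine measurable_argminIdx.comp (measurable_pi_lambda _ fun m' =>
    Finset.measurable_sum _ fun k _ => ?_)
  split_ifs
  · exact ((((hh.mul (hCm m k)).add (hwk k)).sub (hh.mul (hCm m' k))).norm).pow_const 2
  · exact measurable_const

lemma measurable_destDecision {N n : ℕ} [NeZero N] (s : ℕ) {α : Type*}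
    [MeasurableSpace α] {C : α → Fin N → Fin n → ℂ} {g₁ g₂ : α → ℂ} {y : α → Fin n → ℂ}
    (hC : Measurable C) (hg₁ : Measurable g₁) (hg₂ : Measurable g₂) (hy : Measurable y) :
    Measurable fun p => destDecision s (C p) (g₁ p) (g₂ p) (y p) := by
  have hCm : ∀ m k, Measurable fun p => C p m k := fun m k => by fun_prop
  have hyk : ∀ k, Measurable fun p => y p k := fun k => by fun_prop
  have hC₁ : ∀ m, Measurable fun p => C p m := fun m => (measurable_pi_apply m).comp hC
  have hR : ∀ m k, Measurable fun p => relaySignal s (C p m) k := fun m k =>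
    (measurable_relaySignal s k).comp (hC₁ m)
  refine measurable_argminIdx.comp (measurable_pi_lambda _ fun m' =>
    Finset.measurable_sum _ fun k _ => ?_)
  exact (((hyk k).sub ((hg₁.mul (hCm m' k)).add (hg₂.mul (hR m' k)))).norm).pow_const 2

lemma measurable_received {N n : ℕ} (s : ℕ) (m m₁ : Fin N) {α : Type*}
    [MeasurableSpace α] {C : α → Fin N → Fin n → ℂ} {g₁ g₂ : α → ℂ} {v : α → Fin n → ℂ}
    (hC : Measurable C) (hg₁ : Measurable g₁) (hg₂ : Measurable g₂) (hv : Measurable v) :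
    Measurable fun p => received s (C p) (g₁ p) (g₂ p) (v p) m m₁ := by
  refine measurable_pi_lambda _ fun k => ?_
  have hCm : Measurable fun p => C p m k := by fun_prop
  have hvk : Measurable fun p => v p k := by fun_prop
  have hCm₁ : Measurable fun p => C p m₁ := (measurable_pi_apply m₁).comp hC
  have hR : Measurable fun p => relaySignal s (C p m₁) k :=
    (measurable_relaySignal s k).comp hCm₁
  exact ((hg₁.mul hCm).add (hg₂.mul hR)).add hvk

/-- Measurability of the error event: decompose by the listening time `L` and by the decision of
the relay. -/
lemma measurableSet_destDecision_ne {N n : ℕ} [NeZero N] {L : ℂ → ℕ} (hL : Measurable L)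
    (m : Fin N) :
    MeasurableSet {ω : Outcome N n | destDecision (L ω.2.1.1) ω.1 ω.2.1.2.1 ω.2.1.2.2
      (received (L ω.2.1.1) ω.1 ω.2.1.2.1 ω.2.1.2.2 ω.2.2.2 m
        (relayDecision (L ω.2.1.1) ω.1 ω.2.1.1 ω.2.2.1 m)) ≠ m} := by
  have hC : Measurable fun ω : Outcome N n => ω.1 := measurable_fst
  have hh : Measurable fun ω : Outcome N n => ω.2.1.1 := by fun_prop
  have hg₁ : Measurable fun ω : Outcome N n => ω.2.1.2.1 := by fun_prop
  have hg₂ : Measurable fun ω : Outcome N n => ω.2.1.2.2 := by fun_prop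
  have hw : Measurable fun ω : Outcome N n => ω.2.2.1 := by fun_prop
  have hv : Measurable fun ω : Outcome N n => ω.2.2.2 := by fun_prop
  have : {ω : Outcome N n | destDecision (L ω.2.1.1) ω.1 ω.2.1.2.1 ω.2.1.2.2
      (received (L ω.2.1.1) ω.1 ω.2.1.2.1 ω.2.1.2.2 ω.2.2.2 m
        (relayDecision (L ω.2.1.1) ω.1 ω.2.1.1 ω.2.2.1 m)) ≠ m} = ⋃ (l : ℕ) (m₁ : Fin N),
      ({ω | L ω.2.1.1 = l} ∩ {ω | relayDecision l ω.1 ω.2.1.1 ω.2.2.1 m = m₁}) ∩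
      {ω | destDecision l ω.1 ω.2.1.2.1 ω.2.1.2.2
        (received l ω.1 ω.2.1.2.1 ω.2.1.2.2 ω.2.2.2 m m₁) ≠ m} := by
    ext ω
    simp only [Set.mem_iUnion, Set.mem_inter_iff, Set.mem_ofPred_eq]
    constructor
    · intro hω
      exact ⟨_, _, ⟨rfl, rfl⟩, hω⟩
    · rintro ⟨l, m₁, ⟨h1, h2⟩, h3⟩
      rw [h1, h2]
      exact h3
  rw [this]
  refine MeasurableSet.iUnion fun l => MeasurableSet.iUnion fun m₁ => ((?_ : MeasurableSet _).inter
    (?_ : MeasurableSet _)).inter (?_ : MeasurableSet _)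
  · exact (hL.comp hh) (measurableSet_singleton l)
  · exact (measurable_relayDecision l m hC hh hw) (measurableSet_singleton m₁)
  · exact (measurable_destDecision l hC hg₁ hg₂
      (measurable_received l m m₁ hC hg₁ hg₂ hv)) (measurableSet_singleton m).compl

lemma measurableSet_errorEvent (rule : StartRule) (M T : ℕ) (R c ρ : ℝ)
    (m : Fin (numMessages R (M * T))) : MeasurableSet (errorEvent rule M T R c ρ m) :=
  measurableSet_destDecision_ne (L := fun h => listenBlocks rule M R c ρ h * T)
    ((measurable_listenBlocks rule M R c ρ).mul_const T) m

lemma signal_same {n : ℕ} (g₁ g₂ : ℂ) (s : ℕ) (x : Fin n → ℂ) (k : Fin n) :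
    signal g₁ g₁ g₂ s x k = g₁ * x k + g₂ * relaySignal s x k := by
  unfold signal
  split_ifs with h
  · simp [relaySignal, h]
  · rfl

lemma infoDensity_eq_sub {n : ℕ} (σ2 E : ℝ) (a b c : ℂ) (s : ℕ) (x y : Fin n → ℂ) :
    infoDensity σ2 E a b c s x y = ∑ k : Fin n, (Real.log ((σ2 + gain a b c s k * E) / σ2) +
      ‖y k‖ ^ 2 / (σ2 + gain a b c s k * E)) - (∑ k, ‖y k - signal a b c s x k‖ ^ 2) / σ2 := by
  rw [infoDensity, Finset.sum_sub_distrib, Finset.sum_div]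

lemma infoDensity_le_of_sum_le {n : ℕ} {σ2 : ℝ} (hσ : 0 < σ2) (E : ℝ) (a b c : ℂ) (s : ℕ)
    {x x' y : Fin n → ℂ}
    (h : ∑ k, ‖y k - signal a b c s x' k‖ ^ 2 ≤ ∑ k, ‖y k - signal a b c s x k‖ ^ 2) :
    infoDensity σ2 E a b c s x y ≤ infoDensity σ2 E a b c s x' y := by
  rw [infoDensity_eq_sub, infoDensity_eq_sub]
  gcongr

lemma relayDecision_eq {N n : ℕ} [NeZero N] (s : ℕ) (C : Fin N → Fin n → ℂ) (h : ℂ)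
    (w : Fin n → ℂ) (m : Fin N) :
    relayDecision s C h w m = argminIdx (fun m' => ∑ k : Fin n, if (k : ℕ) < s then
      ‖(signal h 0 0 s (C m) k + w k) - h * C m' k‖ ^ 2 else 0) := by
  unfold relayDecision
  congr 1
  funext m'
  refine Finset.sum_congr rfl fun k _ => ?_
  split_ifs with hk
  · rw [signal_of_lt hk]
  · rfl

lemma destDecision_received_eq {N n : ℕ} [NeZero N] (s : ℕ) (C : Fin N → Fin n → ℂ) (g₁ g₂ : ℂ)
    (v : Fin n → ℂ) (m : Fin N) :
    destDecision s C g₁ g₂ (received s C g₁ g₂ v m m) = argminIdx (fun m' => ∑ k : Fin n,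
      ‖(signal g₁ g₁ g₂ s (C m) k + v k) - signal g₁ g₁ g₂ s (C m') k‖ ^ 2) := by
  simp only [destDecision, received, signal_same]

/-- After the listening phase the channel with `b = c = 0` delivers noise only, which contributes
the same to the information density of all codewords. -/
lemma relay_metric_infoDensity_le {n : ℕ} {σ2 : ℝ} (hσ : 0 < σ2) (E : ℝ) (h : ℂ) (s : ℕ)
    (y x x' : Fin n → ℂ)
    (hD : (∑ k : Fin n, if (k : ℕ) < s then ‖y k - h * x' k‖ ^ 2 else 0) ≤
      ∑ k : Fin n, if (k : ℕ) < s then ‖y k - h * x k‖ ^ 2 else 0) :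
    infoDensity σ2 E h 0 0 s x y ≤ infoDensity σ2 E h 0 0 s x' y := by
  refine infoDensity_le_of_sum_le hσ E h 0 0 s ?_
  have key : ∀ x : Fin n → ℂ, ∑ k, ‖y k - signal h 0 0 s x k‖ ^ 2 =
      (∑ k : Fin n, if (k : ℕ) < s then ‖y k - h * x k‖ ^ 2 else 0) +
      ∑ k : Fin n, if (k : ℕ) < s then 0 else ‖y k‖ ^ 2 := by
    intro x
    rw [← Finset.sum_add_distrib]
    refine Finset.sum_congr rfl fun k _ => ?_
    unfold signal
    split_ifs <;> simp
  rw [key, key]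
  linarith

/-- The error probability for given channel gains `(h, g₁, g₂)`, averaged over messages, codebook
and noises. -/
def condErrorProb (rule : StartRule) (σv2 σw2 : ℝ) (M T : ℕ) (R ρ : ℝ) (γ : ℂ × ℂ × ℂ) : ℝ≥0∞ :=
  (∑ m : Fin (numMessages R (M * T)),
    ((Measure.pi fun _ : Fin (numMessages R (M * T)) => complexGaussianVec (M * T) (ρ * σv2)).prod
      ((complexGaussianVec (M * T) σw2).prod (complexGaussianVec (M * T) σv2)))
      {q | (q.1, γ, q.2) ∈ errorEvent rule M T R (σv2 / σw2) ρ m}) / numMessages R (M * T)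

/-- The law of the channel gains. -/
def gainLaw : Measure (ℂ × ℂ × ℂ) :=
  (complexGaussian 1).prod ((complexGaussian 1).prod (complexGaussian 1))

instance : IsProbabilityMeasure gainLaw := by unfold gainLaw; infer_instance

lemma measurePreserving_reorder {α β δ : Type*} [MeasurableSpace α] [MeasurableSpace β]
    [MeasurableSpace δ] (μ : Measure α) (Γ : Measure β) (ν : Measure δ) [SFinite μ] [SFinite Γ]
    [SFinite ν] :
    MeasurePreserving (fun p : β × (α × δ) => (p.2.1, (p.1, p.2.2)))
      (Γ.prod (μ.prod ν)) (μ.prod (Γ.prod ν)) := by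
  have h1 := (measurePreserving_prodAssoc Γ μ ν).symm MeasurableEquiv.prodAssoc
  have h2 := (Measure.measurePreserving_swap (μ := Γ) (ν := μ)).prod (MeasurePreserving.id ν)
  have h3 := measurePreserving_prodAssoc μ Γ ν
  exact h3.comp (h2.comp h1)

lemma measurable_measure_errorEvent (rule : StartRule) (σv2 σw2 : ℝ) (M T : ℕ) (R ρ : ℝ)
    (m : Fin (numMessages R (M * T))) :
    Measurable fun γ : ℂ × ℂ × ℂ =>
      ((Measure.pi fun _ : Fin (numMessages R (M * T)) =>
        complexGaussianVec (M * T) (ρ * σv2)).prod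
        ((complexGaussianVec (M * T) σw2).prod (complexGaussianVec (M * T) σv2)))
        {q | (q.1, γ, q.2) ∈ errorEvent rule M T R (σv2 / σw2) ρ m} := by
  refine measurable_measure_prodMk_left (ν := (Measure.pi fun _ : Fin (numMessages R (M * T)) =>
      complexGaussianVec (M * T) (ρ * σv2)).prod
      ((complexGaussianVec (M * T) σw2).prod (complexGaussianVec (M * T) σv2)))
    (s := (fun p : (ℂ × ℂ × ℂ) × ((Fin (numMessages R (M * T)) → Fin (M * T) → ℂ) ×
      ((Fin (M * T) → ℂ) × (Fin (M * T) → ℂ))) => (p.2.1, (p.1, p.2.2))) ⁻¹'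
      errorEvent rule M T R (σv2 / σw2) ρ m) ?_
  exact (measurableSet_errorEvent rule M T R (σv2 / σw2) ρ m).preimage (by fun_prop)

lemma measurable_condErrorProb (rule : StartRule) (σv2 σw2 : ℝ) (M T : ℕ) (R ρ : ℝ) :
    Measurable (condErrorProb rule σv2 σw2 M T R ρ) :=
  Measurable.div_const (Finset.measurable_sum _ fun m _ =>
    measurable_measure_errorEvent rule σv2 σw2 M T R ρ m) _

lemma condErrorProb_le_one (rule : StartRule) (σv2 σw2 : ℝ) (M T : ℕ) (R ρ : ℝ) (γ : ℂ × ℂ × ℂ) :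
    condErrorProb rule σv2 σw2 M T R ρ γ ≤ 1 := by
  refine ENNReal.div_le_of_le_mul ?_
  rw [one_mul]
  refine (Finset.sum_le_sum fun m _ => prob_le_one).trans ?_
  simp

lemma errorProb_eq (rule : StartRule) (σv2 σw2 : ℝ) (M T : ℕ) (R ρ : ℝ) :
    errorProb rule σv2 σw2 M T R ρ =
      (∫⁻ γ, condErrorProb rule σv2 σw2 M T R ρ γ ∂gainLaw).toReal := by
  have hN : (numMessages R (M * T) : ℝ≥0∞) ≠ 0 := by
    exact_mod_cast NeZero.ne (numMessages R (M * T))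
  unfold errorProb condErrorProb
  simp_rw [ENNReal.div_eq_inv_mul]
  rw [div_eq_inv_mul]
  have hmeas := measurable_measure_errorEvent rule σv2 σw2 M T R ρ
  rw [lintegral_const_mul _ (Finset.measurable_sum _ fun m _ => hmeas m),
    lintegral_finsetSum _ fun m _ => hmeas m, ENNReal.toReal_mul, ENNReal.toReal_sum,
    ENNReal.toReal_inv, ENNReal.toReal_natCast]
  · congr 1
    refine Finset.sum_congr rfl fun m _ => ?_
    have hpre := (measurePreserving_reorder
      (Measure.pi fun _ : Fin (numMessages R (M * T)) => complexGaussianVec (M * T) (ρ * σv2))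
      gainLaw ((complexGaussianVec (M * T) σw2).prod (complexGaussianVec (M * T) σv2)))
    have h1 := hpre.measure_preimage
      (measurableSet_errorEvent rule M T R (σv2 / σw2) ρ m).nullMeasurableSet
    rw [Measure.real, law]
    congr 1
    refine h1.symm.trans ?_
    rw [Measure.prod_apply
      ((measurableSet_errorEvent rule M T R (σv2 / σw2) ρ m).preimage hpre.measurable)]
    rfl
  · intro m _
    refine ne_of_lt ((lintegral_mono (fun γ => prob_le_one)).trans_lt ?_)
    simp

/-! ### Asymptotics given the channel gains -/

lemma mem_errorEvent_iff {rule : StartRule} {M T : ℕ} {R c ρ : ℝ}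
    {m : Fin (numMessages R (M * T))} {C : Fin (numMessages R (M * T)) → Fin (M * T) → ℂ}
    {γ : ℂ × ℂ × ℂ} {w v : Fin (M * T) → ℂ} :
    (C, γ, w, v) ∈ errorEvent rule M T R c ρ m ↔
      destDecision (listenBlocks rule M R c ρ γ.1 * T) C γ.2.1 γ.2.2
        (received (listenBlocks rule M R c ρ γ.1 * T) C γ.2.1 γ.2.2 v m
          (relayDecision (listenBlocks rule M R c ρ γ.1 * T) C γ.1 w m)) ≠ m := Iff.rfl

lemma received_of_le {N n : ℕ} {s : ℕ} (hs : n ≤ s) (C : Fin N → Fin n → ℂ) (g₁ g₂ : ℂ)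
    (v : Fin n → ℂ) (m m₁ m₂ : Fin N) :
    received s C g₁ g₂ v m m₁ = received s C g₁ g₂ v m m₂ := by
  funext k
  have : (k : ℕ) < s := lt_of_lt_of_le k.2 hs
  simp [received, relaySignal, this]

/-- The condition under which the relay does not spoil the transmission for long sub-blocks: it
stays silent, or its channel supports the rate while it listens. -/
def RelayReliable (M m₀ : ℕ) (R cρ : ℝ) (h : ℂ) : Prop :=
  m₀ = M ∨ R * Real.log 2 < mutualInfo cρ (m₀ / M) h 0 0

/-- Up to an event of vanishing probability, the destination errs exactly if it errs when the
relay sends the signal for the correct message. -/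
lemma exists_errorEvent_approx (rule : StartRule) {σv2 σw2 ρ R : ℝ} (hv : 0 < σv2) (hw : 0 < σw2)
    (hρ : 0 < ρ) (hR : 0 ≤ R) {M : ℕ} (hM : 0 < M) (γ : ℂ × ℂ × ℂ)
    (hrel : RelayReliable M (listenBlocks rule M R (σv2 / σw2) ρ γ.1) R (σv2 / σw2 * ρ) γ.1) :
    ∃ η : ℕ → ℝ≥0∞, Tendsto η atTop (𝓝 0) ∧ ∀ j : ℕ, 0 < j →
      ∀ m : Fin (numMessages R (M * (2 * j))),
      ∃ S : Set ((Fin (numMessages R (M * (2 * j))) → Fin (M * (2 * j)) → ℂ) ×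
          (Fin (M * (2 * j)) → ℂ)),
        MeasurableSet S ∧
        ((Measure.pi fun _ : Fin (numMessages R (M * (2 * j))) =>
          complexGaussianVec (M * (2 * j)) (ρ * σv2)).prod
            (complexGaussianVec (M * (2 * j)) σw2)) S ≤ η j ∧
        ∀ C w v, (C, w) ∉ S →
          ((C, γ, w, v) ∈ errorEvent rule M (2 * j) R (σv2 / σw2) ρ m ↔
          destDecision (listenBlocks rule M R (σv2 / σw2) ρ γ.1 * (2 * j)) C γ.2.1 γ.2.2
            (received (listenBlocks rule M R (σv2 / σw2) ρ γ.1 * (2 * j)) C γ.2.1 γ.2.2 v m m)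
              ≠ m) := by
  set m₀ := listenBlocks rule M R (σv2 / σw2) ρ γ.1 with hm₀
  have hm₀M : m₀ ≤ M := listenBlocks_le _ _ _ _ _ _
  -- A relay that listens throughout sends nothing, so its decision is irrelevant.
  rcases hrel with hfull | hI
  · refine ⟨fun _ => 0, tendsto_const_nhds, fun j _ m => ⟨∅, MeasurableSet.empty, by simp,
      fun C w v _ => ?_⟩⟩
    rw [mem_errorEvent_iff, ← hm₀, received_of_le (by rw [hfull]) C _ _ v m _ m]
  · have hE : 0 < ρ * σv2 := by positivity
    have hsnr : ρ * σv2 / σw2 = σv2 / σw2 * ρ := by ring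
    rw [← hsnr] at hI
    obtain ⟨η, hη, h⟩ := exists_tendsto_measure_argminIdx_ne hw hE hR γ.1 0 0 hM hm₀M hI
    refine ⟨η, hη, fun j hj m => ⟨{p | relayDecision (m₀ * (2 * j)) p.1 γ.1 p.2 m ≠ m}, ?_, ?_, ?_⟩⟩
    · exact (measurable_relayDecision (m₀ * (2 * j)) m measurable_fst measurable_const
        measurable_snd) (measurableSet_singleton m).compl
    · simp_rw [relayDecision_eq]
      exact h j hj (fun y x' => ∑ k : Fin (M * (2 * j)), if (k : ℕ) < m₀ * (2 * j) then
        ‖y k - γ.1 * x' k‖ ^ 2 else 0)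
        (fun y x x' hD => relay_metric_infoDensity_le hw _ _ _ y x x' hD) m
    · intro C w v hS
      have hS : relayDecision (m₀ * (2 * j)) C γ.1 w m = m := not_not.1 hS
      rw [mem_errorEvent_iff, ← hm₀, hS]

lemma measurePreserving_fst_fst {α β δ : Type*} [MeasurableSpace α] [MeasurableSpace β]
    [MeasurableSpace δ] (μ : Measure α) (ν : Measure β) (κ : Measure δ) [IsProbabilityMeasure μ]
    [IsProbabilityMeasure ν] [IsProbabilityMeasure κ] :
    MeasurePreserving (fun q : α × (β × δ) => (q.1, q.2.1)) (μ.prod (ν.prod κ)) (μ.prod ν) :=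
  (MeasurePreserving.id μ).prod measurePreserving_fst

lemma measurePreserving_fst_snd {α β δ : Type*} [MeasurableSpace α] [MeasurableSpace β]
    [MeasurableSpace δ] (μ : Measure α) (ν : Measure β) (κ : Measure δ) [IsProbabilityMeasure μ]
    [IsProbabilityMeasure ν] [IsProbabilityMeasure κ] :
    MeasurePreserving (fun q : α × (β × δ) => (q.1, q.2.2)) (μ.prod (ν.prod κ)) (μ.prod κ) :=
  (MeasurePreserving.id μ).prod measurePreserving_snd

lemma measurable_idealDecision {N n : ℕ} [NeZero N] (s : ℕ) (g₁ g₂ : ℂ) (m : Fin N) :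
    Measurable fun p : (Fin N → Fin n → ℂ) × (Fin n → ℂ) =>
      destDecision s p.1 g₁ g₂ (received s p.1 g₁ g₂ p.2 m m) :=
  measurable_destDecision s measurable_fst measurable_const measurable_const
    (measurable_received s m m measurable_fst measurable_const measurable_const measurable_snd)

/-- For channel gains that support the rate, the error probability vanishes. -/
lemma tendsto_condErrorProb_zero (rule : StartRule) {σv2 σw2 ρ R : ℝ} (hv : 0 < σv2)
    (hw : 0 < σw2) (hρ : 0 < ρ) (hR : 0 ≤ R) {M : ℕ} (hM : 0 < M) (γ : ℂ × ℂ × ℂ)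
    (hrel : RelayReliable M (listenBlocks rule M R (σv2 / σw2) ρ γ.1) R (σv2 / σw2 * ρ) γ.1)
    (hI : R * Real.log 2 <
      mutualInfo ρ (listenBlocks rule M R (σv2 / σw2) ρ γ.1 / M) γ.2.1 γ.2.1 γ.2.2) :
    Tendsto (fun j : ℕ => condErrorProb rule σv2 σw2 M (2 * j) R ρ γ) atTop (𝓝 0) := by
  obtain ⟨η, hη, hS⟩ := exists_errorEvent_approx rule hv hw hρ hR hM γ hrel
  set m₀ := listenBlocks rule M R (σv2 / σw2) ρ γ.1 with hm₀
  have hm₀M : m₀ ≤ M := listenBlocks_le _ _ _ _ _ _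
  have hE : 0 < ρ * σv2 := by positivity
  have hsnr : ρ * σv2 / σv2 = ρ := by field_simp
  rw [← hsnr] at hI
  obtain ⟨ε, hε, h⟩ := exists_tendsto_measure_argminIdx_ne hv hE hR γ.2.1 γ.2.1 γ.2.2 hM hm₀M hI
  have hlim : Tendsto (fun j => η j + ε j) atTop (𝓝 0) := by simpa using hη.add hε
  refine tendsto_of_tendsto_of_tendsto_of_le_of_le' tendsto_const_nhds hlim
    (Eventually.of_forall fun _ => zero_le) ?_
  filter_upwards [eventually_gt_atTop 0] with j hj
  refine ENNReal.div_le_of_le_mul ?_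
  set N := numMessages R (M * (2 * j)) with hN
  set n := M * (2 * j) with hn
  have hle : ∀ m : Fin N, ((Measure.pi fun _ : Fin N => complexGaussianVec n (ρ * σv2)).prod
      ((complexGaussianVec n σw2).prod (complexGaussianVec n σv2)))
      {q | (q.1, γ, q.2) ∈ errorEvent rule M (2 * j) R (σv2 / σw2) ρ m} ≤ η j + ε j := by
    intro m
    obtain ⟨S, hSm, hSη, hSe⟩ := hS j hj m
    set B : Set ((Fin N → Fin n → ℂ) × (Fin n → ℂ)) :=
      {p | destDecision (m₀ * (2 * j)) p.1 γ.2.1 γ.2.2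
        (received (m₀ * (2 * j)) p.1 γ.2.1 γ.2.2 p.2 m m) ≠ m} with hB
    have hBm : MeasurableSet B := (measurable_idealDecision (m₀ * (2 * j)) γ.2.1 γ.2.2 m)
      (measurableSet_singleton m).compl
    have hBε : ((Measure.pi fun _ : Fin N => complexGaussianVec n (ρ * σv2)).prod
        (complexGaussianVec n σv2)) B ≤ ε j := by
      simp only [hB, destDecision_received_eq]
      exact h j hj (fun y x' => ∑ k, ‖y k - signal γ.2.1 γ.2.1 γ.2.2 (m₀ * (2 * j)) x' k‖ ^ 2)
        (fun y x x' hD => infoDensity_le_of_sum_le hv _ _ _ _ _ hD) m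
    refine le_trans (measure_mono (t := (fun q => (q.1, q.2.1)) ⁻¹' S ∪
      (fun q => (q.1, q.2.2)) ⁻¹' B) ?_) ((measure_union_le _ _).trans (add_le_add ?_ ?_))
    · rintro ⟨C, w, v⟩ hq
      by_cases hCS : (C, w) ∈ S
      · exact Or.inl hCS
      · exact Or.inr ((hSe C w v hCS).1 hq)
    · rw [(measurePreserving_fst_fst _ _ _).measure_preimage hSm.nullMeasurableSet]
      exact hSη
    · rw [(measurePreserving_fst_snd _ _ _).measure_preimage hBm.nullMeasurableSet]
      exact hBε
  refine (Finset.sum_le_sum fun m _ => hle m).trans ?_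
  simp only [Finset.sum_const, Finset.card_univ, Fintype.card_fin, nsmul_eq_mul]
  exact (mul_comm _ _).le

/-- For channel gains that do not support the rate, the error probability tends to one. -/
lemma tendsto_one_sub_condErrorProb (rule : StartRule) {σv2 σw2 ρ R : ℝ} (hv : 0 < σv2)
    (hw : 0 < σw2) (hρ : 0 < ρ) (hR : 0 ≤ R) {M : ℕ} (hM : 0 < M) (γ : ℂ × ℂ × ℂ)
    (hrel : RelayReliable M (listenBlocks rule M R (σv2 / σw2) ρ γ.1) R (σv2 / σw2 * ρ) γ.1)
    (hI : mutualInfo ρ (listenBlocks rule M R (σv2 / σw2) ρ γ.1 / M) γ.2.1 γ.2.1 γ.2.2 <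
      R * Real.log 2) :
    Tendsto (fun j : ℕ => 1 - condErrorProb rule σv2 σw2 M (2 * j) R ρ γ) atTop (𝓝 0) := by
  obtain ⟨η, hη, hS⟩ := exists_errorEvent_approx rule hv hw hρ hR hM γ hrel
  set m₀ := listenBlocks rule M R (σv2 / σw2) ρ γ.1 with hm₀
  have hm₀M : m₀ ≤ M := listenBlocks_le _ _ _ _ _ _
  have hE : 0 < ρ * σv2 := by positivity
  have hsnr : ρ * σv2 / σv2 = ρ := by field_simp
  rw [← hsnr] at hI
  obtain ⟨ε, hε, h⟩ := exists_tendsto_sum_measure_decode hv hE γ.2.1 γ.2.1 γ.2.2 hM hm₀M hI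
  have hlim : Tendsto (fun j => η j + ε j) atTop (𝓝 0) := by simpa using hη.add hε
  refine tendsto_of_tendsto_of_tendsto_of_le_of_le' tendsto_const_nhds hlim
    (Eventually.of_forall fun _ => zero_le) ?_
  filter_upwards [eventually_gt_atTop 0] with j hj
  have hj' := h j hj
  unfold condErrorProb
  have hNpos : (numMessages R (M * (2 * j)) : ℝ≥0∞) ≠ 0 := by
    exact_mod_cast NeZero.ne (numMessages R (M * (2 * j)))
  set N := numMessages R (M * (2 * j)) with hN
  set n := M * (2 * j) with hn
  set PC := Measure.pi fun _ : Fin N => complexGaussianVec n (ρ * σv2)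
  set B : Fin N → Set ((Fin N → Fin n → ℂ) × (Fin n → ℂ)) := fun m =>
      {p | destDecision (m₀ * (2 * j)) p.1 γ.2.1 γ.2.2
        (received (m₀ * (2 * j)) p.1 γ.2.1 γ.2.2 p.2 m m) = m} with hB
  have hBm : ∀ m, MeasurableSet (B m) := fun m =>
    (measurable_idealDecision (m₀ * (2 * j)) γ.2.1 γ.2.2 m) (measurableSet_singleton m)
  have hBε : ∑ m, (PC.prod (complexGaussianVec n σv2)) (B m) ≤ N * ε j := by
    have := hj' (fun C y => destDecision (m₀ * (2 * j)) C γ.2.1 γ.2.2 y)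
      (measurable_destDecision (m₀ * (2 * j)) measurable_fst measurable_const measurable_const
        measurable_snd)
    refine le_trans (le_of_eq ?_) this
    refine Finset.sum_congr rfl fun m _ => ?_
    simp only [hB, signal_same]
    rfl
  have hle : ∀ m : Fin N, 1 ≤ (PC.prod
      ((complexGaussianVec n σw2).prod (complexGaussianVec n σv2)))
      {q | (q.1, γ, q.2) ∈ errorEvent rule M (2 * j) R (σv2 / σw2) ρ m} +
      (η j + (PC.prod (complexGaussianVec n σv2)) (B m)) := by
    intro m
    obtain ⟨S, hSm, hSη, hSe⟩ := hS j hj m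
    rw [← (measurePreserving_fst_snd PC (complexGaussianVec n σw2)
      (complexGaussianVec n σv2)).measure_preimage (hBm m).nullMeasurableSet]
    refine le_trans ?_ (add_le_add le_rfl (add_le_add ((measurePreserving_fst_fst PC
      (complexGaussianVec n σw2) (complexGaussianVec n σv2)).measure_preimage
        hSm.nullMeasurableSet |>.le.trans hSη) le_rfl))
    refine le_trans ?_ (add_le_add le_rfl (measure_union_le _ _))
    refine le_trans ?_ (measure_union_le _ _)
    rw [← measure_univ (μ := PC.prod ((complexGaussianVec n σw2).prod (complexGaussianVec n σv2)))]
    refine measure_mono ?_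
    rintro ⟨C, w, v⟩ -
    by_cases hCS : (C, w) ∈ S
    · exact Or.inr (Or.inl hCS)
    by_cases hB' : (C, v) ∈ B m
    · exact Or.inr (Or.inr hB')
    · exact Or.inl ((hSe C w v hCS).2 hB')
  have hsum := Finset.sum_le_sum fun m (_ : m ∈ (Finset.univ : Finset (Fin N))) => hle m
  rw [Finset.sum_add_distrib, Finset.sum_add_distrib] at hsum
  simp only [Finset.sum_const, Finset.card_univ, Fintype.card_fin, nsmul_eq_mul, mul_one] at hsum
  rw [tsub_le_iff_right]
  have hdiv : (1 : ℝ≥0∞) = (N : ℝ≥0∞) / N := (ENNReal.div_self hNpos (by simp)).symm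
  rw [hdiv]
  refine (ENNReal.div_le_div_right (hsum.trans (add_le_add le_rfl
    (add_le_add le_rfl hBε))) _).trans (le_of_eq ?_)
  rw [← mul_add, ENNReal.add_div, add_comm, mul_comm, ENNReal.mul_div_cancel_right hNpos (by simp)]

/-! ### Outage probabilities as limits of error probabilities -/

/-- The waiting rule makes the relay's channel support the rate up to equality, and equality holds
only for gains on countably many circles. -/
lemma relayReliable_of_notMem {rule : StartRule} {c ρ R : ℝ} (hc : 0 < c) (hρ : 0 < ρ)
    (hR : 0 < R) {M : ℕ} (hM : 0 < M) {h : ℂ}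
    (hh : ∀ l : ℕ, ‖h‖ ≠ √(((2 : ℝ) ^ (M * R / l) - 1) / (c * ρ))) :
    RelayReliable M (listenBlocks rule M R c ρ h) R (c * ρ) h := by
  by_cases h0 : h = 0
  · left; simp [listenBlocks, h0]
  by_cases hfull : listenBlocks rule M R c ρ h = M
  · exact Or.inl hfull
  right
  set m₀ := listenBlocks rule M R c ρ h with hm₀
  have hMR : (0 : ℝ) < M * R := by have : (0 : ℝ) < M := by exact_mod_cast hM
                                   positivity
  have hx : 0 < ‖h‖ ^ 2 * c * ρ := by have := norm_pos_iff.2 h0; positivity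
  have hlog : 0 < Real.logb 2 (1 + ‖h‖ ^ 2 * c * ρ) := Real.logb_pos one_lt_two (by linarith)
  set q : ℝ := M * R / Real.logb 2 (1 + ‖h‖ ^ 2 * c * ρ) with hq
  have hq0 : 0 < q := by positivity
  have hqm : q ≤ m₀ := by
    have h1 : m₀ = min M (max (rule.minWait M) ⌈q⌉₊) := by rw [hm₀, listenBlocks, if_neg h0]
    rcases min_choice M (max (rule.minWait M) ⌈q⌉₊) with h2 | h2
    · exact absurd (h1.trans h2) hfull
    · have h3 : ⌈q⌉₊ ≤ m₀ := by rw [h1, h2]; exact le_max_right _ _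
      exact (Nat.le_ceil q).trans (by exact_mod_cast h3)
  have hm0 : (0 : ℝ) < m₀ := hq0.trans_le hqm
  have hne : q ≠ m₀ := by
    intro he
    have h1 : Real.logb 2 (1 + ‖h‖ ^ 2 * c * ρ) = M * R / m₀ := by
      rw [← he, hq]; field_simp
    have h2 : (2 : ℝ) ^ (M * R / m₀) = 1 + ‖h‖ ^ 2 * c * ρ := by
      rw [← h1, Real.rpow_logb two_pos (by norm_num) (by linarith)]
    refine hh m₀ ?_
    rw [h2, show (1 + ‖h‖ ^ 2 * c * ρ - 1) / (c * ρ) = ‖h‖ ^ 2 by field_simp; ring,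
      Real.sqrt_sq (norm_nonneg h)]
  have hlt : q < m₀ := lt_of_le_of_ne hqm hne
  rw [hq, div_lt_iff₀ hlog, Real.logb, mul_div_assoc', lt_div_iff₀ (Real.log_pos one_lt_two)] at hlt
  have hM' : (0 : ℝ) < M := by exact_mod_cast hM
  have hval : mutualInfo (c * ρ) (m₀ / M) h 0 0 =
      (m₀ * Real.log (1 + ‖h‖ ^ 2 * c * ρ)) / M := by
    simp only [mutualInfo, norm_zero]
    rw [show ‖h‖ ^ 2 * (c * ρ) = ‖h‖ ^ 2 * c * ρ by ring]
    norm_num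
    ring
  rw [hval, lt_div_iff₀ hM']
  linarith

/-- The circles `‖h‖ = const` are null sets of the gain distribution. -/
lemma ae_relayReliable (rule : StartRule) {c ρ R : ℝ} (hc : 0 < c) (hρ : 0 < ρ)
    (hR : 0 < R) {M : ℕ} (hM : 0 < M) :
    ∀ᵐ γ ∂gainLaw, RelayReliable M (listenBlocks rule M R c ρ γ.1) R (c * ρ) γ.1 := by
  have h1 : ∀ᵐ h ∂complexGaussian 1,
      ∀ l : ℕ, ‖h‖ ≠ √(((2 : ℝ) ^ (M * R / l) - 1) / (c * ρ)) := by
    refine ae_all_iff.2 fun l => ?_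
    suffices hvol : ∀ᵐ h ∂(volume : Measure ℂ),
        ‖h‖ ≠ √(((2 : ℝ) ^ (M * R / l) - 1) / (c * ρ)) from
      (complexGaussian_absolutelyContinuous one_pos).ae_le hvol
    rw [ae_iff]
    have : {h : ℂ | ¬ ‖h‖ ≠ √(((2 : ℝ) ^ (M * R / l) - 1) / (c * ρ))} =
        Metric.sphere 0 (√(((2 : ℝ) ^ (M * R / l) - 1) / (c * ρ))) := by
      ext h; simp
    rw [this]
    exact Measure.addHaar_sphere _ _ _
  have h2 : ∀ᵐ γ ∂gainLaw, ∀ l : ℕ, ‖γ.1‖ ≠ √(((2 : ℝ) ^ (M * R / l) - 1) / (c * ρ)) :=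
    Measure.quasiMeasurePreserving_fst.ae h1
  filter_upwards [h2] with γ hγ
  exact relayReliable_of_notMem hc hρ hR hM hγ

/-- The mutual information (in nats per symbol) of the destination's channel. -/
def destInfo (rule : StartRule) (M : ℕ) (R c ρ : ℝ) (γ : ℂ × ℂ × ℂ) : ℝ :=
  mutualInfo ρ (listenBlocks rule M R c ρ γ.1 / M) γ.2.1 γ.2.1 γ.2.2

lemma measurable_destInfo (rule : StartRule) (M : ℕ) (R c ρ : ℝ) :
    Measurable (destInfo rule M R c ρ) := by
  have h : Measurable fun γ : ℂ × ℂ × ℂ => (listenBlocks rule M R c ρ γ.1 : ℝ) :=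
    measurable_from_nat.comp ((measurable_listenBlocks rule M R c ρ).comp measurable_fst)
  unfold destInfo mutualInfo
  fun_prop

/-- For long sub-blocks the error probability lies between the outage probabilities. -/
lemma exists_subblock_threshold (rule : StartRule) {σv2 σw2 ρ R : ℝ} (hv : 0 < σv2) (hw : 0 < σw2)
    (hρ : 0 < ρ) (hR : 0 < R) {M : ℕ} (hM : 0 < M) {δ : ℝ} (hδ : 0 < δ) :
    ∃ T₀ : ℕ, ∀ T : ℕ, Even T → T₀ ≤ T →
      gainLaw.real {γ | destInfo rule M R (σv2 / σw2) ρ γ < R * Real.log 2} - δ ≤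
        errorProb rule σv2 σw2 M T R ρ ∧
      errorProb rule σv2 σw2 M T R ρ ≤
        gainLaw.real {γ | destInfo rule M R (σv2 / σw2) ρ γ ≤ R * Real.log 2} + δ := by
  have hc : 0 < σv2 / σw2 := by positivity
  have hrel := ae_relayReliable rule hc hρ hR hM
  have hIm := measurable_destInfo rule M R (σv2 / σw2) ρ
  set U : Set (ℂ × ℂ × ℂ) := {γ | R * Real.log 2 < destInfo rule M R (σv2 / σw2) ρ γ} with hU
  set V : Set (ℂ × ℂ × ℂ) := {γ | destInfo rule M R (σv2 / σw2) ρ γ < R * Real.log 2} with hV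
  have hUm : MeasurableSet U := measurableSet_lt measurable_const hIm
  have hVm : MeasurableSet V := measurableSet_lt hIm measurable_const
  set p : ℕ → ℂ × ℂ × ℂ → ℝ≥0∞ := fun j => condErrorProb rule σv2 σw2 M (2 * j) R ρ with hp
  have hpm : ∀ j, Measurable (p j) := fun j => measurable_condErrorProb _ _ _ _ _ _ _
  have hp1 : ∀ j γ, p j γ ≤ 1 := fun j γ => condErrorProb_le_one _ _ _ _ _ _ _ _
  have hlimU : Tendsto (fun j => ∫⁻ γ, U.indicator (p j) γ ∂gainLaw) atTop (𝓝 0) := by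
    have := tendsto_lintegral_of_dominated_convergence (μ := gainLaw)
      (F := fun j => U.indicator (p j)) (f := fun _ => 0) (fun _ => 1)
      (fun j => (hpm j).indicator hUm)
      (fun j => Eventually.of_forall fun γ => (Set.indicator_le_self' (by simp) γ).trans (hp1 j γ))
      (by simp) (by
        filter_upwards [hrel] with γ hγ
        by_cases h : γ ∈ U
        · simp only [Set.indicator_of_mem h]
          exact tendsto_condErrorProb_zero rule hv hw hρ hR.le hM γ hγ h
        · simp [Set.indicator_of_notMem h])
    simpa using this
  have hlimV : Tendsto (fun j => ∫⁻ γ, V.indicator (fun γ => 1 - p j γ) γ ∂gainLaw)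
      atTop (𝓝 0) := by
    have := tendsto_lintegral_of_dominated_convergence (μ := gainLaw)
      (F := fun j => V.indicator (fun γ => 1 - p j γ)) (f := fun _ => 0) (fun _ => 1)
      (fun j => (measurable_const.sub (hpm j)).indicator hVm)
      (fun j => Eventually.of_forall fun γ => (Set.indicator_le_self' (by simp) γ).trans
        tsub_le_self)
      (by simp) (by
        filter_upwards [hrel] with γ hγ
        by_cases h : γ ∈ V
        · simp only [Set.indicator_of_mem h]
          exact tendsto_one_sub_condErrorProb rule hv hw hρ hR.le hM γ hγ h
        · simp [Set.indicator_of_notMem h])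
    simpa using this
  have hδ' : (0 : ℝ≥0∞) < ENNReal.ofReal δ := ENNReal.ofReal_pos.2 hδ
  obtain ⟨J, hJ⟩ := eventually_atTop.1
    ((hlimU.eventually (ge_mem_nhds hδ')).and (hlimV.eventually (ge_mem_nhds hδ')))
  refine ⟨2 * J, fun T hT hJT => ?_⟩
  obtain ⟨j, rfl⟩ : ∃ j, T = 2 * j := by obtain ⟨j, hj⟩ := hT; exact ⟨j, by omega⟩
  obtain ⟨h1, h2⟩ := hJ j (by omega)
  rw [errorProb_eq]
  have hfin : ∫⁻ γ, p j γ ∂gainLaw ≠ ∞ :=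
    ne_of_lt ((lintegral_mono (hp1 j)).trans_lt (by simp))
  constructor
  · have key : gainLaw V ≤ ∫⁻ γ, p j γ ∂gainLaw + ENNReal.ofReal δ := by
      refine le_trans ?_ (add_le_add le_rfl h2)
      rw [← lintegral_add_left (hpm j), ← lintegral_indicator_one hVm]
      refine lintegral_mono fun γ => ?_
      by_cases h : γ ∈ V
      · simp only [Set.indicator_of_mem h, Pi.one_apply]
        exact le_add_tsub
      · simp [Set.indicator_of_notMem h]
    have := ENNReal.toReal_mono (by finiteness) key
    rw [ENNReal.toReal_add hfin (by simp), ENNReal.toReal_ofReal hδ.le] at this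
    change (gainLaw V).toReal - δ ≤ _
    linarith
  · have key : ∫⁻ γ, p j γ ∂gainLaw ≤ gainLaw Uᶜ + ENNReal.ofReal δ := by
      refine le_trans ?_ (add_le_add le_rfl h1)
      rw [← lintegral_indicator_one hUm.compl,
        ← lintegral_add_left (measurable_one.indicator hUm.compl)]
      refine lintegral_mono fun γ => ?_
      by_cases h : γ ∈ U
      · simp [Set.indicator_of_mem h]
      · rw [Set.indicator_of_notMem h, Set.indicator_of_mem (Set.mem_compl h), add_zero]
        exact hp1 j γ
    have := ENNReal.toReal_mono (by finiteness) key
    rw [ENNReal.toReal_add (by finiteness) (by simp), ENNReal.toReal_ofReal hδ.le] at this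
    have hUc : Uᶜ = {γ | destInfo rule M R (σv2 / σw2) ρ γ ≤ R * Real.log 2} := by
      ext γ; simp [hU]
    rw [hUc] at this
    exact this

/-! ### Exponents of decay -/

/-- `f` decays at least with exponent `d`: `f ρ ≤ ρ ^ (-d + o(1))`. -/
def ExponentGE (f : ℝ → ℝ) (d : ℝ) : Prop :=
  ∀ ε : ℝ, 0 < ε → ∀ᶠ ρ in atTop, f ρ ≤ ρ ^ (-d + ε)

/-- `f` decays at most with exponent `d`: `ρ ^ (-d - o(1)) ≤ f ρ`. -/
def ExponentLE (f : ℝ → ℝ) (d : ℝ) : Prop :=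
  ∀ ε : ℝ, 0 < ε → ∀ᶠ ρ in atTop, ρ ^ (-d - ε) ≤ f ρ

lemma ExponentGE.mono {f g : ℝ → ℝ} {d : ℝ} (hf : ExponentGE f d) (h : ∀ᶠ ρ in atTop, g ρ ≤ f ρ) :
    ExponentGE g d := fun ε hε => by
  filter_upwards [hf ε hε, h] with ρ h1 h2 using h2.trans h1

lemma ExponentLE.mono {f g : ℝ → ℝ} {d : ℝ} (hf : ExponentLE f d) (h : ∀ᶠ ρ in atTop, f ρ ≤ g ρ) :
    ExponentLE g d := fun ε hε => by
  filter_upwards [hf ε hε, h] with ρ h1 h2 using h1.trans h2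

lemma ExponentGE.weaken {f : ℝ → ℝ} {d d' : ℝ} (hf : ExponentGE f d) (h : d' ≤ d) :
    ExponentGE f d' := fun ε hε => by
  filter_upwards [hf ε hε, eventually_ge_atTop 1] with ρ h1 h2
  exact h1.trans (Real.rpow_le_rpow_of_exponent_le h2 (by linarith))

lemma ExponentLE.weaken {f : ℝ → ℝ} {d d' : ℝ} (hf : ExponentLE f d) (h : d ≤ d') :
    ExponentLE f d' := fun ε hε => by
  filter_upwards [hf ε hε, eventually_ge_atTop 1] with ρ h1 h2
  exact (Real.rpow_le_rpow_of_exponent_le h2 (by linarith)).trans h1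

lemma exponentGE_of_forall_lt {f : ℝ → ℝ} {d : ℝ} (h : ∀ d' < d, ExponentGE f d') :
    ExponentGE f d := fun ε hε => by
  filter_upwards [h (d - ε / 2) (by linarith) (ε / 2) (by linarith)] with ρ h1
  rwa [show -(d - ε / 2) + ε / 2 = -d + ε by ring] at h1

lemma ExponentGE.mul {f g : ℝ → ℝ} {d d' : ℝ} (hf : ExponentGE f d) (hg : ExponentGE g d')
    (hg0 : ∀ᶠ ρ in atTop, 0 ≤ g ρ) : ExponentGE (fun ρ => f ρ * g ρ) (d + d') :=
  fun ε hε => by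
    filter_upwards [hf (ε / 2) (by linarith), hg (ε / 2) (by linarith), hg0,
      eventually_gt_atTop 0] with ρ h1 h2 h3 h4
    rw [show -(d + d') + ε = (-d + ε / 2) + (-d' + ε / 2) by ring, Real.rpow_add h4]
    exact mul_le_mul h1 h2 h3 (Real.rpow_nonneg h4.le _)

lemma ExponentLE.mul {f g : ℝ → ℝ} {d d' : ℝ} (hf : ExponentLE f d) (hg : ExponentLE g d') :
    ExponentLE (fun ρ => f ρ * g ρ) (d + d') :=
  fun ε hε => by
    filter_upwards [hf (ε / 2) (by linarith), hg (ε / 2) (by linarith),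
      eventually_gt_atTop 0] with ρ h1 h2 h4
    rw [show -(d + d') - ε = (-d - ε / 2) + (-d' - ε / 2) by ring, Real.rpow_add h4]
    exact mul_le_mul h1 h2 (Real.rpow_nonneg h4.le _) ((Real.rpow_nonneg h4.le _).trans h1)

lemma eventually_const_le_rpow (C : ℝ) {ε : ℝ} (hε : 0 < ε) : ∀ᶠ ρ : ℝ in atTop, C ≤ ρ ^ ε :=
  (tendsto_rpow_atTop hε).eventually_ge_atTop C

lemma exponentGE_const (C : ℝ) : ExponentGE (fun _ => C) 0 := fun ε hε => by
  rw [neg_zero, zero_add]; exact eventually_const_le_rpow C hε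

lemma exponentLE_const {C : ℝ} (hC : 0 < C) : ExponentLE (fun _ => C) 0 := fun ε hε => by
  filter_upwards [eventually_const_le_rpow C⁻¹ hε, eventually_gt_atTop 0] with ρ h1 h2
  rw [neg_zero, zero_sub, Real.rpow_neg h2.le]
  exact inv_le_of_inv_le₀ hC h1

lemma exponentGE_rpow (a : ℝ) : ExponentGE (fun ρ => ρ ^ a) (-a) := fun ε hε => by
  filter_upwards [eventually_ge_atTop 1] with ρ h
  exact Real.rpow_le_rpow_of_exponent_le h (by linarith)

lemma exponentLE_rpow (a : ℝ) : ExponentLE (fun ρ => ρ ^ a) (-a) := fun ε hε => by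
  filter_upwards [eventually_ge_atTop 1] with ρ h
  exact Real.rpow_le_rpow_of_exponent_le h (by linarith)

lemma ExponentGE.max {f : ℝ → ℝ} {d d' : ℝ} (h : ExponentGE f d) (h' : ExponentGE f d') :
    ExponentGE f (max d d') := by
  rcases max_choice d d' with e | e <;> rw [e] <;> assumption

lemma ExponentLE.min {f g : ℝ → ℝ} {d d' : ℝ} (h : ExponentLE f d) (h' : ExponentLE g d') :
    ExponentLE (fun ρ => min (f ρ) (g ρ)) (max d d') := fun ε hε => by
  filter_upwards [(h.weaken (le_max_left d d')) ε hε,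
    (h'.weaken (le_max_right d d')) ε hε] with ρ h1 h2
  exact le_min h1 h2

lemma ExponentGE.add {f g : ℝ → ℝ} {d : ℝ} (hf : ExponentGE f d) (hg : ExponentGE g d) :
    ExponentGE (fun ρ => f ρ + g ρ) d := by
  intro ε hε
  filter_upwards [hf (ε / 2) (by linarith), hg (ε / 2) (by linarith),
    eventually_const_le_rpow 2 (half_pos hε), eventually_gt_atTop 0] with ρ h1 h2 h3 h4
  rw [show -d + ε = ε / 2 + (-d + ε / 2) by ring, Real.rpow_add h4]
  have := Real.rpow_nonneg h4.le (-d + ε / 2)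
  nlinarith

lemma exponentGE_sum {ι : Type*} (s : Finset ι) {f : ι → ℝ → ℝ} {d : ℝ}
    (h : ∀ i ∈ s, ExponentGE (f i) d) : ExponentGE (fun ρ => ∑ i ∈ s, f i ρ) d := by
  induction s using Finset.cons_induction with
  | empty =>
    intro ε hε
    filter_upwards [eventually_ge_atTop 0] with ρ h
    simpa using Real.rpow_nonneg h _
  | cons i s hi ih =>
    simp only [Finset.sum_cons]
    exact (h i (Finset.mem_cons_self i s)).add
      (ih fun j hj => h j (Finset.mem_cons_of_mem hj))

lemma hasDiversityGain_of_exponents {f : ℝ → ℝ} {d : ℝ} (h1 : ExponentGE f d)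
    (h2 : ExponentLE f d) : HasDiversityGain f d := by
  rw [HasDiversityGain, Metric.tendsto_nhds]
  intro ε hε
  filter_upwards [h1 (ε / 2) (by linarith), h2 (ε / 2) (by linarith), eventually_gt_atTop 1]
    with ρ h1 h2 h3
  have hρ : 0 < ρ := by linarith
  have hlog := Real.log_pos h3
  have hf : 0 < f ρ := (Real.rpow_pos_of_pos hρ _).trans_le h2
  have e1 := Real.log_le_log hf h1
  have e2 := Real.log_le_log (Real.rpow_pos_of_pos hρ _) h2
  rw [Real.log_rpow hρ] at e1 e2
  have e3 : Real.log (f ρ) / Real.log ρ ≤ -d + ε / 2 := (div_le_iff₀ hlog).2 e1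
  have e4 : -d - ε / 2 ≤ Real.log (f ρ) / Real.log ρ := (le_div_iff₀ hlog).2 e2
  rw [Real.dist_eq, abs_lt]
  constructor <;> linarith

lemma exponentGE_exp_mul {L : ℝ → ℝ} {r : ℝ}
    (hL : Tendsto (fun ρ => L ρ / Real.log ρ) atTop (𝓝 r)) (p : ℝ) :
    ExponentGE (fun ρ => Real.exp (p * L ρ)) (-(p * r)) := fun ε hε => by
  have h := (hL.const_mul p).eventually_le_const (show p * r < p * r + ε by linarith)
  filter_upwards [h, eventually_gt_atTop 1] with ρ h1 h2
  have hlog := Real.log_pos h2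
  rw [Real.rpow_def_of_pos (by linarith), Real.exp_le_exp]
  rw [mul_div_assoc', div_le_iff₀ hlog] at h1
  linarith

lemma exponentLE_exp_mul {L : ℝ → ℝ} {r : ℝ}
    (hL : Tendsto (fun ρ => L ρ / Real.log ρ) atTop (𝓝 r)) (p : ℝ) :
    ExponentLE (fun ρ => Real.exp (p * L ρ)) (-(p * r)) := fun ε hε => by
  have h := (hL.const_mul p).eventually_const_le (show p * r - ε < p * r by linarith)
  filter_upwards [h, eventually_gt_atTop 1] with ρ h1 h2
  have hlog := Real.log_pos h2
  rw [Real.rpow_def_of_pos (by linarith), Real.exp_le_exp]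
  rw [mul_div_assoc', le_div_iff₀ hlog] at h1
  linarith

/-- Subtracting one does not change the exponent, since `L` stays away from zero. -/
lemma exponentLE_exp_mul_sub_one_div {L : ℝ → ℝ} {r : ℝ}
    (hL : Tendsto (fun ρ => L ρ / Real.log ρ) atTop (𝓝 r)) {L₀ : ℝ} (hL₀ : 0 < L₀)
    (hL₀L : ∀ᶠ ρ in atTop, L₀ ≤ L ρ) {p C : ℝ} (hp : 0 < p) (hC : 0 < C) :
    ExponentLE (fun ρ => (Real.exp (p * L ρ) - 1) / (C * ρ)) (1 - p * r) := by
  have hκ : 0 < (1 - Real.exp (-(p * L₀))) / C := by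
    have : Real.exp (-(p * L₀)) < 1 := by
      rw [Real.exp_lt_one_iff]; nlinarith
    exact div_pos (by linarith) hC
  have h := ((exponentLE_const hκ).mul (exponentLE_exp_mul hL p)).mul (exponentLE_rpow (-1))
  rw [show 0 + -(p * r) + -(-1) = 1 - p * r by ring] at h
  refine h.mono ?_
  filter_upwards [hL₀L, eventually_gt_atTop 0] with ρ h1 h2
  rw [Real.rpow_neg_one, div_mul_eq_mul_div, div_mul_eq_mul_div, mul_comm C ρ, ← div_div,
    ← div_eq_mul_inv]
  gcongr
  have : Real.exp (-(p * L₀)) * Real.exp (p * L ρ) ≥ 1 := by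
    rw [← Real.exp_add]; exact Real.one_le_exp (by nlinarith)
  nlinarith

lemma exponentLE_ball {x : ℝ → ℝ} {d : ℝ} (hx : ExponentLE x d) :
    ExponentLE (fun ρ => (complexGaussian 1).real {z | ‖z‖ ^ 2 < x ρ}) (max d 0) := by
  have h := (exponentLE_const (Real.exp_pos (-1))).mul (hx.min (exponentLE_const one_pos))
  rw [zero_add] at h
  refine h.mono ?_
  filter_upwards [hx 1 one_pos, eventually_gt_atTop 0] with ρ h1 h2
  have hx0 : 0 ≤ x ρ := (Real.rpow_nonneg h2.le _).trans h1
  have h3 := (le_complexGaussian_one_ball (x := min (x ρ) 1) (le_min hx0 zero_le_one)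
    (min_le_right _ _)).trans (measure_mono (t := {z | ‖z‖ ^ 2 < x ρ})
      fun z (hz : ‖z‖ ^ 2 < _) => hz.trans_le (min_le_left _ _))
  exact (ENNReal.ofReal_le_iff_le_toReal (by finiteness)).1 h3

/-! ### Listening time -/

lemma lt_listenBlocks_of_lt_minWait {rule : StartRule} {M k : ℕ} (hk : k < M)
    (h : k < rule.minWait M) (R c ρ : ℝ) (z : ℂ) : k < listenBlocks rule M R c ρ z := by
  unfold listenBlocks
  split_ifs
  · exact hk
  · exact lt_min hk (lt_of_lt_of_le h (le_max_left _ _))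

lemma logb_one_add_pos {c ρ : ℝ} (hc : 0 < c) (hρ : 0 < ρ) {z : ℂ} (hz : z ≠ 0) :
    0 < Real.logb 2 (1 + ‖z‖ ^ 2 * c * ρ) := by
  have : 0 < ‖z‖ ^ 2 * c * ρ := by have := norm_pos_iff.2 hz; positivity
  exact Real.logb_pos one_lt_two (by linarith)

lemma listenBlocks_pos (rule : StartRule) {M : ℕ} (hM : 0 < M) {R c ρ : ℝ} (hR : 0 < R)
    (hc : 0 < c) (hρ : 0 < ρ) (z : ℂ) : 0 < listenBlocks rule M R c ρ z := by
  unfold listenBlocks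
  split_ifs with hz
  · exact hM
  · have h1 := logb_one_add_pos hc hρ hz
    have hM' : (0 : ℝ) < M := by exact_mod_cast hM
    exact lt_min hM (lt_of_lt_of_le (Nat.ceil_pos.2 (by positivity)) (le_max_right _ _))

/-- The relay listens to more than `k` sub-blocks only if its channel does not support the rate
within `k` sub-blocks. -/
lemma norm_sq_lt_of_lt_listenBlocks {rule : StartRule} {M k : ℕ} (hk : 0 < k)
    (hkw : rule.minWait M ≤ k) {R c ρ : ℝ} (hc : 0 < c) (hρ : 0 < ρ) {z : ℂ}
    (h : k < listenBlocks rule M R c ρ z) :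
    ‖z‖ ^ 2 < Real.exp (M / k * (R * Real.log 2)) / (c * ρ) := by
  by_cases hz : z = 0
  · rw [hz]; rw [norm_zero, zero_pow two_ne_zero]; positivity
  have h1 := logb_one_add_pos hc hρ hz
  rw [listenBlocks, if_neg hz, lt_min_iff, lt_max_iff] at h
  have h2 := h.2.resolve_left (not_lt.2 hkw)
  have hk' : (0 : ℝ) < k := by exact_mod_cast hk
  rw [Nat.lt_ceil, lt_div_iff₀ h1, Real.logb, mul_div_assoc', div_lt_iff₀ (Real.log_pos one_lt_two)]
    at h2
  have h3 : 0 < 1 + ‖z‖ ^ 2 * c * ρ := by positivity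
  have h4 : Real.log (1 + ‖z‖ ^ 2 * c * ρ) < M / k * (R * Real.log 2) := by
    rw [div_mul_eq_mul_div, lt_div_iff₀ hk']; linarith
  have h5 := (Real.log_lt_iff_lt_exp h3).1 h4
  rw [lt_div_iff₀ (by positivity)]
  nlinarith

lemma lt_listenBlocks_of_norm_sq_lt {rule : StartRule} {M k : ℕ} (hk : 0 < k)
    (hkM : k < M) {R c ρ : ℝ} (hc : 0 < c) (hρ : 0 < ρ) {z : ℂ}
    (h : ‖z‖ ^ 2 < (Real.exp (M / k * (R * Real.log 2)) - 1) / (c * ρ)) :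
    k < listenBlocks rule M R c ρ z := by
  by_cases hz : z = 0
  · simpa [listenBlocks, hz] using hkM
  have h1 := logb_one_add_pos hc hρ hz
  have hk' : (0 : ℝ) < k := by exact_mod_cast hk
  have h3 : 0 < 1 + ‖z‖ ^ 2 * c * ρ := by positivity
  rw [lt_div_iff₀ (by positivity)] at h
  have h4 : Real.log (1 + ‖z‖ ^ 2 * c * ρ) < M / k * (R * Real.log 2) :=
    (Real.log_lt_iff_lt_exp h3).2 (by nlinarith)
  rw [listenBlocks, if_neg hz, lt_min_iff, lt_max_iff]
  refine ⟨hkM, Or.inr ?_⟩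
  rw [Nat.lt_ceil, lt_div_iff₀ h1, Real.logb, mul_div_assoc', div_lt_iff₀ (Real.log_pos one_lt_two)]
  rw [div_mul_eq_mul_div, lt_div_iff₀ hk'] at h4
  linarith

/-- The exponent of the probability that the relay listens to more than `k` out of `M`
sub-blocks. It is zero where the relay has to do so in any case. -/
def listenExponent (rule : StartRule) (r : ℝ) (M k : ℕ) : ℝ :=
  if k = 0 ∨ k < rule.minWait M then 0 else max (1 - M / k * r) 0

section Listen

variable {R : ℝ → ℝ} {r R₀ c : ℝ}

lemma tendsto_log_rate (hR : HasMultiplexingGain R r) :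
    Tendsto (fun ρ => R ρ * Real.log 2 / Real.log ρ) atTop (𝓝 r) := by
  refine hR.congr fun ρ => ?_
  rw [Real.logb, div_div_eq_mul_div]

lemma exponentGE_listen (rule : StartRule) (hR : HasMultiplexingGain R r)
    (hc : 0 < c) (M k : ℕ) :
    ExponentGE (fun ρ => (complexGaussian 1).real {z | k < listenBlocks rule M (R ρ) c ρ z})
      (listenExponent rule r M k) := by
  have h1 : ExponentGE
      (fun ρ => (complexGaussian 1).real {z | k < listenBlocks rule M (R ρ) c ρ z}) 0 :=
    (exponentGE_const 1).mono (Eventually.of_forall fun ρ => measureReal_le_one)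
  unfold listenExponent
  split_ifs with h
  · exact h1
  rw [not_or, not_lt] at h
  refine ExponentGE.max ?_ h1
  have h2 := ((exponentGE_const c⁻¹).mul (exponentGE_exp_mul (tendsto_log_rate hR) (M / k))
    (Eventually.of_forall fun _ => (Real.exp_pos _).le)).mul (exponentGE_rpow (-1))
    (by filter_upwards [eventually_gt_atTop 0] with ρ h using Real.rpow_nonneg h.le _)
  rw [show 0 + -(M / k * r) + -(-1) = 1 - M / k * r by ring] at h2
  refine h2.mono ?_
  filter_upwards [eventually_gt_atTop 0] with ρ h4
  have h5 : (complexGaussian 1) {z | k < listenBlocks rule M (R ρ) c ρ z} ≤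
      ENNReal.ofReal (Real.exp (M / k * (R ρ * Real.log 2)) / (c * ρ)) :=
    (measure_mono fun z hz => norm_sq_lt_of_lt_listenBlocks (Nat.pos_of_ne_zero h.1) h.2
      hc h4 hz).trans (complexGaussian_one_ball_le (by positivity))
  refine (ENNReal.toReal_le_of_le_ofReal (by positivity) h5).trans (le_of_eq ?_)
  rw [Real.rpow_neg_one]
  field_simp

lemma exponentLE_listen (rule : StartRule) (hR : HasMultiplexingGain R r)
    (hR₀ : 0 < R₀) (hRR : ∀ᶠ ρ in atTop, R₀ ≤ R ρ) (hc : 0 < c) {M k : ℕ} (hM : 0 < M)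
    (hk : k < M) :
    ExponentLE (fun ρ => (complexGaussian 1).real {z | k < listenBlocks rule M (R ρ) c ρ z})
      (listenExponent rule r M k) := by
  unfold listenExponent
  split_ifs with h
  · refine (exponentLE_const one_pos).mono ?_
    filter_upwards [hRR, eventually_gt_atTop 0] with ρ h3 h4
    have : {z | k < listenBlocks rule M (R ρ) c ρ z} = Set.univ := by
      refine Set.eq_univ_of_forall fun z => ?_
      rcases h with h | h
      · rw [h]; exact listenBlocks_pos rule hM (hR₀.trans_le h3) hc h4 z
      · exact lt_listenBlocks_of_lt_minWait hk h _ _ _ _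
    rw [this]; simp
  rw [not_or, not_lt] at h
  have hk0 := Nat.pos_of_ne_zero h.1
  have hMk : (0 : ℝ) < M / k := div_pos (by exact_mod_cast hM) (by exact_mod_cast hk0)
  have hL₀ : 0 < R₀ * Real.log 2 := mul_pos hR₀ (Real.log_pos one_lt_two)
  refine (exponentLE_ball (exponentLE_exp_mul_sub_one_div (tendsto_log_rate hR) hL₀
    (by filter_upwards [hRR] with ρ h
        exact mul_le_mul_of_nonneg_right h (Real.log_nonneg one_le_two)) hMk hc)).mono ?_
  filter_upwards [hRR, eventually_gt_atTop 0] with ρ h3 h4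
  exact measureReal_mono fun z hz =>
    lt_listenBlocks_of_norm_sq_lt hk0 hk hc h4 hz

end Listen

/-! ### Outage of the destination's channel -/

lemma log_one_add_norm_sq_nonneg {ρ : ℝ} (hρ : 0 ≤ ρ) (g : ℂ) : 0 ≤ Real.log (1 + ‖g‖ ^ 2 * ρ) :=
  Real.log_nonneg (by have : 0 ≤ ‖g‖ ^ 2 * ρ := by positivity
                      linarith)

lemma log_le_log_alamouti {ρ : ℝ} (hρ : 0 ≤ ρ) (g₁ g₂ : ℂ) :
    Real.log (1 + ‖g₁‖ ^ 2 * ρ) ≤ Real.log (1 + (‖g₁‖ ^ 2 + ‖g₂‖ ^ 2) * ρ) := by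
  have h1 : 0 ≤ ‖g₁‖ ^ 2 * ρ := by positivity
  have h2 : 0 ≤ ‖g₂‖ ^ 2 * ρ := by positivity
  exact Real.log_le_log (by linarith) (by linarith)

lemma log_le_log_alamouti' {ρ : ℝ} (hρ : 0 ≤ ρ) (g₁ g₂ : ℂ) :
    Real.log (1 + ‖g₂‖ ^ 2 * ρ) ≤ Real.log (1 + (‖g₁‖ ^ 2 + ‖g₂‖ ^ 2) * ρ) := by
  rw [add_comm (‖g₁‖ ^ 2)]; exact log_le_log_alamouti hρ g₂ g₁

/-- Listening longer costs mutual information. -/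
lemma mutualInfo_anti {ρ l l' : ℝ} (hρ : 0 ≤ ρ) (hl : l ≤ l') (g₁ g₂ : ℂ) :
    mutualInfo ρ l' g₁ g₁ g₂ ≤ mutualInfo ρ l g₁ g₁ g₂ := by
  have := log_le_log_alamouti hρ g₁ g₂
  unfold mutualInfo
  nlinarith

/-- The destination does at least as well as with two parallel links, used in proportion `μ` to
`1 - μ`. -/
lemma le_mutualInfo {ρ l μ : ℝ} (hρ : 0 ≤ ρ) (hl : l ≤ μ) (hμ : μ ≤ 1) (g₁ g₂ : ℂ) :
    μ * Real.log (1 + ‖g₁‖ ^ 2 * ρ) + (1 - μ) * Real.log (1 + ‖g₂‖ ^ 2 * ρ) ≤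
      mutualInfo ρ l g₁ g₁ g₂ := by
  refine le_trans ?_ (mutualInfo_anti hρ hl g₁ g₂)
  have := log_le_log_alamouti' hρ g₁ g₂
  unfold mutualInfo
  have : 0 ≤ 1 - μ := by linarith
  gcongr

/-- Negative moments of a single link. -/
lemma exists_lintegral_rpow_le {b : ℝ} (hb0 : 0 ≤ b) (hb1 : b < 1) :
    ∃ K : ℝ, 0 ≤ K ∧ ∀ ρ : ℝ, 0 < ρ →
      ∫⁻ z, ENNReal.ofReal ((1 + ‖z‖ ^ 2 * ρ) ^ (-b)) ∂complexGaussian 1 ≤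
        ENNReal.ofReal (K * ρ ^ (-b)) := by
  have hfin := lintegral_norm_rpow_complexGaussian_one_lt_top hb1
  refine ⟨_, ENNReal.toReal_nonneg (a := ∫⁻ z, ENNReal.ofReal (‖z‖ ^ (-2 * b)) ∂complexGaussian 1),
    fun ρ hρ => ?_⟩
  rw [ENNReal.ofReal_mul ENNReal.toReal_nonneg, ENNReal.ofReal_toReal hfin.ne,
    ← lintegral_mul_const _ (by fun_prop)]
  refine lintegral_mono_ae ?_
  have hne : ∀ᵐ z ∂complexGaussian 1, z ≠ 0 := by
    have : ∀ᵐ z ∂(volume : Measure ℂ), z ≠ 0 := by simp [ae_iff]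
    exact (complexGaussian_absolutelyContinuous one_pos).ae_le this
  filter_upwards [hne] with z hz
  have hz' := norm_pos_iff.2 hz
  rw [← ENNReal.ofReal_mul (by positivity)]
  refine ENNReal.ofReal_le_ofReal ?_
  calc (1 + ‖z‖ ^ 2 * ρ) ^ (-b) ≤ (‖z‖ ^ 2 * ρ) ^ (-b) :=
        Real.rpow_le_rpow_of_nonpos (by positivity) (by linarith) (by linarith)
    _ = ‖z‖ ^ (-2 * b) * ρ ^ (-b) := by
        rw [Real.mul_rpow (by positivity) hρ.le, ← Real.rpow_natCast, ← Real.rpow_mul hz'.le]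
        congr 2
        push_cast; ring

/-- Markov bound for the outage probability of the destination's channel. -/
lemma exists_measure_mutualInfo_le {l μ p b₁ b₂ : ℝ} (hlμ : l ≤ μ) (hμ1 : μ ≤ 1)
    (hp : 0 ≤ p) (hb₁ : 0 ≤ b₁) (hb₁' : b₁ < 1) (hb₁p : b₁ ≤ p * μ) (hb₂ : 0 ≤ b₂)
    (hb₂' : b₂ < 1) (hb₂p : b₂ ≤ p * (1 - μ)) :
    ∃ K : ℝ, 0 ≤ K ∧ ∀ ρ L : ℝ, 0 < ρ →
      ((complexGaussian 1).prod (complexGaussian 1)).real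
        {g | mutualInfo ρ l g.1 g.1 g.2 ≤ L} ≤ K * Real.exp (p * L) * ρ ^ (-(b₁ + b₂)) := by
  obtain ⟨K₁, hK₁, h1⟩ := exists_lintegral_rpow_le hb₁ hb₁'
  obtain ⟨K₂, hK₂, h2⟩ := exists_lintegral_rpow_le hb₂ hb₂'
  refine ⟨K₁ * K₂, by positivity, fun ρ L hρ => ?_⟩
  refine ENNReal.toReal_le_of_le_ofReal (by positivity) ?_
  have hmeas : MeasurableSet {g : ℂ × ℂ | mutualInfo ρ l g.1 g.1 g.2 ≤ L} := by
    refine measurableSet_le ?_ measurable_const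
    unfold mutualInfo
    fun_prop
  rw [← lintegral_indicator_one hmeas]
  calc _ ≤ ∫⁻ g, ENNReal.ofReal (Real.exp (p * L)) *
        (ENNReal.ofReal ((1 + ‖g.1‖ ^ 2 * ρ) ^ (-b₁)) *
          ENNReal.ofReal ((1 + ‖g.2‖ ^ 2 * ρ) ^ (-b₂)))
          ∂(complexGaussian 1).prod (complexGaussian 1) := by
        refine lintegral_mono fun g => ?_
        by_cases hg : g ∈ {g : ℂ × ℂ | mutualInfo ρ l g.1 g.1 g.2 ≤ L}
        swap
        · rw [Set.indicator_of_notMem hg]; exact zero_le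
        rw [Set.indicator_of_mem hg, Pi.one_apply]
        have hg : mutualInfo ρ l g.1 g.1 g.2 ≤ L := hg
        have hpos : ∀ z : ℂ, 0 < 1 + ‖z‖ ^ 2 * ρ := fun z => by positivity
        rw [← ENNReal.ofReal_mul (Real.rpow_nonneg (hpos _).le _),
          ← ENNReal.ofReal_mul (Real.exp_pos _).le, ENNReal.one_le_ofReal,
          Real.rpow_def_of_pos (hpos _), Real.rpow_def_of_pos (hpos _), ← Real.exp_add,
          ← Real.exp_add]
        refine Real.one_le_exp ?_
        have e1 := le_mutualInfo hρ.le hlμ hμ1 g.1 g.2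
        have n1 := log_one_add_norm_sq_nonneg hρ.le g.1
        have n2 := log_one_add_norm_sq_nonneg hρ.le g.2
        have e2 := mul_le_mul_of_nonneg_left (e1.trans hg) hp
        have e3 := mul_le_mul_of_nonneg_right hb₁p n1
        have e4 := mul_le_mul_of_nonneg_right hb₂p n2
        nlinarith
    _ = ENNReal.ofReal (Real.exp (p * L)) *
        ((∫⁻ z, ENNReal.ofReal ((1 + ‖z‖ ^ 2 * ρ) ^ (-b₁)) ∂complexGaussian 1) *
          ∫⁻ z, ENNReal.ofReal ((1 + ‖z‖ ^ 2 * ρ) ^ (-b₂)) ∂complexGaussian 1) := by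
        rw [lintegral_const_mul _ (by fun_prop), lintegral_prod_mul
          (f := fun z : ℂ => ENNReal.ofReal ((1 + ‖z‖ ^ 2 * ρ) ^ (-b₁)))
          (g := fun z : ℂ => ENNReal.ofReal ((1 + ‖z‖ ^ 2 * ρ) ^ (-b₂)))
          (by fun_prop) (by fun_prop)]
    _ ≤ ENNReal.ofReal (Real.exp (p * L)) *
        (ENNReal.ofReal (K₁ * ρ ^ (-b₁)) * ENNReal.ofReal (K₂ * ρ ^ (-b₂))) := by
        gcongr
        · exact h1 ρ hρ
        · exact h2 ρ hρ
    _ = _ := by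
        rw [← ENNReal.ofReal_mul (by positivity), ← ENNReal.ofReal_mul (by positivity), neg_add,
          Real.rpow_add hρ]
        congr 1; ring

section Outage

variable {L : ℝ → ℝ} {r : ℝ}

/-- The Markov bound for all moment orders `b₁, b₂ < 1`, optimised up to an arbitrarily small loss
`t` that keeps the orders strictly below one. -/
lemma exponentGE_mutualInfo_of_markov (hL : Tendsto (fun ρ => L ρ / Real.log ρ) atTop (𝓝 r))
    {l μ p : ℝ} (hlμ : l ≤ μ) (hμ0 : 0 ≤ μ) (hμ1 : μ ≤ 1) (hp : 0 ≤ p) :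
    ExponentGE (fun ρ => ((complexGaussian 1).prod (complexGaussian 1)).real
      {g | mutualInfo ρ l g.1 g.1 g.2 ≤ L ρ}) (min 1 (p * μ) + min 1 (p * (1 - μ)) - p * r) := by
  set a₁ := min 1 (p * μ) with ha₁
  set a₂ := min 1 (p * (1 - μ)) with ha₂
  have ha₁0 : 0 ≤ a₁ := le_min zero_le_one (mul_nonneg hp hμ0)
  have ha₂0 : 0 ≤ a₂ := le_min zero_le_one (mul_nonneg hp (by linarith))
  refine exponentGE_of_forall_lt fun d' hd' => ?_
  set t : ℝ := min 1 ((a₁ + a₂ - p * r - d') / 2) with ht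
  have ht0 : 0 < t := lt_min one_pos (by linarith)
  have ht1 : t ≤ 1 := min_le_left _ _
  have ht2 : t ≤ (a₁ + a₂ - p * r - d') / 2 := min_le_right _ _
  have hle : ∀ a : ℝ, 0 ≤ a → (1 - t) * a ≤ a := fun a ha => by nlinarith
  have hlt : ∀ a : ℝ, 0 ≤ a → a ≤ 1 → (1 - t) * a < 1 := fun a ha ha1 => by nlinarith
  have ha₁1 : a₁ ≤ 1 := min_le_left _ _
  have ha₂1 : a₂ ≤ 1 := min_le_left _ _
  obtain ⟨K, hK, h⟩ := exists_measure_mutualInfo_le (l := l) (μ := μ) (p := p)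
    (b₁ := (1 - t) * a₁) (b₂ := (1 - t) * a₂) hlμ hμ1 hp
    (mul_nonneg (by linarith) ha₁0) (hlt _ ha₁0 ha₁1)
    ((hle _ ha₁0).trans (min_le_right _ _)) (mul_nonneg (by linarith) ha₂0)
    (hlt _ ha₂0 ha₂1) ((hle _ ha₂0).trans (min_le_right _ _))
  have h2 := ((exponentGE_const K).mul (exponentGE_exp_mul hL p)
    (Eventually.of_forall fun _ => (Real.exp_pos _).le)).mul
    (exponentGE_rpow (-((1 - t) * a₁ + (1 - t) * a₂)))
    (by filter_upwards [eventually_gt_atTop 0] with ρ h using Real.rpow_nonneg h.le _)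
  refine (h2.mono ?_).weaken (d' := d') ?_
  · filter_upwards [eventually_gt_atTop 0] with ρ hρ using h ρ (L ρ) hρ
  · nlinarith

/-- The exponent of the outage probability of the destination's channel when the relay listens
during a fraction `l` of the codeword: the minimum of `u + v` over the gains `|g₁|² = ρ ^ (-u)`,
`|g₂|² = ρ ^ (-v)` for which the channel does not support multiplexing gain `r`. -/
def outageExponent (r l : ℝ) : ℝ :=
  if l ≤ 1 / 2 then 2 * (1 - r) else if 1 - r ≤ l then (1 - r) / l else 2 - r / (1 - l)

lemma exponentGE_mutualInfo (hL : Tendsto (fun ρ => L ρ / Real.log ρ) atTop (𝓝 r)) (hr : 0 ≤ r)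
    {l : ℝ} (hl : l ≤ 1) :
    ExponentGE (fun ρ => ((complexGaussian 1).prod (complexGaussian 1)).real
      {g | mutualInfo ρ l g.1 g.1 g.2 ≤ L ρ}) (outageExponent r l) := by
  unfold outageExponent
  -- The optimal `p` makes `p * μ` or `p * (1 - μ)` equal to one, where the moments of the
  -- power gains cease to exist. For `l ≤ 1 / 2`, `μ = 1 / 2` does this for both links at once.
  split_ifs with h1 h2
  · have := exponentGE_mutualInfo_of_markov hL (p := 2) h1 (by norm_num) (by norm_num) (by norm_num)
    norm_num at this
    exact this.weaken (by linarith)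
  · rw [not_le] at h1
    have hl0 : 0 < l := by linarith
    have := exponentGE_mutualInfo_of_markov hL (p := 1 / l) le_rfl hl0.le hl (by positivity)
    rw [one_div_mul_cancel hl0.ne', min_self,
      min_eq_right (by rw [one_div_mul_eq_div, div_le_one hl0]; linarith)] at this
    refine this.weaken (le_of_eq ?_)
    field_simp; ring
  · rw [not_le] at h1 h2
    have hl1 : 0 < 1 - l := by linarith
    have := exponentGE_mutualInfo_of_markov hL (p := 1 / (1 - l)) le_rfl (by linarith) hl
      (by positivity)
    rw [one_div_mul_cancel hl1.ne', min_self,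
      min_eq_left (by rw [one_div_mul_eq_div, le_div_iff₀ hl1]; linarith)] at this
    refine this.weaken (le_of_eq ?_)
    field_simp; ring

lemma eventually_log_one_add_le {C a a' : ℝ} (hC : 0 ≤ C) (ha : max a 0 < a') :
    ∀ᶠ ρ : ℝ in atTop, Real.log (1 + C * ρ ^ a) ≤ a' * Real.log ρ := by
  filter_upwards [eventually_const_le_rpow (1 + C) (sub_pos.2 ha), eventually_ge_atTop 1]
    with ρ h1 h2
  have hρ : 0 < ρ := by linarith
  have hpos : 0 ≤ C * ρ ^ a := by positivity
  rw [← Real.log_rpow hρ]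
  refine Real.log_le_log (by linarith) ?_
  have e1 : ρ ^ a ≤ ρ ^ max a 0 := Real.rpow_le_rpow_of_exponent_le h2 (le_max_left _ _)
  have e2 : 1 ≤ ρ ^ max a 0 := Real.one_le_rpow h2 (le_max_right _ _)
  calc 1 + C * ρ ^ a ≤ (1 + C) * ρ ^ max a 0 := by nlinarith
    _ ≤ ρ ^ (a' - max a 0) * ρ ^ max a 0 := by gcongr
    _ = ρ ^ a' := by rw [← Real.rpow_add hρ]; congr 1; ring

lemma prod_ball_le (x y : ℝ) {S : Set (ℂ × ℂ)}
    (hS : ∀ g₁ g₂ : ℂ, ‖g₁‖ ^ 2 < x → ‖g₂‖ ^ 2 < y → (g₁, g₂) ∈ S) :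
    (complexGaussian 1).real {z | ‖z‖ ^ 2 < x} * (complexGaussian 1).real {z | ‖z‖ ^ 2 < y} ≤
      ((complexGaussian 1).prod (complexGaussian 1)).real S := by
  rw [← measureReal_prod_prod]
  exact measureReal_mono fun g hg => hS g.1 g.2 hg.1 hg.2

/-- Outage at gains of orders `ρ ^ (-u)` and `ρ ^ (-v)`. -/
lemma exponentLE_mutualInfo_of_mem (hL : Tendsto (fun ρ => L ρ / Real.log ρ) atTop (𝓝 r))
    (hr : 0 < r) {l u v : ℝ} (hl0 : 0 < l) (hl1 : l ≤ 1) (hv : 0 ≤ v) (hvu : v ≤ u) (hu : u ≤ 1)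
    (huv : 1 - r ≤ l * u + (1 - l) * v) :
    ExponentLE (fun ρ => ((complexGaussian 1).prod (complexGaussian 1)).real
      {g | mutualInfo ρ l g.1 g.1 g.2 < L ρ}) (u + v) := by
  intro ε hε
  -- Gains smaller by a factor `ρ ^ (-e)` turn the weak inequality `huv` into strict outage.
  set e : ℝ := ε / 4 with he
  have he0 : 0 < e := by positivity
  set x₁ := max (1 - u - e) 0 with hx₁
  set x₂ := max (1 - v - e) 0 with hx₂
  have hlt : l * x₁ + (1 - l) * x₂ < r := by
    have i1 : x₁ ≤ 1 - u := max_le (by linarith) (by linarith)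
    have i2 : x₂ ≤ 1 - v := max_le (by linarith) (by linarith)
    have hl1' : 0 ≤ 1 - l := by linarith
    have i2' := mul_le_mul_of_nonneg_left i2 hl1'
    rcases hu.lt_or_eq with hu' | hu'
    · have : x₁ < 1 - u := max_lt (by linarith) (by linarith)
      nlinarith
    · have h0 : x₁ = 0 := max_eq_right (by linarith)
      rcases hl1'.eq_or_lt with hl' | hl'
      · rw [h0, ← hl']; linarith
      · rcases (hvu.trans hu).lt_or_eq with hv' | hv'
        · have : x₂ < 1 - v := max_lt (by linarith) (by linarith)
          nlinarith
        · have h0' : x₂ = 0 := max_eq_right (by linarith)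
          rw [h0, h0']; linarith
  set θ := (r - (l * x₁ + (1 - l) * x₂)) / 2 with hθ
  have hθ0 : 0 < θ := by rw [hθ]; linarith
  have h1 := eventually_log_one_add_le (C := 1) (a := 1 - u - e) (a' := x₁ + θ) zero_le_one
    (by rw [← hx₁]; linarith)
  have h2 := eventually_log_one_add_le (C := 2) (a := 1 - v - e) (a' := x₂ + θ) zero_le_two
    (by rw [← hx₂]; linarith)
  have h3 := hL.eventually_const_lt (show r - θ < r by linarith)
  have hb₁ := exponentLE_ball (exponentLE_rpow (-(u + e)))
  have hb₂ := exponentLE_ball (exponentLE_rpow (-(v + e)))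
  rw [neg_neg, max_eq_left (by linarith)] at hb₁ hb₂
  filter_upwards [h1, h2, h3, (hb₁.mul hb₂) (ε / 2) (by positivity), eventually_gt_atTop 1]
    with ρ h1 h2 h3 h4 h5
  have hρ : 0 < ρ := by linarith
  have hlog := Real.log_pos h5
  rw [show -(u + v) - ε = -(u + e + (v + e)) - ε / 2 by rw [he]; ring]
  refine h4.trans (prod_ball_le _ _ fun g₁ g₂ hg₁ hg₂ => ?_)
  have hg₁' : ‖g₁‖ ^ 2 * ρ ≤ 1 * ρ ^ (1 - u - e) := by
    rw [one_mul, show 1 - u - e = -(u + e) + 1 by ring, Real.rpow_add hρ, Real.rpow_one]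
    gcongr
  have hg₂' : ‖g₂‖ ^ 2 * ρ ≤ ρ ^ (1 - v - e) := by
    rw [show 1 - v - e = -(v + e) + 1 by ring, Real.rpow_add hρ, Real.rpow_one]
    gcongr
  have huv' : ρ ^ (1 - u - e) ≤ ρ ^ (1 - v - e) :=
    Real.rpow_le_rpow_of_exponent_le h5.le (by linarith)
  have k1 : Real.log (1 + ‖g₁‖ ^ 2 * ρ) ≤ (x₁ + θ) * Real.log ρ :=
    (Real.log_le_log (by positivity) (by linarith)).trans h1
  have k2 : Real.log (1 + (‖g₁‖ ^ 2 + ‖g₂‖ ^ 2) * ρ) ≤ (x₂ + θ) * Real.log ρ :=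
    (Real.log_le_log (by positivity) (by linarith)).trans h2
  rw [lt_div_iff₀ hlog] at h3
  change mutualInfo ρ l g₁ g₁ g₂ < L ρ
  unfold mutualInfo
  have k3 := mul_le_mul_of_nonneg_left k1 hl0.le
  have k4 := mul_le_mul_of_nonneg_left k2 (show 0 ≤ 1 - l by linarith)
  have k5 : l * ((x₁ + θ) * Real.log ρ) + (1 - l) * ((x₂ + θ) * Real.log ρ) =
      (r - θ) * Real.log ρ := by rw [hθ]; ring
  linarith

lemma exponentLE_mutualInfo (hL : Tendsto (fun ρ => L ρ / Real.log ρ) atTop (𝓝 r)) (hr : 0 ≤ r)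
    (hr1 : r ≤ 1) {L₀ : ℝ} (hL₀ : 0 < L₀) (hLL : ∀ᶠ ρ in atTop, L₀ ≤ L ρ) {l : ℝ} (hl0 : 0 < l)
    (hl : l ≤ 1) :
    ExponentLE (fun ρ => ((complexGaussian 1).prod (complexGaussian 1)).real
      {g | mutualInfo ρ l g.1 g.1 g.2 < L ρ}) (outageExponent r l) := by
  -- Both links equally weak.
  have hdiag : ExponentLE (fun ρ => ((complexGaussian 1).prod (complexGaussian 1)).real
      {g | mutualInfo ρ l g.1 g.1 g.2 < L ρ}) (2 * (1 - r)) := by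
    have h := exponentLE_ball
      (exponentLE_exp_mul_sub_one_div hL hL₀ hLL one_pos (two_pos (α := ℝ)))
    rw [one_mul, max_eq_left (by linarith)] at h
    have h2 := h.mul h
    rw [← two_mul] at h2
    refine h2.mono ?_
    filter_upwards [eventually_gt_atTop 0] with ρ hρ
    refine prod_ball_le _ _ fun g₁ g₂ hg₁ hg₂ => ?_
    rw [one_mul, lt_div_iff₀ (by positivity)] at hg₁ hg₂
    have k1 := log_le_log_alamouti hρ.le g₁ g₂
    have k2 : Real.log (1 + (‖g₁‖ ^ 2 + ‖g₂‖ ^ 2) * ρ) < L ρ :=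
      (Real.log_lt_iff_lt_exp (by positivity)).2 (by linarith)
    change mutualInfo ρ l g₁ g₁ g₂ < L ρ
    unfold mutualInfo
    nlinarith
  unfold outageExponent
  split_ifs with h1 h2
  · exact hdiag
  · rw [not_le] at h1
    rcases hr.eq_or_lt with rfl | hr0
    -- At `r = 0` the direct link alone matters. Its exact outage ball is used, since gains of order
    -- `ρ ^ (-1)` meet the rate condition with equality only.
    · have hl1 : l = 1 := by linarith
      have h := exponentLE_ball (exponentLE_exp_mul_sub_one_div hL hL₀ hLL one_pos one_pos)
      rw [mul_zero, max_eq_left (by norm_num), sub_zero] at h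
      rw [hl1, sub_zero, div_one]
      refine h.mono ?_
      filter_upwards [eventually_gt_atTop 0] with ρ hρ
      have hprod := measureReal_prod_prod (μ := complexGaussian 1) (ν := complexGaussian 1)
        {z | ‖z‖ ^ 2 < (Real.exp (1 * L ρ) - 1) / (1 * ρ)} Set.univ
      rw [probReal_univ, mul_one] at hprod
      rw [← hprod]
      refine measureReal_mono fun g hg => ?_
      have hg : ‖g.1‖ ^ 2 < _ := hg.1
      rw [one_mul, one_mul, lt_div_iff₀ hρ] at hg
      have k2 : Real.log (1 + ‖g.1‖ ^ 2 * ρ) < L ρ :=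
        (Real.log_lt_iff_lt_exp (by positivity)).2 (by linarith)
      simpa [mutualInfo] using k2
    -- Only the direct link is weak.
    · have := exponentLE_mutualInfo_of_mem hL hr0 (u := (1 - r) / l) (v := 0) hl0 hl le_rfl
        (div_nonneg (by linarith) hl0.le) ((div_le_one hl0).2 h2)
        (le_of_eq (by field_simp; ring))
      rwa [add_zero] at this
  · rw [not_le] at h1 h2
    have hl1 : 0 < 1 - l := by linarith
    rcases hr.eq_or_lt with rfl | hr0
    · simpa using hdiag
    -- The direct link carries no information, and the relay's link is weak as well.
    · have := exponentLE_mutualInfo_of_mem hL hr0 (u := 1) (v := 1 - r / (1 - l)) hl0 hl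
        (by rw [sub_nonneg, div_le_one hl1]; linarith)
        (by have : 0 ≤ r / (1 - l) := by positivity
            linarith) le_rfl
        (le_of_eq (by field_simp; ring))
      exact this.weaken (by linarith)

end Outage

/-! ### The diversity gain and its limit -/

/-- The diversity gain with `M` sub-blocks: the least cost of an outage, where the relay listens to
at least `k + 1` sub-blocks at cost `listenExponent rule r M k`. -/
def diversity (rule : StartRule) (r : ℝ) (M : ℕ) : ℝ :=
  ⨅ k : Fin M, (listenExponent rule r M k + outageExponent r (((k : ℕ) + 1 : ℝ) / M))

lemma diversity_le (rule : StartRule) (r : ℝ) {M k : ℕ} (hk : k < M) :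
    diversity rule r M ≤ listenExponent rule r M k + outageExponent r ((k + 1 : ℝ) / M) :=
  ciInf_le (Set.finite_range _).bddBelow (⟨k, hk⟩ : Fin M)

lemma exists_diversity_eq (rule : StartRule) (r : ℝ) {M : ℕ} (hM : 0 < M) :
    ∃ k < M, diversity rule r M =
      listenExponent rule r M k + outageExponent r ((k + 1 : ℝ) / M) := by
  have : Nonempty (Fin M) := ⟨⟨0, hM⟩⟩
  obtain ⟨k, hk⟩ := exists_eq_ciInf_of_finite
    (f := fun k : Fin M => listenExponent rule r M k + outageExponent r (((k : ℕ) + 1 : ℝ) / M))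
  exact ⟨k, k.2, hk.symm⟩

section Outage

variable {R : ℝ → ℝ} {r R₀ c : ℝ}

/-- Union bound over the number `k + 1` of sub-blocks that the relay listens to. -/
lemma exponentGE_destInfo (rule : StartRule) (hr : 0 ≤ r) (hR : HasMultiplexingGain R r)
    (hR₀ : 0 < R₀) (hRR : ∀ᶠ ρ in atTop, R₀ ≤ R ρ) (hc : 0 < c) {M : ℕ} (hM : 0 < M) :
    ExponentGE (fun ρ => gainLaw.real
      {γ | destInfo rule M (R ρ) c ρ γ ≤ R ρ * Real.log 2}) (diversity rule r M) := by
  have hM' : (0 : ℝ) < M := by exact_mod_cast hM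
  have h := exponentGE_sum (Finset.range M) (d := diversity rule r M)
    (f := fun k ρ => (complexGaussian 1).real {z | k < listenBlocks rule M (R ρ) c ρ z} *
      ((complexGaussian 1).prod (complexGaussian 1)).real
        {g | mutualInfo ρ ((k + 1 : ℝ) / M) g.1 g.1 g.2 ≤ R ρ * Real.log 2}) fun k hk => by
    have hk : k + 1 ≤ M := Finset.mem_range.1 hk
    have hk' : (k + 1 : ℝ) ≤ M := by exact_mod_cast hk
    exact ((exponentGE_listen rule hR hc M k).mul
      (exponentGE_mutualInfo (tendsto_log_rate hR) hr ((div_le_one hM').2 hk'))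
      (Eventually.of_forall fun _ => measureReal_nonneg)).weaken (diversity_le rule r hk)
  refine h.mono ?_
  filter_upwards [hRR, eventually_gt_atTop 0] with ρ h1 hρ
  simp_rw [← measureReal_prod_prod]
  refine le_trans (measureReal_mono (fun γ hγ => ?_) (measure_ne_top _ _))
    (measureReal_biUnion_finset_le _ _)
  have h2 := listenBlocks_pos rule hM (hR₀.trans_le h1) hc hρ γ.1
  have h3 := listenBlocks_le rule M (R ρ) c ρ γ.1
  refine Set.mem_biUnion (x := listenBlocks rule M (R ρ) c ρ γ.1 - 1)
    (Finset.mem_range.2 (by omega)) ⟨Nat.sub_lt h2 one_pos, ?_⟩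
  have h4 : ((listenBlocks rule M (R ρ) c ρ γ.1 - 1 : ℕ) : ℝ) + 1 =
      listenBlocks rule M (R ρ) c ρ γ.1 := by
    exact_mod_cast Nat.sub_add_cancel h2
  change mutualInfo ρ _ γ.2.1 γ.2.1 γ.2.2 ≤ _
  rw [h4]
  exact hγ

/-- Outage occurs when the relay listens to at least `k + 1` sub-blocks, for the cheapest `k`, and
the gains to the destination are in outage already for `k + 1` sub-blocks. -/
lemma exponentLE_destInfo (rule : StartRule) (hr : 0 ≤ r) (hr1 : r ≤ 1)
    (hR : HasMultiplexingGain R r)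
    (hR₀ : 0 < R₀) (hRR : ∀ᶠ ρ in atTop, R₀ ≤ R ρ) (hc : 0 < c) {M : ℕ} (hM : 0 < M) :
    ExponentLE (fun ρ => gainLaw.real
      {γ | destInfo rule M (R ρ) c ρ γ < R ρ * Real.log 2}) (diversity rule r M) := by
  have hM' : (0 : ℝ) < M := by exact_mod_cast hM
  obtain ⟨k, hk, hd⟩ := exists_diversity_eq rule r hM
  have hk' : (k + 1 : ℝ) ≤ M := by exact_mod_cast hk
  rw [hd]
  have hlog := Real.log_pos one_lt_two
  refine ((exponentLE_listen rule hR hR₀ hRR hc hM hk).mul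
    (exponentLE_mutualInfo (tendsto_log_rate hR) hr hr1 (mul_pos hR₀ hlog)
      (by filter_upwards [hRR] with ρ h using mul_le_mul_of_nonneg_right h hlog.le)
      (by positivity) ((div_le_one hM').2 hk'))).mono ?_
  filter_upwards [eventually_gt_atTop 0] with ρ hρ
  rw [← measureReal_prod_prod]
  refine measureReal_mono fun γ hγ => ?_
  have h1 : k < listenBlocks rule M (R ρ) c ρ γ.1 := hγ.1
  have h2 : mutualInfo ρ ((k + 1 : ℝ) / M) γ.2.1 γ.2.1 γ.2.2 < R ρ * Real.log 2 := hγ.2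
  refine lt_of_le_of_lt (mutualInfo_anti hρ.le ?_ _ _) h2
  gcongr
  exact_mod_cast h1

end Outage

/-- The diversity gain for long sub-blocks. -/
lemma exists_threshold_hasDiversityGain (rule : StartRule) {σv2 σw2 r R₀ : ℝ} (hv : 0 < σv2)
    (hw : 0 < σw2) (hr : 0 ≤ r) (hr1 : r ≤ 1) {R : ℝ → ℝ} (hR : HasMultiplexingGain R r)
    (hR₀ : 0 < R₀) (hRR : ∀ᶠ ρ in atTop, R₀ ≤ R ρ) {M : ℕ} (hM : 0 < M) :
    ∃ T₀ : ℝ → ℕ, ∀ T : ℝ → ℕ, (∀ ρ, Even (T ρ) ∧ T₀ ρ ≤ T ρ) →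
      HasDiversityGain (fun ρ => errorProb rule σv2 σw2 M (T ρ) (R ρ) ρ)
        (diversity rule r M) := by
  have hc : 0 < σv2 / σw2 := by positivity
  set P : ℝ → ℝ := fun ρ => gainLaw.real
    {γ | destInfo rule M (R ρ) (σv2 / σw2) ρ γ < R ρ * Real.log 2} with hP
  set Q : ℝ → ℝ := fun ρ => gainLaw.real
    {γ | destInfo rule M (R ρ) (σv2 / σw2) ρ γ ≤ R ρ * Real.log 2} with hQ
  have hPle := exponentLE_destInfo rule hr hr1 hR hR₀ hRR hc hM
  have hQge := exponentGE_destInfo rule hr hR hR₀ hRR hc hM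
  have hPQ : ∀ ρ, P ρ ≤ Q ρ := fun ρ =>
    measureReal_mono (Set.ofPred_subset_ofPred.2 fun _ => le_of_lt)
  -- The tolerance must be small compared with `P ρ`, which is positive for all large `ρ`.
  have hthr : ∀ ρ, ∃ T₀ : ℕ, 0 < ρ → 0 < R ρ → 0 < P ρ → ∀ T : ℕ, Even T → T₀ ≤ T →
      P ρ - P ρ / 2 ≤ errorProb rule σv2 σw2 M T (R ρ) ρ ∧
        errorProb rule σv2 σw2 M T (R ρ) ρ ≤ Q ρ + P ρ / 2 := by
    intro ρ
    by_cases h : 0 < ρ ∧ 0 < R ρ ∧ 0 < P ρ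
    · obtain ⟨T₀, hT₀⟩ := exists_subblock_threshold rule hv hw h.1 h.2.1 hM (half_pos h.2.2)
      exact ⟨T₀, fun _ _ _ => hT₀⟩
    · exact ⟨0, fun h1 h2 h3 => absurd ⟨h1, h2, h3⟩ h⟩
  choose T₀ hT₀ using hthr
  refine ⟨T₀, fun T hT => ?_⟩
  have hev : ∀ᶠ ρ in atTop, P ρ - P ρ / 2 ≤ errorProb rule σv2 σw2 M (T ρ) (R ρ) ρ ∧
      errorProb rule σv2 σw2 M (T ρ) (R ρ) ρ ≤ Q ρ + P ρ / 2 := by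
    filter_upwards [eventually_gt_atTop 0, hRR, hPle 1 one_pos] with ρ h1 h2 h3
    exact hT₀ ρ h1 (hR₀.trans_le h2) ((Real.rpow_pos_of_pos h1 _).trans_le h3) _ (hT ρ).1 (hT ρ).2
  refine hasDiversityGain_of_exponents ?_ ?_
  · refine (hQge.add hQge).mono ?_
    filter_upwards [hev] with ρ h
    have h1 := hPQ ρ
    have h2 : 0 ≤ Q ρ := measureReal_nonneg
    change _ ≤ Q ρ + Q ρ
    linarith [h.2]
  · have h := (exponentLE_const (half_pos one_pos)).mul hPle
    rw [zero_add] at h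
    refine h.mono ?_
    filter_upwards [hev] with ρ h
    change 1 / 2 * P ρ ≤ _
    linarith [h.1]

lemma listenExponent_nonneg (rule : StartRule) (r : ℝ) (M k : ℕ) :
    0 ≤ listenExponent rule r M k := by
  unfold listenExponent
  split_ifs
  · exact le_rfl
  · exact le_max_right _ _

lemma tradeoff_le {r : ℝ} (hr1 : r ≤ 1) : tradeoff r ≤ 2 * (1 - r) := by
  unfold tradeoff
  split_ifs with h
  · exact le_rfl
  · rw [not_le] at h
    rw [div_le_iff₀ (by linarith)]
    nlinarith

/-- The tradeoff is an upper bound: consider outage after the first sub-block if `r ≤ 1 / 2`, and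
after a fraction `r` of the codeword otherwise. -/
lemma diversity_le_tradeoff (rule : StartRule) {r : ℝ} (hr1 : r ≤ 1) {M : ℕ}
    (hM : 2 ≤ M) : diversity rule r M ≤ tradeoff r := by
  have hM' : (2 : ℝ) ≤ M := by exact_mod_cast hM
  unfold tradeoff
  split_ifs with h
  -- With `k = 0` the relay need not be slow: both gains to the destination are weak.
  · refine (diversity_le rule r (show 0 < M by omega)).trans (le_of_eq ?_)
    rw [listenExponent, if_pos (Or.inl rfl), outageExponent, if_pos, zero_add]
    rw [div_le_iff₀ (by linarith)]
    push_cast; linarith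
  · rw [not_le] at h
    -- Just enough sub-blocks for the relay's channel to support the rate.
    have hMr : 0 < (M : ℝ) * r := mul_pos (by linarith) (by linarith)
    have hm0 : 0 < ⌈(M : ℝ) * r⌉₊ := Nat.ceil_pos.2 hMr
    have hmM : ⌈(M : ℝ) * r⌉₊ ≤ M := Nat.ceil_le.2 (by nlinarith)
    obtain ⟨k, hk⟩ := Nat.exists_eq_succ_of_ne_zero hm0.ne'
    rw [Nat.succ_eq_add_one] at hk
    have hkr : (k : ℝ) < M * r := Nat.lt_ceil.1 (by omega)
    have hrk : (M : ℝ) * r ≤ k + 1 := by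
      have := Nat.le_ceil ((M : ℝ) * r)
      rw [hk] at this
      exact_mod_cast this
    refine (diversity_le rule r (show k < M by omega)).trans ?_
    have h1 : listenExponent rule r M k = 0 := by
      unfold listenExponent
      split_ifs with hk'
      · rfl
      · rw [not_or] at hk'
        have hk0 : (0 : ℝ) < k := by exact_mod_cast Nat.pos_of_ne_zero hk'.1
        refine max_eq_right ?_
        rw [sub_nonpos, div_mul_eq_mul_div, le_div_iff₀ hk0]
        linarith
    have h2 : r ≤ (k + 1 : ℝ) / M := by rw [le_div_iff₀ (by linarith)]; linarith
    rw [h1, zero_add, outageExponent, if_neg (by linarith), if_pos (by linarith)]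
    exact div_le_div_of_nonneg_left (by linarith) (by linarith) h2

/-- The cost of an outage in the limit of many sub-blocks is at least the tradeoff, at every
listening fraction `l`. -/
lemma tradeoff_le_limit {r l : ℝ} (hr : 0 ≤ r) (hr1 : r ≤ 1) (hl : 1 / 2 < l) (hl1 : l ≤ 1) :
    tradeoff r ≤ max (1 - r / l) 0 + outageExponent r l := by
  have hl0 : 0 < l := by linarith
  rw [outageExponent, if_neg (not_le.2 hl)]
  have m1 := le_max_left (1 - r / l) 0
  have m2 := le_max_right (1 - r / l) 0
  unfold tradeoff
  split_ifs with h1 h2 h2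
  · have : 1 - r / l + (1 - r) / l = 1 + (1 - 2 * r) / l := by field_simp; ring
    have : 1 - 2 * r ≤ (1 - 2 * r) / l := le_div_self (by linarith) hl0 hl1
    linarith
  · rw [not_le] at h2
    have hl1' : 0 < 1 - l := by linarith
    have e : r / l + r / (1 - l) = r / (l * (1 - l)) := by field_simp; ring
    have : r / (l * (1 - l)) ≤ 1 + 2 * r := by
      rw [div_le_iff₀ (by positivity)]
      have a1 : r * (1 - r) ≤ l * (1 - l) := by nlinarith
      have a2 := mul_le_mul_of_nonneg_left a1 (show 0 ≤ 1 + 2 * r by linarith)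
      have a3 : 0 ≤ r * (r * (1 - 2 * r)) := mul_nonneg hr (mul_nonneg hr (by linarith))
      nlinarith
    linarith
  · rw [not_le] at h1
    have hr0 : 0 < r := by linarith
    rcases le_total r l with h | h
    · have e1 : 1 - r / l + (1 - r) / l = 1 - (2 * r - 1) / l := by field_simp; ring
      have e2 : 1 - (2 * r - 1) / r = (1 - r) / r := by field_simp; ring
      have e3 : (2 * r - 1) / l ≤ (2 * r - 1) / r :=
        div_le_div_of_nonneg_left (by linarith) hr0 h
      linarith
    · have : (1 - r) / r ≤ (1 - r) / l := div_le_div_of_nonneg_left (by linarith) hl0 h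
      linarith
  · rw [not_le] at h1 h2
    linarith

/-- Near `l = 1 / 2` the outage exponent is close to `2 * (1 - r)`. -/
lemma le_outageExponent_near_half {r l x : ℝ} (hr : 0 ≤ r) (hr1 : r ≤ 1) (hl : 1 / 2 < l)
    (hx : x ≤ 1 / 4) (hlx : l ≤ 1 / 2 + x) : 2 * (1 - r) - 8 * x ≤ outageExponent r l := by
  have hl0 : 0 < l := by linarith
  have hx0 : 0 < x := by linarith
  rw [outageExponent, if_neg (not_le.2 hl)]
  split_ifs with h
  · rw [le_div_iff₀ hl0]
    nlinarith
  · rw [not_le] at h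
    have hl1 : 0 < 1 - l := by linarith
    have : r / (1 - l) ≤ 2 * r + 8 * x := by
      rw [div_le_iff₀ hl1]
      nlinarith
    linarith

lemma tradeoff_sub_le_diversity (rule : StartRule) {r : ℝ} (hr : 0 ≤ r) (hr1 : r ≤ 1) {M : ℕ}
    (hM : 4 ≤ M) : tradeoff r - 8 * (1 / M) ≤ diversity rule r M := by
  have hM' : (4 : ℝ) ≤ M := by exact_mod_cast hM
  have hM0 : (0 : ℝ) < M := by linarith
  have hx0 : (0 : ℝ) < 1 / M := by positivity
  have hx : (1 : ℝ) / M ≤ 1 / 4 := one_div_le_one_div_of_le (by norm_num) hM'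
  obtain ⟨k, hk, hd⟩ := exists_diversity_eq rule r (show 0 < M by omega)
  rw [hd]
  have hk' : (k + 1 : ℝ) ≤ M := by exact_mod_cast hk
  set l : ℝ := (k + 1 : ℝ) / M with hl
  have hl1 : l ≤ 1 := (div_le_one hM0).2 hk'
  have hkl : (k : ℝ) / M = l - 1 / M := by rw [hl]; ring
  have he := listenExponent_nonneg rule r M k
  have ht := tradeoff_le hr1
  by_cases h : l ≤ 1 / 2
  · have : outageExponent r l = 2 * (1 - r) := if_pos h
    linarith
  rw [not_le] at h
  by_cases hwait : k = 0 ∨ k < rule.minWait M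
  -- Here listening costs nothing, but `l` exceeds `1 / 2` by at most one sub-block.
  · have hk2 : (k : ℝ) / M ≤ 1 / 2 := by
      rcases hwait with hw | hw
      · rw [hw]; norm_num
      · cases rule with
        | anytime => exact absurd hw (Nat.not_lt_zero k)
        | secondHalf =>
          have := Nat.lt_ceil.1 hw
          rw [div_le_iff₀ hM0]
          linarith
    have := le_outageExponent_near_half hr hr1 h hx (by linarith)
    linarith
  · rw [listenExponent, if_neg hwait]
    rw [not_or] at hwait
    have hk0 : (0 : ℝ) < k := by exact_mod_cast Nat.pos_of_ne_zero hwait.1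
    have hMk : (M : ℝ) / k = 1 / (l - 1 / M) := by rw [← hkl, one_div_div]
    have hy : 0 < l - 1 / M := by linarith
    -- Replacing `k` by `k + 1` in the listening exponent changes it by at most `8 / M`.
    have h1 : (M : ℝ) / k * r ≤ r / l + 8 * (1 / M) := by
      have e : 1 / (l - 1 / M) - 1 / l = (1 / M) / (l * (l - 1 / M)) := by
        have := hy.ne'
        have hl0 : l ≠ 0 := by linarith
        rw [div_sub_div _ _ this hl0, mul_comm (l - 1 / M) l]
        congr 1
        ring
      have e2 : (1 / M : ℝ) / (l * (l - 1 / M)) ≤ 8 * (1 / M) := by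
        rw [div_le_iff₀ (by positivity)]
        have : (1 : ℝ) / 8 ≤ l * (l - 1 / M) := by nlinarith
        nlinarith
      rw [hMk]
      have e3 : 1 / (l - 1 / M) * r ≤ (1 / l + 8 * (1 / M)) * r :=
        mul_le_mul_of_nonneg_right (by linarith) hr
      have e4 : 1 / l * r = r / l := by ring
      nlinarith
    have h2 := tradeoff_le_limit hr hr1 h hl1
    have h3 : max (1 - r / l) 0 ≤ max (1 - M / k * r) 0 + 8 * (1 / M) := by
      refine max_le ?_ ?_
      · have := le_max_left (1 - M / k * r) 0
        linarith
      · have := le_max_right (1 - M / k * r) 0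
        linarith
    linarith

lemma tendsto_diversity (rule : StartRule) {r : ℝ} (hr : 0 ≤ r) (hr1 : r ≤ 1) :
    Tendsto (diversity rule r) atTop (𝓝 (tradeoff r)) := by
  have h : Tendsto (fun M : ℕ => tradeoff r - 8 * (1 / (M : ℝ))) atTop (𝓝 (tradeoff r)) := by
    have := (tendsto_one_div_atTop_nhds_zero_nat (𝕜 := ℝ)).const_mul 8
    simpa using this.const_sub (tradeoff r)
  refine tendsto_of_tendsto_of_tendsto_of_le_of_le' h tendsto_const_nhds ?_ ?_
  · filter_upwards [eventually_ge_atTop 4] with M hM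
    exact tradeoff_sub_le_diversity rule hr hr1 hM
  · filter_upwards [eventually_ge_atTop 2] with M hM
    exact diversity_le_tradeoff rule hr1 hM

end DDF

end

theorem lemma1 (rule : DDF.StartRule) (σv2 σw2 : ℝ) (hv : 0 < σv2) (hw : 0 < σw2)
    (r : ℝ) (hr0 : 0 ≤ r) (hr1 : r ≤ 1)
    (R : ℝ → ℝ) (hR : DDF.HasMultiplexingGain R r)
    (hRpos : ∃ R₀ : ℝ, 0 < R₀ ∧ ∀ᶠ ρ in atTop, R₀ ≤ R ρ) :
    ∃ d : ℕ → ℝ,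
      (∀ M : ℕ, 0 < M → ∃ T₀ : ℝ → ℕ, ∀ T : ℝ → ℕ,
        (∀ ρ, Even (T ρ) ∧ T₀ ρ ≤ T ρ) →
          DDF.HasDiversityGain
            (fun ρ => DDF.errorProb rule σv2 σw2 M (T ρ) (R ρ) ρ) (d M)) ∧
      Tendsto d atTop (𝓝 (DDF.tradeoff r)) := by
  obtain ⟨R₀, hR₀, hRR⟩ := hRpos
  exact ⟨DDF.diversity rule r, fun M hM =>
    DDF.exists_threshold_hasDiversityGain rule hv hw hr0 hr1 hR hR₀ hRR hM,
    DDF.tendsto_diversity rule hr0 hr1⟩
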